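/- Let $K$ be a field of characteristic $0$ and $\mathfrak g$ a finite-dimensional simple Lie algebra over $K$ with a splitting Cartan subalgebra (for instance $K=\mathbb C$ and any Cartan subalgebra), a choice of simple roots $\alpha_1,\dots,\alpha_r$, and highest root $\theta$. Let $A=(A_{ij})_{i,j=0,\dots,r}$, $A_{ij}=\langle\alpha_j,\alpha_i^\vee\rangle$, be the Cartan matrix of the untwisted affine extension $\mathfrak g^+$ (where $\alpha_0$, $\alpha_0^\vee$ pair as $-\theta$, $-\theta^\vee$). Let $B=(B_{ij})_{i,j=-2,\dots,r}$ be given by $B_{ij}=A_{ij}$ for $i,j\ge 0$, $B_{-1,-1}=2$, $B_{-1,0}=B_{0,-1}=-1$, $B_{-1,j}=B_{j,-1}=0$ for $j\ge1$, $B_{-2,-2}=0$, $B_{-2,-1}=B_{-1,-2}=-1$, $B_{-2,j}=B_{j,-2}=0$ for $j\geq 0$; the block $i,j\ge -1$ is the Cartan matrix of the over-extension $\mathfrak g^{++}$. Let $\tilde S(\mathfrak g^{++})$ be the Lie superalgebra over $K$ with odd generators $e_{-2}=\epsilon_{-2}$ and $\phi_{-2,i}$ ($0\le i\le r$) and even generators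 $e_i,f_i,h_i$ ($-1\le i\le r$), subject to the following relations, in which every index takes all values for which the generators involved exist, except where it is restricted: $$[h_i,e_j]=B_{ij}e_j,\quad [h_i,f_j]=-B_{ij}f_j,\quad [e_i,f_j]=\delta_{ij}h_j,$$ $$(\mathrm{ad}\,e_i)^{1-B_{ij}}(e_j)=(\mathrm{ad}\,f_i)^{1-B_{ij}}(f_j)=0\quad(\text{for }B_{ij}\le 0),$$ $$[e_{-2},\phi_{-2,i}]=h_i,\quad [h_i,\phi_{-2,j}]=-B_{i,-2}\,\phi_{-2,j},\quad [e_i,[f_j,\phi_{-2,k}]]=\delta_{ij}B_{kj}\,\phi_{-2,j}\ \ (i,j\ge0),$$ $$[e_{-1},\phi_{-2,i}]=[f_{-1},[f_{-1},\phi_{-2,i}]]=0,$$ $$[\phi_{-2,i},\phi_{-2,j}]=0,\qquad [\phi_{-2,i},[\phi_{-2,j},f_{-1}]]=0\ \ (i,j\ge1).$$ It is $\mathbb Z^{r+3}$-graded: for each node $i$, $e_i$ has degree $1$ and $f_i$ (respectively all $\phi_{-2,j}$ if $i=-2$) degree $-1$, all other generators having degree $0$. The tensor hierarchy algebra $S(\mathfrak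 g^{++})$ is the quotient of $\tilde S(\mathfrak g^{++})$ by its maximal graded ideal that intersects the subalgebra of multidegree $(0,\dots,0)$ trivially, i.e. by the sum of all graded ideals with this property. In $S(\mathfrak g^{++})$ let $e_\theta$ be a highest root vector of $\mathfrak g$, i.e. an element of the subalgebra generated by $e_1,\dots,e_r$ with $[h_i,e_\theta]=\langle\theta,\alpha_i^\vee\rangle e_\theta$ and $[e_i,e_\theta]=0$ for $i=1,\dots,r$. Let the nodes be numbered so that node $1$ is adjacent to the affine node $0$ (if two nodes are adjacent to it, node $1$ is either of them), and put $$J=[\epsilon_{-2},[e_{-1},[e_0,[e_\theta,[f_{-1},\phi_{-2,1}]]]]].$$ Then $$[J,[e_{-1},J]]=0 .$$ -/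

import Mathlib

noncomputable section

namespace TensorHierarchy

/-! ### Algebras with a bilinear bracket: ideals, quotients, generated subalgebras -/

section Bracket

variable {K L : Type*} [Field K] [AddCommGroup L] [Module K L]

/-- A two-sided ideal of a vector space `L` with a bilinear bracket `β`. -/
def IsIdeal (β : L →ₗ[K] L →ₗ[K] L) (I : Submodule K L) : Prop :=
  ∀ x ∈ I, ∀ y : L, β x y ∈ I ∧ β y x ∈ I

/-- The bracket induced on the quotient by an ideal: `[x + I, y + I] = [x, y] + I`. -/
def quotientBracket (β : L →ₗ[K] L →ₗ[K] L) (I : Submodule K L) (hI : IsIdeal β I) :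
    (L ⧸ I) →ₗ[K] (L ⧸ I) →ₗ[K] (L ⧸ I) :=
  (I.liftQ (I.liftQ (β.compr₂ I.mkQ)
      (fun x hx => LinearMap.ext fun y =>
        (Submodule.Quotient.mk_eq_zero I).2 (hI x hx y).1)).flip
    (fun y hy => LinearMap.ext fun q => by
      obtain ⟨x, rfl⟩ := I.mkQ_surjective q
      exact (Submodule.Quotient.mk_eq_zero I).2 (hI y hy x).2)).flip

theorem quotientBracket_mk (β : L →ₗ[K] L →ₗ[K] L) (I : Submodule K L) (hI : IsIdeal β I)
    (x y : L) : quotientBracket β I hI (I.mkQ x) (I.mkQ y) = I.mkQ (β x y) := rfl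

theorem isIdeal_sInf (β : L →ₗ[K] L →ₗ[K] L) (s : Set (Submodule K L))
    (hs : ∀ I ∈ s, IsIdeal β I) : IsIdeal β (sInf s) := by
  intro x hx y
  rw [Submodule.mem_sInf] at hx
  constructor <;> rw [Submodule.mem_sInf] <;> intro I hI
  · exact (hs I hI x (hx I hI) y).1
  · exact (hs I hI x (hx I hI) y).2

theorem isIdeal_sSup (β : L →ₗ[K] L →ₗ[K] L) (s : Set (Submodule K L))
    (hs : ∀ I ∈ s, IsIdeal β I) : IsIdeal β (sSup s) := by
  intro x hx y
  constructor
  · have h : sSup s ≤ (sSup s).comap (β.flip y) :=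
      sSup_le fun I hI z hz => (le_sSup hI : I ≤ sSup s) (hs I hI z hz y).1
    exact h hx
  · have h : sSup s ≤ (sSup s).comap (β y) :=
      sSup_le fun I hI z hz => (le_sSup hI : I ≤ sSup s) (hs I hI z hz y).2
    exact h hx

/-- The subalgebra generated by a set, i.e. the smallest subspace that contains the set and is
closed under the bracket. -/
def generatedSubalgebra (β : L →ₗ[K] L →ₗ[K] L) (s : Set L) : Submodule K L :=
  sInf {V | s ⊆ V ∧ ∀ x ∈ V, ∀ y ∈ V, β x y ∈ V}

end Bracket

/-! ### Nodes of the Dynkin diagrams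

`I` stands for the set of nodes `1, …, r` of a finite-dimensional simple Lie algebra. -/

/-- The nodes `0, 1, …, r` of the affine extension; `none` is the affine node `0`. -/
abbrev AffineNode (I : Type*) := Option I

/-- The nodes `-1, 0, …, r` of the over-extension; `none` is the node `-1`. -/
abbrev OverNode (I : Type*) := Option (AffineNode I)

/-- The nodes `-2, -1, …, r` of the super-extension; `none` is the fermionic node `-2`. -/
abbrev SuperNode (I : Type*) := Option (OverNode I)

/-- Extend a Cartan matrix whose rows and columns are indexed by `Option J` by one further node
`none`, with diagonal entry `d`, which is connected by a single line to the node `some none` and to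
no other node. -/
def addNode {J : Type*} (d : ℤ) (A : Matrix (Option J) (Option J) ℤ) :
    Matrix (Option (Option J)) (Option (Option J)) ℤ := fun i j =>
  match i, j with
  | none, none => d
  | none, some none => -1
  | none, some (some _) => 0
  | some none, none => -1
  | some (some _), none => 0
  | some i, some j => A i j

/-- The Cartan matrix of the over-extension, given the one of the affine extension. -/
def overCartan {I : Type*} (A : Matrix (AffineNode I) (AffineNode I) ℤ) :
    Matrix (OverNode I) (OverNode I) ℤ :=
  addNode 2 A

/-- The Cartan matrix `B` of the super-extension of the over-extension: the fermionic node has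
diagonal entry `0`. -/
def superCartan {I : Type*} (A : Matrix (AffineNode I) (AffineNode I) ℤ) :
    Matrix (SuperNode I) (SuperNode I) ℤ :=
  addNode 0 (overCartan A)

/-! ### The tensor hierarchy algebra by generators and relations -/

/-- The generators of the tensor hierarchy algebra; `e none = ε₋₂` and the `φ i = φ_{-2,i}` are odd,
all others are even. -/
inductive Gen (I : Type*)
  | e (i : SuperNode I)
  | f (i : OverNode I)
  | h (i : OverNode I)
  | φ (i : AffineNode I)

variable {I : Type*}

/-- The multidegree of a generator, one component for each node. -/
def Gen.degree : Gen I → (SuperNode I →₀ ℤ)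
  | .e i => Finsupp.single i 1
  | .f i => -Finsupp.single (some i) 1
  | .h _ => 0
  | .φ _ => -Finsupp.single none 1

/-- The multidegree of a bracket monomial in the generators. -/
def degree : FreeMagma (Gen I) → (SuperNode I →₀ ℤ)
  | .of x => x.degree
  | .mul u v => degree u + degree v

/-- The level of a bracket monomial: the degree with respect to the fermionic node. The parity of
a monomial is the parity of its level. -/
def level (u : FreeMagma (Gen I)) : ℤ := degree u none

variable (K : Type*) [Field K]

/-- The sign `(-1)^{|u||v|}`. -/
def koszulSign (u v : FreeMagma (Gen I)) : K :=
  if Odd (level u) ∧ Odd (level v) then -1 else 1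

variable (I) in
/-- The free non-associative algebra on the generators; its product is denoted `⁅x, y⁆` below. -/
abbrev FreeAlg := FreeNonUnitalNonAssocAlgebra K (Gen I)

/-- The bracket monomial `u` as an element of the free non-associative algebra. -/
def mon (u : FreeMagma (Gen I)) : FreeAlg I K := MonoidAlgebra.single u 1

variable (I) in
/-- The product of the free non-associative algebra as a bilinear map. -/
def freeBracket : FreeAlg I K →ₗ[K] FreeAlg I K →ₗ[K] FreeAlg I K :=
  LinearMap.mul K (FreeAlg I K)

local instance : Bracket (FreeAlg I K) (FreeAlg I K) := ⟨fun x y => freeBracket I K x y⟩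

/-- A generator as an element of the free non-associative algebra. -/
def gen (x : Gen I) : FreeAlg I K := FreeNonUnitalNonAssocAlgebra.of K x

variable (A : Matrix (AffineNode I) (AffineNode I) ℤ)

open Gen in
/-- The elements that are set to zero: the super-antisymmetry and super-Jacobi identities, followed
by the defining relations. -/
inductive Rel : FreeAlg I K → Prop
  | antisymm (u v : FreeMagma (Gen I)) :
      Rel (⁅mon K u, mon K v⁆ + koszulSign K u v • ⁅mon K v, mon K u⁆)
  | jacobi (u v w : FreeMagma (Gen I)) :
      Rel (⁅mon K u, ⁅mon K v, mon K w⁆⁆ - ⁅⁅mon K u, mon K v⁆, mon K w⁆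
        - koszulSign K u v • ⁅mon K v, ⁅mon K u, mon K w⁆⁆)
  | h_e (i : OverNode I) (j : SuperNode I) :
      Rel (⁅gen K (h i), gen K (e j)⁆ - (superCartan A (some i) j : K) • gen K (e j))
  | h_f (i j : OverNode I) :
      Rel (⁅gen K (h i), gen K (f j)⁆ + (superCartan A (some i) (some j) : K) • gen K (f j))
  | e_f_same (i : OverNode I) :
      Rel (⁅gen K (e (some i)), gen K (f i)⁆ - gen K (h i))
  | e_f_ne (i : SuperNode I) (j : OverNode I) (hij : i ≠ some j) :
      Rel ⁅gen K (e i), gen K (f j)⁆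
  | serre_e (i j : SuperNode I) (hij : superCartan A i j ≤ 0) :
      Rel ((fun x => ⁅gen K (e i), x⁆)^[(1 - superCartan A i j).toNat] (gen K (e j)))
  | serre_f (i j : OverNode I) (hij : superCartan A (some i) (some j) ≤ 0) :
      Rel ((fun x => ⁅gen K (f i), x⁆)^[(1 - superCartan A (some i) (some j)).toNat]
        (gen K (f j)))
  | ε_φ (i : AffineNode I) :
      Rel (⁅gen K (e none : Gen I), gen K (φ i)⁆ - gen K (h (some i)))
  | h_φ (i : OverNode I) (j : AffineNode I) :
      Rel (⁅gen K (h i), gen K (φ j)⁆ + (superCartan A (some i) none : K) • gen K (φ j))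
  | e_f_φ_same (i k : AffineNode I) :
      Rel (⁅gen K (e (some (some i))), ⁅gen K (f (some i)), gen K (φ k)⁆⁆
        - (superCartan A (some (some k)) (some (some i)) : K) • gen K (φ i))
  | e_f_φ_ne (i j k : AffineNode I) (hij : i ≠ j) :
      Rel ⁅gen K (e (some (some i))), ⁅gen K (f (some j)), gen K (φ k)⁆⁆
  | e_φ (i : AffineNode I) :
      Rel ⁅gen K (e (some none) : Gen I), gen K (φ i)⁆
  | f_f_φ (i : AffineNode I) :
      Rel ⁅gen K (f none : Gen I), ⁅gen K (f none : Gen I), gen K (φ i)⁆⁆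
  | φ_φ (i j : AffineNode I) :
      Rel ⁅gen K (φ i), gen K (φ j)⁆
  | φ_φ_f (i j : I) :
      Rel ⁅gen K (φ (some i)), ⁅gen K (φ (some j)), gen K (f none : Gen I)⁆⁆

/-- The ideal generated by the relations. -/
def relIdeal : Submodule K (FreeAlg I K) :=
  sInf {V | IsIdeal (freeBracket I K) V ∧ ∀ x, Rel K A x → x ∈ V}

theorem isIdeal_relIdeal : IsIdeal (freeBracket I K) (relIdeal K A) :=
  isIdeal_sInf _ _ fun _ h => h.1

/-- The Lie superalgebra `S̃(𝔤⁺⁺)` given by the generators and relations. -/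
abbrev TildeS := FreeAlg I K ⧸ relIdeal K A

/-- The bracket of `S̃(𝔤⁺⁺)`. -/
def tildeBracket : TildeS K A →ₗ[K] TildeS K A →ₗ[K] TildeS K A :=
  quotientBracket (freeBracket I K) (relIdeal K A) (isIdeal_relIdeal K A)

/-- The subspace of `S̃(𝔤⁺⁺)` of a given multidegree. -/
def homogeneousPart (d : SuperNode I →₀ ℤ) : Submodule K (TildeS K A) :=
  Submodule.span K {x | ∃ u : FreeMagma (Gen I), degree u = d ∧ x = (relIdeal K A).mkQ (mon K u)}

/-- Graded ideals of `S̃(𝔤⁺⁺)` that intersect the subalgebra of multidegree `0` trivially. -/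
def IsAvoidingIdeal (V : Submodule K (TildeS K A)) : Prop :=
  IsIdeal (tildeBracket K A) V ∧
    (V = ⨆ d, V ⊓ homogeneousPart K A d) ∧
    V ⊓ homogeneousPart K A 0 = ⊥

/-- The maximal graded ideal of `S̃(𝔤⁺⁺)` that intersects the subalgebra of multidegree `0`
trivially, namely the sum of all ideals with this property. -/
def maxIdeal : Submodule K (TildeS K A) := sSup {V | IsAvoidingIdeal K A V}

theorem isIdeal_maxIdeal : IsIdeal (tildeBracket K A) (maxIdeal K A) :=
  isIdeal_sSup _ _ fun _ h => h.1

/-- The tensor hierarchy algebra `S(𝔤⁺⁺)`, where `A` is the Cartan matrix of `𝔤⁺`. -/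
def S : Type _ := TildeS K A ⧸ maxIdeal K A

instance : AddCommGroup (S K A) := inferInstanceAs (AddCommGroup (TildeS K A ⧸ maxIdeal K A))

instance : Module K (S K A) := inferInstanceAs (Module K (TildeS K A ⧸ maxIdeal K A))

/-- The bracket of `S(𝔤⁺⁺)` as a bilinear map. -/
def bracket : S K A →ₗ[K] S K A →ₗ[K] S K A :=
  quotientBracket (tildeBracket K A) (maxIdeal K A) (isIdeal_maxIdeal K A)

instance : Bracket (S K A) (S K A) := ⟨fun x y => bracket K A x y⟩

/-- A generator as an element of `S(𝔤⁺⁺)`. -/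
def toS (x : Gen I) : S K A := (maxIdeal K A).mkQ ((relIdeal K A).mkQ (gen K x))

variable {K A}

/-- `J = [ε₋₂, e₋₁, e₀, e_θ, f₋₁, φ_{-2,i}]` with `[x, y, …, z, w] = [x, [y, […, [z, w]]]]`. -/
def lowestState (i : I) (eθ : S K A) : S K A :=
  ⁅toS K A (.e none), ⁅toS K A (.e (some none)), ⁅toS K A (.e (some (some none))), ⁅eθ,
    ⁅toS K A (.f none), toS K A (.φ (some i))⁆⁆⁆⁆⁆

/-! ### The affine Cartan matrix and the highest root vector -/

section RootData

variable {ι R M N : Type*} [CommRing R] [AddCommGroup M] [Module R M] [AddCommGroup N] [Module R N]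
  {P : RootPairing ι R M N}

/-- `θ` is the highest root: its difference with any root is a sum of simple roots. -/
def IsHighestRoot (b : P.Base) (θ : ι) : Prop :=
  ∀ β : ι, P.root θ - P.root β ∈ AddSubmonoid.closure (P.root '' b.support)

/-- The Cartan matrix of the untwisted affine extension, in the convention
`A i j = ⟨α_j, α_i^∨⟩`, where `α_0` pairs with the other simple roots and coroots as `-θ` does. -/
def affineCartan [P.IsCrystallographic] (b : P.Base) (θ : ι) :
    Matrix (AffineNode b.support) (AffineNode b.support) ℤ := fun i j =>
  match i, j with
  | none, none => 2
  | none, some j => -P.pairingIn ℤ j θ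
  | some i, none => -P.pairingIn ℤ θ i
  | some i, some j => P.pairingIn ℤ j i

/-- `x` is a highest root vector of the copy of `𝔤` in `S(𝔤⁺⁺)`: it lies in the subalgebra generated
by the raising operators `e_1, …, e_r` of `𝔤`, it has weight `θ`, and it is annihilated by
`e_1, …, e_r`. -/
def IsHighestRootVector [P.IsCrystallographic] (b : P.Base) (θ : ι)
    (x : S K (affineCartan b θ)) : Prop :=
  x ∈ generatedSubalgebra (bracket K (affineCartan b θ))
      (Set.range fun i : b.support => toS K (affineCartan b θ) (.e (some (some (some i))))) ∧
    (∀ i : b.support, ⁅toS K (affineCartan b θ) (.h (some (some i))), x⁆ =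
      (P.pairingIn ℤ θ i : K) • x) ∧
    ∀ i : b.support, ⁅toS K (affineCartan b θ) (.e (some (some (some i)))), x⁆ = 0

end RootData

end TensorHierarchy

end

/-! Write ε, E, F, Φ_a for ε₋₂, e₋₁, f₋₁, φ₋₂,ₐ. An ideal of S(𝔤⁺⁺) whose elements all have positive
degree at node 0 has no component of multidegree 0, so it vanishes. It therefore suffices to show
that [J,[E,J]] would generate such an ideal.

The criterion is `Grading.eq_bot_of_L0`. Let L0 be the subalgebra generated by all generators except
e₀ and f₀, and let X be an L0-stable space of positive degree that is killed by f₀. Repeated action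
on X of the L0-module V1 generated by e₀ spans a space stable under all generators. Stability under
f₀ needs [f₀, V1] ⊆ L0. This holds because, modulo Φ₀, elements of L0 can be chosen to commute with
f₀ or to have e₀ as an eigenvector (`L0_le_split`). Hence X = 0.

To use this, L0 must be known explicitly. The Φ_k with k ≥ 1 generate under 𝔤 an odd abelian module
Rg, and the combination Φc of Φ₀ and the Φ_k given by the comarks commutes with the affine
generators. Then L0 is spanned by eight elements together with the spaces [ε,Rg], Rg, [F,Rg] and
[Φc,[F,Rg]]. Closure under the bracket needs one identity that is not a relation, `Good`:
[Φ_k,[F,r]] = [Φc,[F,[h_k,r]]] for r in Rg.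

Put φ = [e_θ,Φ₁] and Y = [e₀,[F,φ]], so that J = [[ε,E],Y]. If [F,φ] = 0, then J = 0. Otherwise
consider j = [[e₀,e_θ],Φ₁]. Its weight θ + α₀ pairs to zero with every simple coroot, so it commutes
with all e_a, f_a and Φ_a, and [F,j] = Y. This yields `Good` for r = φ (`HighestRoot.good`).
`FCore.T_eq_zero` extends it to all of Rg, using that the finite Cartan matrix is nondegenerate and
connected and that no nonzero sum of simple roots is antidominant.

Finally x = [J,[E,J]] is killed by E, F, ε, all f_a, and the e_i and Φ_i with i ≥ 1. With ψ =
[F,Φc], the span of x, Φc·x, ψ·x and Φc·ψ·x satisfies the hypotheses of the criterion, so x = 0. The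
recurrent tool is elementary sl₂ theory: under local nilpotency, a vector of positive weight killed
by f is zero. -/

noncomputable section

namespace TensorHierarchy

/-! ### Lie superalgebras -/

/-- A bracket that is additive in both arguments. -/
class BiadditiveBracket (L : Type*) [AddCommGroup L] [Bracket L L] : Prop where
  add_br (x y z : L) : ⁅x + y, z⁆ = ⁅x, z⁆ + ⁅y, z⁆
  br_add (x y z : L) : ⁅x, y + z⁆ = ⁅x, y⁆ + ⁅x, z⁆

/-- A vector space with a bilinear bracket, together with spaces of even and odd elements for
which the super-antisymmetry and super-Jacobi identities hold. -/
class SuperBracket (K L : Type*) [Field K] [AddCommGroup L] [Module K L] [Bracket L L]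
    [BiadditiveBracket L] where
  ev : Submodule K L
  od : Submodule K L
  smul_br (c : K) (x y : L) : ⁅c • x, y⁆ = c • ⁅x, y⁆
  br_smul (c : K) (x y : L) : ⁅x, c • y⁆ = c • ⁅x, y⁆
  ev_ev {x y : L} : x ∈ ev → y ∈ ev → ⁅x, y⁆ ∈ ev
  ev_od {x y : L} : x ∈ ev → y ∈ od → ⁅x, y⁆ ∈ od
  od_od {x y : L} : x ∈ od → y ∈ od → ⁅x, y⁆ ∈ ev
  anti {x : L} (hx : x ∈ ev) (y : L) : ⁅x, y⁆ = -⁅y, x⁆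
  symm {x y : L} (hx : x ∈ od) (hy : y ∈ od) : ⁅x, y⁆ = ⁅y, x⁆
  jac {x : L} (hx : x ∈ ev) (y z : L) : ⁅x, ⁅y, z⁆⁆ = ⁅⁅x, y⁆, z⁆ + ⁅y, ⁅x, z⁆⁆
  jac_od {x y : L} (hx : x ∈ od) (hy : y ∈ od) (z : L) :
    ⁅x, ⁅y, z⁆⁆ = ⁅⁅x, y⁆, z⁆ - ⁅y, ⁅x, z⁆⁆

section Basic

variable {L : Type*} [AddCommGroup L] [Bracket L L] [BiadditiveBracket L]

theorem add_br (x y z : L) : ⁅x + y, z⁆ = ⁅x, z⁆ + ⁅y, z⁆ := BiadditiveBracket.add_br x y z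

theorem br_add (x y z : L) : ⁅x, y + z⁆ = ⁅x, y⁆ + ⁅x, z⁆ := BiadditiveBracket.br_add x y z

@[simp] theorem br_zero (x : L) : ⁅x, (0 : L)⁆ = 0 := by
  simpa using br_add x 0 0

@[simp] theorem zero_br (x : L) : ⁅(0 : L), x⁆ = 0 := by
  simpa using add_br 0 0 x

@[simp] theorem br_neg (x y : L) : ⁅x, -y⁆ = -⁅x, y⁆ := by
  rw [eq_neg_iff_add_eq_zero, ← br_add]; simp

@[simp] theorem neg_br (x y : L) : ⁅-x, y⁆ = -⁅x, y⁆ := by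
  rw [eq_neg_iff_add_eq_zero, ← add_br]; simp

theorem br_sub (x y z : L) : ⁅x, y - z⁆ = ⁅x, y⁆ - ⁅x, z⁆ := by
  simp [sub_eq_add_neg, br_add]

theorem sub_br (x y z : L) : ⁅x - y, z⁆ = ⁅x, z⁆ - ⁅y, z⁆ := by
  simp [sub_eq_add_neg, add_br]

theorem br_sum {α : Type*} (s : Finset α) (f : α → L) (x : L) :
    ⁅x, ∑ i ∈ s, f i⁆ = ∑ i ∈ s, ⁅x, f i⁆ :=
  map_sum (AddMonoidHom.mk' (fun y => ⁅x, y⁆) (br_add x)) f s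

theorem sum_br {α : Type*} (s : Finset α) (f : α → L) (x : L) :
    ⁅∑ i ∈ s, f i, x⁆ = ∑ i ∈ s, ⁅f i, x⁆ :=
  map_sum (AddMonoidHom.mk' (fun y => ⁅y, x⁆) (fun a b => add_br a b x)) f s

end Basic

section Super

open SuperBracket

variable {K L : Type*} [Field K] [AddCommGroup L] [Module K L] [Bracket L L]
  [BiadditiveBracket L] [SuperBracket K L]

theorem smul_br (c : K) (x y : L) : ⁅c • x, y⁆ = c • ⁅x, y⁆ := SuperBracket.smul_br c x y

theorem br_smul (c : K) (x y : L) : ⁅x, c • y⁆ = c • ⁅x, y⁆ := SuperBracket.br_smul c x y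

theorem od_ev {x y : L} (hx : x ∈ od (K := K)) (hy : y ∈ ev (K := K)) :
    ⁅x, y⁆ ∈ od (K := K) (L := L) := by
  rw [← neg_neg ⁅x, y⁆, ← anti hy]
  exact neg_mem (ev_od hy hx)

theorem jac_od_ev {x y : L} (hy : y ∈ ev (K := K)) (z : L) :
    ⁅x, ⁅y, z⁆⁆ = ⁅⁅x, y⁆, z⁆ + ⁅y, ⁅x, z⁆⁆ := by
  rw [jac hy x z, anti hy x]; simp

/-- Elements that commute act by commuting operators. -/
theorem comm {x y : L} (hx : x ∈ ev (K := K)) (h : ⁅x, y⁆ = 0) (v : L) :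
    ⁅x, ⁅y, v⁆⁆ = ⁅y, ⁅x, v⁆⁆ := by
  rw [jac hx, h]; simp

theorem anticomm {x y : L} (hx : x ∈ od (K := K)) (hy : y ∈ od (K := K)) (h : ⁅x, y⁆ = 0)
    (v : L) : ⁅x, ⁅y, v⁆⁆ = -⁅y, ⁅x, v⁆⁆ := by
  rw [jac_od hx hy, h]; simp

theorem br_eq_zero_symm {x y : L} (hx : x ∈ ev (K := K)) (h : ⁅x, y⁆ = 0) : ⁅y, x⁆ = 0 := by
  rw [anti hx, neg_eq_zero] at h; exact h

theorem br_self {x : L} [CharZero K] (hx : x ∈ ev (K := K)) : ⁅x, x⁆ = 0 := by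
  have h : (2 : K) • ⁅x, x⁆ = 0 := by
    rw [two_smul]; nth_rw 1 [anti hx]; simp
  exact (smul_eq_zero.1 h).resolve_left two_ne_zero

theorem od_sq {x : L} [CharZero K] (hx : x ∈ od (K := K)) (h : ⁅x, x⁆ = 0) (v : L) :
    ⁅x, ⁅x, v⁆⁆ = 0 := by
  have h' : (2 : K) • ⁅x, ⁅x, v⁆⁆ = 0 := by
    rw [two_smul]; nth_rw 1 [jac_od hx hx, h]; simp
  exact (smul_eq_zero.1 h').resolve_left two_ne_zero

/-! ### Weights, local nilpotency and sl₂ -/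

theorem br_of_wt {h x y : L} (hh : h ∈ ev (K := K)) {p q : K} (hx : ⁅h, x⁆ = p • x)
    (hy : ⁅h, y⁆ = q • y) : ⁅h, ⁅x, y⁆⁆ = (p + q) • ⁅x, y⁆ := by
  rw [jac hh, hx, hy, smul_br, br_smul, add_smul]

variable (K) in
/-- The adjoint action of an element. -/
def ad (x : L) : Module.End K L where
  toFun y := ⁅x, y⁆
  map_add' := br_add x
  map_smul' c y := br_smul c x y

@[simp] theorem ad_apply (x y : L) : ad K x y = ⁅x, y⁆ := rfl

variable (K) in
/-- The vectors on which the adjoint action of `x` is nilpotent. -/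
def nil (x : L) : Submodule K L where
  carrier := {v | ∃ N : ℕ, (ad K x ^ N) v = 0}
  zero_mem' := ⟨0, map_zero _⟩
  add_mem' := by
    rintro u v ⟨m, hm⟩ ⟨n, hn⟩
    refine ⟨m + n, ?_⟩
    have h1 : (ad K x ^ (m + n)) u = 0 := by
      rw [add_comm, pow_add, Module.End.mul_apply, hm, map_zero]
    rw [map_add, h1, pow_add, Module.End.mul_apply, hn, map_zero, add_zero]
  smul_mem' := by
    rintro c v ⟨m, hm⟩
    exact ⟨m, by rw [map_smul, hm, smul_zero]⟩

theorem mem_nil_of_br {x v : L} (h : ⁅x, v⁆ ∈ nil K x) : v ∈ nil K x := by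
  obtain ⟨N, hN⟩ := h
  exact ⟨N + 1, by rwa [pow_succ, Module.End.mul_apply]⟩

theorem mem_nil_of_br_eq_zero {x v : L} (h : ⁅x, v⁆ = 0) : v ∈ nil K x :=
  mem_nil_of_br (h ▸ zero_mem _)

/-- The adjoint action of an even element is a derivation, so a high power on a bracket puts a high
power on one of the factors. -/
theorem br_mem_nil {x : L} (hx : x ∈ ev (K := K)) {u v : L} (hu : u ∈ nil K x)
    (hv : v ∈ nil K x) : ⁅u, v⁆ ∈ nil K x := by
  obtain ⟨m, hm⟩ := hu
  obtain ⟨n, hn⟩ := hv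
  induction m generalizing u v n with
  | zero =>
    have : u = 0 := by simpa using hm
    simp [this]
  | succ m ihm =>
    induction n generalizing v with
    | zero =>
      have : v = 0 := by simpa using hn
      simp [this]
    | succ n ihn =>
      apply mem_nil_of_br
      rw [jac hx]
      refine add_mem (ihm (by rwa [pow_succ, Module.End.mul_apply] at hm) (n + 1) hn)
        (ihn (by rwa [pow_succ, Module.End.mul_apply] at hn))

/-- A vector of positive weight that is annihilated by `f` vanishes if `e` acts nilpotently on
it. -/
theorem eq_zero_of_f [CharZero K] {e f h v : L} (he : e ∈ ev (K := K)) (hh : h ∈ ev (K := K))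
    (hef : ⁅e, f⁆ = h) (hhe : ⁅h, e⁆ = (2 : K) • e) (hv : v ∈ nil K e) {m : ℤ} (hm : 0 < m)
    (hf : ⁅f, v⁆ = 0) (hw : ⁅h, v⁆ = (m : K) • v) : v = 0 := by
  obtain ⟨N, hN⟩ := hv
  have hwt (k : ℕ) : ⁅h, (ad K e ^ k) v⁆ = ((m + 2 * k : ℤ) : K) • (ad K e ^ k) v := by
    induction k with
    | zero => simpa using hw
    | succ k ih =>
      rw [pow_succ', Module.End.mul_apply, ad_apply, br_of_wt hh hhe ih]
      congr 1; push_cast; ring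
  -- The standard sl₂ formula. The factor (k + 1)(m + k) is nonzero because m > 0, so e^(k+1) v = 0
  -- descends to e^k v = 0 and finally to v = 0.
  have hfk (k : ℕ) : ⁅f, (ad K e ^ (k + 1)) v⁆ =
      -(((k + 1) * (m + k) : ℤ) : K) • (ad K e ^ k) v := by
    induction k with
    | zero =>
      rw [zero_add, pow_one, ad_apply]
      have := jac he f v
      rw [hf, hef, hw, br_zero] at this
      simp [eq_neg_of_add_eq_zero_right this.symm]
    | succ k ih =>
      have h1 := jac he f ((ad K e ^ (k + 1)) v)
      rw [ih, hef, hwt] at h1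
      rw [pow_succ', Module.End.mul_apply, ad_apply, ← sub_eq_iff_eq_add'.2 h1, br_smul,
        ← ad_apply (K := K) e, ← Module.End.mul_apply, ← pow_succ', ← sub_smul]
      congr 1; push_cast; ring
  induction N with
  | zero => simpa using hN
  | succ k ih =>
    apply ih
    have := hfk k
    rw [hN, br_zero, eq_comm, smul_eq_zero, neg_eq_zero, Int.cast_eq_zero] at this
    refine this.resolve_left ?_
    positivity

/-- A vector of weight zero that is annihilated by `f` is annihilated by `e`. -/
theorem br_e_eq_zero [CharZero K] {e f h v : L} (he : e ∈ ev (K := K)) (hf' : f ∈ ev (K := K))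
    (hh : h ∈ ev (K := K))
    (hef : ⁅e, f⁆ = h) (hhe : ⁅h, e⁆ = (2 : K) • e) (hv : v ∈ nil K e)
    (hf : ⁅f, v⁆ = 0) (hw : ⁅h, v⁆ = 0) : ⁅e, v⁆ = 0 := by
  -- The bracket [e, v] has weight 2, and f sends it to e f v − h v = 0.
  refine eq_zero_of_f (m := 2) he hh hef hhe (br_mem_nil he ?_ hv) (by norm_num) ?_ ?_
  · exact mem_nil_of_br_eq_zero (br_self he)
  · rw [jac hf', hf, anti hf', hef]; simp [hw]
  · rw [jac hh, hw, hhe, smul_br]; simp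

end Super

open SuperBracket

set_option linter.unusedSectionVars false

/-! ### Chevalley relations with a fermionic node -/

section Core

variable {K L J : Type*} [Field K] [AddCommGroup L] [Module K L] [Bracket L L]
  [BiadditiveBracket L] [SuperBracket K L]

variable (K L J) in
/-- Elements of a Lie superalgebra that satisfy the relations of the generators attached to a
Cartan matrix and to the fermionic node. -/
structure Core where
  A : J → J → ℤ
  e : J → L
  f : J → L
  h : J → L
  Φ : J → L
  ε : L
  e_ev (a : J) : e a ∈ ev (K := K)
  f_ev (a : J) : f a ∈ ev (K := K)
  Φ_od (a : J) : Φ a ∈ od (K := K)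
  ε_od : ε ∈ od (K := K)
  A_diag (a : J) : A a a = 2
  h_e (a b : J) : ⁅h a, e b⁆ = (A a b : K) • e b
  h_f (a b : J) : ⁅h a, f b⁆ = -(A a b : K) • f b
  e_f_same (a : J) : ⁅e a, f a⁆ = h a
  e_f_ne {a b : J} : a ≠ b → ⁅e a, f b⁆ = 0
  h_Φ (a b : J) : ⁅h a, Φ b⁆ = 0
  e_f_Φ_same (a k : J) : ⁅e a, ⁅f a, Φ k⁆⁆ = (A k a : K) • Φ a
  e_f_Φ_ne {a b : J} (k : J) : a ≠ b → ⁅e a, ⁅f b, Φ k⁆⁆ = 0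
  ε_e (a : J) : ⁅ε, e a⁆ = 0
  ε_f (a : J) : ⁅ε, f a⁆ = 0
  ε_Φ (a : J) : ⁅ε, Φ a⁆ = h a
  ε_ε : ⁅ε, ε⁆ = 0
  Φ_Φ (a b : J) : ⁅Φ a, Φ b⁆ = 0
  e_nil (a : J) (v : L) : v ∈ nil K (e a)
  f_nil (a : J) (v : L) : v ∈ nil K (f a)

namespace Core

variable (D : Core K L J)

theorem h_ev (a : J) : D.h a ∈ ev (K := K) := D.e_f_same a ▸ ev_ev (D.e_ev a) (D.f_ev a)

theorem f_e_same (a : J) : ⁅D.f a, D.e a⁆ = -D.h a := by rw [anti (D.f_ev a), D.e_f_same]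

theorem f_e_ne {a b : J} (hab : a ≠ b) : ⁅D.f a, D.e b⁆ = 0 :=
  br_eq_zero_symm (D.e_ev b) (D.e_f_ne hab.symm)

/-- `f e v = e f v - h v` -/
theorem f_e_v_same (a : J) (v : L) : ⁅D.f a, ⁅D.e a, v⁆⁆ = ⁅D.e a, ⁅D.f a, v⁆⁆ - ⁅D.h a, v⁆ := by
  rw [jac (D.f_ev a), D.f_e_same, neg_br]; abel

theorem e_f_v_same (a : J) (v : L) : ⁅D.e a, ⁅D.f a, v⁆⁆ = ⁅D.f a, ⁅D.e a, v⁆⁆ + ⁅D.h a, v⁆ := by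
  rw [f_e_v_same]; abel

theorem f_e_v_ne {a b : J} (hab : a ≠ b) (v : L) : ⁅D.f a, ⁅D.e b, v⁆⁆ = ⁅D.e b, ⁅D.f a, v⁆⁆ :=
  comm (D.f_ev a) (D.f_e_ne hab) v

theorem f_e_Φ_same (a k : J) : ⁅D.f a, ⁅D.e a, D.Φ k⁆⁆ = (D.A k a : K) • D.Φ a := by
  rw [f_e_v_same, e_f_Φ_same, h_Φ, sub_zero]

theorem f_e_Φ_ne {a b : J} (k : J) (hab : a ≠ b) : ⁅D.f a, ⁅D.e b, D.Φ k⁆⁆ = 0 := by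
  rw [f_e_v_ne D hab, e_f_Φ_ne D k hab.symm]

theorem e_ε (a : J) : ⁅D.e a, D.ε⁆ = 0 := by rw [anti (D.e_ev a), D.ε_e, neg_zero]

theorem f_ε (a : J) : ⁅D.f a, D.ε⁆ = 0 := by rw [anti (D.f_ev a), D.ε_f, neg_zero]

theorem ε_h (a : J) : ⁅D.ε, D.h a⁆ = 0 := by
  rw [← D.e_f_same, jac_od_ev (D.e_ev a), D.ε_e, D.ε_f]; simp

theorem h_ε (a : J) : ⁅D.h a, D.ε⁆ = 0 := by rw [anti (D.h_ev a), D.ε_h, neg_zero]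

theorem Φ_ε (a : J) : ⁅D.Φ a, D.ε⁆ = D.h a := by rw [symm (D.Φ_od a) D.ε_od, D.ε_Φ]

theorem ε_e_v (a : J) (v : L) : ⁅D.ε, ⁅D.e a, v⁆⁆ = ⁅D.e a, ⁅D.ε, v⁆⁆ :=
  (comm (D.e_ev a) (D.e_ε a) v).symm

theorem ε_f_v (a : J) (v : L) : ⁅D.ε, ⁅D.f a, v⁆⁆ = ⁅D.f a, ⁅D.ε, v⁆⁆ :=
  (comm (D.f_ev a) (D.f_ε a) v).symm

/-- The Chevalley involution. -/
@[simps A e f h Φ ε] def swap : Core K L J where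
  A := D.A
  e := D.f
  f := D.e
  h a := -D.h a
  Φ := D.Φ
  ε := -D.ε
  e_ev := D.f_ev
  f_ev := D.e_ev
  Φ_od := D.Φ_od
  ε_od := neg_mem D.ε_od
  A_diag := D.A_diag
  h_e a b := by simp [D.h_f]
  h_f a b := by simp [D.h_e]
  e_f_same := D.f_e_same
  e_f_ne := D.f_e_ne
  h_Φ a b := by simp [D.h_Φ]
  e_f_Φ_same := D.f_e_Φ_same
  e_f_Φ_ne _ hab := D.f_e_Φ_ne _ hab
  ε_e a := by simp [D.ε_f]
  ε_f a := by simp [D.ε_e]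
  ε_Φ a := by simp [D.ε_Φ]
  ε_ε := by simp [D.ε_ε]
  Φ_Φ := D.Φ_Φ
  e_nil := D.f_nil
  f_nil := D.e_nil

@[simp] theorem swap_swap : D.swap.swap = D := by
  cases D; simp [swap]

/-- The restriction to a subset of the nodes. -/
def restrict {J' : Type*} (g : J' → J) (hg : Function.Injective g) :
    Core K L J' where
  A a b := D.A (g a) (g b)
  e a := D.e (g a)
  f a := D.f (g a)
  h a := D.h (g a)
  Φ a := D.Φ (g a)
  ε := D.ε
  e_ev _ := D.e_ev _
  f_ev _ := D.f_ev _
  Φ_od _ := D.Φ_od _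
  ε_od := D.ε_od
  A_diag _ := D.A_diag _
  h_e _ _ := D.h_e _ _
  h_f _ _ := D.h_f _ _
  e_f_same _ := D.e_f_same _
  e_f_ne hab := D.e_f_ne (hg.ne hab)
  h_Φ _ _ := D.h_Φ _ _
  e_f_Φ_same _ _ := D.e_f_Φ_same _ _
  e_f_Φ_ne _ hab := D.e_f_Φ_ne _ (hg.ne hab)
  ε_e _ := D.ε_e _
  ε_f _ := D.ε_f _
  ε_Φ _ := D.ε_Φ _
  ε_ε := D.ε_ε
  Φ_Φ _ _ := D.Φ_Φ _ _
  e_nil _ := D.e_nil _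
  f_nil _ := D.f_nil _

theorem wt_e {a b : J} {v : L} {q : K} (hv : ⁅D.h a, v⁆ = q • v) :
    ⁅D.h a, ⁅D.e b, v⁆⁆ = (D.A a b + q) • ⁅D.e b, v⁆ := br_of_wt (D.h_ev a) (D.h_e a b) hv

theorem wt_f {a b : J} {v : L} {q : K} (hv : ⁅D.h a, v⁆ = q • v) :
    ⁅D.h a, ⁅D.f b, v⁆⁆ = (-D.A a b + q) • ⁅D.f b, v⁆ := br_of_wt (D.h_ev a) (D.h_f a b) hv

theorem wt_Φ (a b : J) : ⁅D.h a, D.Φ b⁆ = (0 : K) • D.Φ b := by rw [h_Φ, zero_smul]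

theorem h_e_same (a : J) : ⁅D.h a, D.e a⁆ = (2 : K) • D.e a := by
  rw [D.h_e, D.A_diag]; norm_num

theorem f_e_Φ (a : J) : ⁅D.f a, ⁅D.e a, D.Φ a⁆⁆ = (2 : K) • D.Φ a := by
  rw [f_e_Φ_same, D.A_diag]; norm_num

theorem e_f_Φ (a : J) : ⁅D.e a, ⁅D.f a, D.Φ a⁆⁆ = (2 : K) • D.Φ a := D.swap.f_e_Φ a

variable [CharZero K]

theorem eq_zero_of_f {a : J} {v : L} {m : ℤ} (hm : 0 < m) (hw : ⁅D.h a, v⁆ = (m : K) • v)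
    (hf : ⁅D.f a, v⁆ = 0) : v = 0 :=
  TensorHierarchy.eq_zero_of_f (D.e_ev a) (D.h_ev a) (D.e_f_same a) (D.h_e_same a) (D.e_nil a v)
    hm hf hw

theorem br_e_eq_zero {a : J} {v : L} (hw : ⁅D.h a, v⁆ = 0) (hf : ⁅D.f a, v⁆ = 0) :
    ⁅D.e a, v⁆ = 0 :=
  TensorHierarchy.br_e_eq_zero (D.e_ev a) (D.f_ev a) (D.h_ev a) (D.e_f_same a) (D.h_e_same a)
    (D.e_nil a v) hf hw

theorem eq_zero_of_e {a : J} {v : L} {m : ℤ} (hm : m < 0) (hw : ⁅D.h a, v⁆ = (m : K) • v)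
    (he : ⁅D.e a, v⁆ = 0) : v = 0 :=
  D.swap.eq_zero_of_f (a := a) (m := -m) (by omega) (by simp [hw]) he

theorem br_f_eq_zero {a : J} {v : L} (hw : ⁅D.h a, v⁆ = 0) (he : ⁅D.e a, v⁆ = 0) :
    ⁅D.f a, v⁆ = 0 :=
  D.swap.br_e_eq_zero (a := a) (by simp [hw]) he

/-- `[e_a, Φ_c]` is a multiple of `[e_a, Φ_a]`. -/
theorem e_Φ (a c : J) : ⁅D.e a, D.Φ c⁆ = ((D.A c a : K) / 2) • ⁅D.e a, D.Φ a⁆ := by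
  rw [← sub_eq_zero, ← br_smul, ← br_sub]
  -- Both vectors have weight 2, and f_a sends both to A_ca Φ_a.
  refine D.eq_zero_of_f (a := a) (m := 2) (by norm_num) ?_ ?_
  · rw [D.wt_e (q := 0) (by simp [br_sub, br_smul, D.h_Φ]), D.A_diag]; norm_num
  · rw [br_sub, br_sub, br_smul, br_smul, f_e_Φ_same, f_e_Φ_same, D.A_diag, smul_smul]
    norm_num

theorem f_Φ (a c : J) : ⁅D.f a, D.Φ c⁆ = ((D.A c a : K) / 2) • ⁅D.f a, D.Φ a⁆ := D.swap.e_Φ a c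

/-- The lowering operator f_a gives A_ca [e_a,Φ_a] − 2[e_a,Φ_c], which vanishes by `e_Φ`; the weight
is 4. -/
theorem e_e_Φ (a c : J) : ⁅D.e a, ⁅D.e a, D.Φ c⁆⁆ = 0 := by
  refine D.eq_zero_of_f (a := a) (m := 4) (by norm_num) ?_ ?_
  · rw [D.wt_e (D.wt_e (D.wt_Φ a c)), D.A_diag]; congr 1; norm_num
  · rw [f_e_v_same, f_e_Φ_same, br_smul, D.wt_e (D.wt_Φ a c), D.e_Φ a c, smul_smul, ← sub_smul, D.A_diag]
    convert zero_smul K _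
    push_cast; ring

end Core

end Core

/-! ### Words in the raising and lowering operators -/

section Words

variable {K L I : Type*} [Field K] [AddCommGroup L] [Module K L] [Bracket L L]
  [BiadditiveBracket L] [SuperBracket K L]

variable (K) in
/-- The bracket with a fixed element on the right. -/
def adRight (x : L) : L →ₗ[K] L where
  toFun y := ⁅y, x⁆
  map_add' a b := add_br a b x
  map_smul' c y := smul_br c y x

@[simp] theorem adRight_apply (x y : L) : adRight K x y = ⁅y, x⁆ := rfl

namespace Core

/-- Words in the raising operators acting on the `Φ k`, with their content. -/
inductive Word [DecidableEq I] (D : Core K L I) : (I → ℕ) → L → Prop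
  | Φ (k : I) : D.Word 0 (D.Φ k)
  | e (i : I) {γ : I → ℕ} {v : L} (hv : D.Word γ v) : D.Word (γ + Pi.single i 1) ⁅D.e i, v⁆

/-- Words in all the `e i` and `f i` acting on the `Φ k`. -/
inductive MixedWord (D : Core K L I) : L → Prop
  | Φ (k : I) : D.MixedWord (D.Φ k)
  | e (i : I) {v : L} (hv : D.MixedWord v) : D.MixedWord ⁅D.e i, v⁆
  | f (i : I) {v : L} (hv : D.MixedWord v) : D.MixedWord ⁅D.f i, v⁆

/-! ### The module generated by the odd elements Φ_k -/

section Rg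

variable (D : Core K L I)

/-- The module generated by the `Φ k`. -/
def Rg : Submodule K L := Submodule.span K {v | D.MixedWord v}

theorem Φ_mem (k : I) : D.Φ k ∈ D.Rg := Submodule.subset_span (.Φ k)

theorem Rg_le {M : Submodule K L} (hΦ : ∀ k, D.Φ k ∈ M)
    (he : ∀ i v, v ∈ D.Rg → v ∈ M → ⁅D.e i, v⁆ ∈ M)
    (hf : ∀ i v, v ∈ D.Rg → v ∈ M → ⁅D.f i, v⁆ ∈ M) : D.Rg ≤ M := by
  refine Submodule.span_le.2 fun v hv => ?_
  induction hv with
  | Φ k => exact hΦ k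
  | e i hv ih => exact he i _ (Submodule.subset_span hv) ih
  | f i hv ih => exact hf i _ (Submodule.subset_span hv) ih

theorem e_mem {v : L} (hv : v ∈ D.Rg) (i : I) : ⁅D.e i, v⁆ ∈ D.Rg :=
  (Submodule.span_le (p := D.Rg.comap (ad K (D.e i)))).2
    (fun _ hv => Submodule.subset_span (.e i hv)) hv

theorem f_mem {v : L} (hv : v ∈ D.Rg) (i : I) : ⁅D.f i, v⁆ ∈ D.Rg :=
  (Submodule.span_le (p := D.Rg.comap (ad K (D.f i)))).2
    (fun _ hv => Submodule.subset_span (.f i hv)) hv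

theorem h_mem {v : L} (hv : v ∈ D.Rg) (i : I) : ⁅D.h i, v⁆ ∈ D.Rg := by
  have := D.e_f_v_same i v
  rw [← sub_eq_iff_eq_add'] at this
  exact this ▸ sub_mem (D.e_mem (D.f_mem hv i) i) (D.f_mem (D.e_mem hv i) i)

/-- A linear map vanishes on `Rg` if it vanishes on the `Φ k` and its kernel is stable. -/
theorem map_Rg (T : L →ₗ[K] L) (hΦ : ∀ k, T (D.Φ k) = 0)
    (he : ∀ i v, v ∈ D.Rg → T v = 0 → T ⁅D.e i, v⁆ = 0)
    (hf : ∀ i v, v ∈ D.Rg → T v = 0 → T ⁅D.f i, v⁆ = 0) {r : L} (hr : r ∈ D.Rg) : T r = 0 :=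
  D.Rg_le (M := LinearMap.ker T) hΦ he hf hr

theorem Rg_od {r : L} (hr : r ∈ D.Rg) : r ∈ od (K := K) :=
  D.Rg_le D.Φ_od (fun _ _ _ h => ev_od (D.e_ev _) h) (fun _ _ _ h => ev_od (D.f_ev _) h) hr

theorem ε_Rg_ev {r : L} (hr : r ∈ D.Rg) : ⁅D.ε, r⁆ ∈ ev (K := K) := od_od D.ε_od (D.Rg_od hr)

theorem swap_Rg : D.swap.Rg = D.Rg :=
  le_antisymm (D.swap.Rg_le D.Φ_mem (fun i _ _ h => D.f_mem h i) (fun i _ _ h => D.e_mem h i))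
    (D.Rg_le D.swap.Φ_mem (fun i _ _ h => D.swap.f_mem h i) (fun i _ _ h => D.swap.e_mem h i))

/-- An element that commutes with the `e i`, `f i` and annihilates the `Φ k` annihilates `Rg`. -/
theorem Rg_eq_zero {x : L} (he : ∀ i, ⁅x, D.e i⁆ = 0)
    (hf : ∀ i, ⁅x, D.f i⁆ = 0) (hΦ : ∀ k, ⁅x, D.Φ k⁆ = 0) {r : L} (hr : r ∈ D.Rg) :
    ⁅x, r⁆ = 0 :=
  D.map_Rg (ad K x) hΦ
    (fun i v _ h => by
      rw [ad_apply] at h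
      rw [ad_apply, jac_od_ev (D.e_ev i), he, h]; simp)
    (fun i v _ h => by
      rw [ad_apply] at h
      rw [ad_apply, jac_od_ev (D.f_ev i), hf, h]; simp) hr

end Rg

section wt

variable [Fintype I] (D : Core K L I)

/-- The weight of the words of a given content. -/
def wt (γ : I → ℕ) (a : I) : ℤ := ∑ j, D.A a j * γ j

@[simp] theorem wt_zero (a : I) : D.wt 0 a = 0 := by simp [wt]

theorem wt_add (γ δ : I → ℕ) (a : I) : D.wt (γ + δ) a = D.wt γ a + D.wt δ a := by
  simp [wt, mul_add, Finset.sum_add_distrib]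

@[simp] theorem wt_single [DecidableEq I] (i a : I) : D.wt (Pi.single i 1) a = D.A a i := by
  simp [wt, Pi.single_apply]

end wt

variable [DecidableEq I] (D : Core K L I)

/-- The span of the words of a given content. -/
def R (γ : I → ℕ) : Submodule K L := Submodule.span K {v | D.Word γ v}

variable {D} in
theorem Word.mem {γ : I → ℕ} {v : L} (hv : D.Word γ v) : v ∈ D.R γ := Submodule.subset_span hv

theorem R_le {γ : I → ℕ} {M : Submodule K L} (h : ∀ v, D.Word γ v → v ∈ M) : D.R γ ≤ M :=
  Submodule.span_le.2 h

theorem e_mem_R {γ : I → ℕ} {v : L} (hv : v ∈ D.R γ) (i : I) :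
    ⁅D.e i, v⁆ ∈ D.R (γ + Pi.single i 1) :=
  D.R_le (M := (D.R _).comap (ad K (D.e i))) (fun _ hv => (Word.e i hv).mem) hv

theorem R_le_Rg (γ : I → ℕ) : D.R γ ≤ D.Rg := by
  refine D.R_le fun v hv => ?_
  induction hv with
  | Φ k => exact D.Φ_mem k
  | e i _ ih => exact D.e_mem ih i

theorem R_zero_le {M : Submodule K L} (hΦ : ∀ k, D.Φ k ∈ M) : D.R 0 ≤ M := by
  refine D.R_le fun v hv => ?_
  generalize hγ : (0 : I → ℕ) = γ at hv
  cases hv with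
  | Φ k => exact hΦ k
  | e i hv => simpa using congrFun hγ i

theorem exists_eq_add_single {γ : I → ℕ} {i : I} (h : γ i ≠ 0) :
    ∃ δ : I → ℕ, γ = δ + Pi.single i 1 := by
  refine ⟨γ - Pi.single i 1, ?_⟩
  ext j
  by_cases hj : j = i
  · subst hj; simp; omega
  · simp [hj]

/-! ### Raising and lowering words; the module is abelian -/

section wt

variable [Fintype I]

theorem h_R {γ : I → ℕ} {v : L} (hv : v ∈ D.R γ) (a : I) :
    ⁅D.h a, v⁆ = (D.wt γ a : K) • v := by
  have h (γ : I → ℕ) (v : L) (hv : D.Word γ v) : ⁅D.h a, v⁆ = (D.wt γ a : K) • v := by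
    induction hv with
    | Φ k => rw [D.wt_zero, D.h_Φ]; simp
    | e i _ ih => rw [D.wt_e ih, wt_add, wt_single]; push_cast; rw [add_comm]
  have := D.R_le (M := LinearMap.ker (ad K (D.h a) - (D.wt γ a : K) • LinearMap.id))
    (fun v hv => by simp [h γ v hv]) hv
  simpa [sub_eq_zero] using this

/-- Commuting f_i through a raising word removes one letter e_i; the process ends with
[f_i,[e_i,Φ_k]] or [e_i,[f_i,Φ_k]], both multiples of Φ_i. Content zero is excluded from the second
claim because [f_i,Φ_k] need not vanish. -/
theorem word_f {δ : I → ℕ} {v : L} (hv : D.Word δ v) (i : I) :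
    (∀ γ, δ = γ + Pi.single i 1 → ⁅D.f i, v⁆ ∈ D.R γ) ∧ (δ ≠ 0 → δ i = 0 → ⁅D.f i, v⁆ = 0) := by
  induction hv with
  | Φ k => exact ⟨fun γ h => by simpa using congrFun h i, fun h => absurd rfl h⟩
  | @e j δ v hv ih =>
    constructor
    · intro γ hγ
      by_cases hij : i = j
      · subst hij
        obtain rfl : δ = γ := add_right_cancel hγ
        rw [f_e_v_same]
        refine sub_mem ?_ (D.h_R hv.mem i ▸ Submodule.smul_mem _ _ hv.mem)
        by_cases hi : δ i = 0
        · by_cases hδ : δ = 0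
          · subst hδ
            refine D.R_zero_le (M := (D.R 0).comap (ad K (D.e i) ∘ₗ ad K (D.f i)))
              (fun k => ?_) hv.mem
            simp only [Submodule.mem_comap, LinearMap.comp_apply, ad_apply, D.e_f_Φ_same]
            exact Submodule.smul_mem _ _ (Word.Φ i).mem
          · rw [ih.2 hδ hi]; simp
        · obtain ⟨γ, rfl⟩ := exists_eq_add_single hi
          exact D.e_mem_R (ih.1 γ rfl) i
      · have hi : δ i ≠ 0 := by
          have := congrFun hγ i
          simp [hij] at this; omega
        obtain ⟨ζ, rfl⟩ := exists_eq_add_single hi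
        obtain rfl : ζ + Pi.single j 1 = γ := by
          rw [add_right_comm] at hγ; exact add_right_cancel hγ
        rw [D.f_e_v_ne hij]
        exact D.e_mem_R (ih.1 ζ rfl) j
    · intro _ hi
      have hij : i ≠ j := by rintro rfl; simp at hi
      have hi' : δ i = 0 := by simpa [hij] using hi
      rw [D.f_e_v_ne hij]
      by_cases hδ : δ = 0
      · subst hδ
        refine D.R_zero_le (M := LinearMap.ker (ad K (D.e j) ∘ₗ ad K (D.f i)))
              (fun k => ?_) hv.mem
        simp [D.e_f_Φ_ne k (Ne.symm hij)]
      · rw [ih.2 hδ hi']; simp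

theorem f_mem_R {γ : I → ℕ} {i : I} {v : L} (hv : v ∈ D.R (γ + Pi.single i 1)) :
    ⁅D.f i, v⁆ ∈ D.R γ :=
  D.R_le (M := (D.R γ).comap (ad K (D.f i))) (fun _ hv => (D.word_f hv i).1 γ rfl) hv

theorem f_R_eq_zero {γ : I → ℕ} (hγ : γ ≠ 0) {i : I} (hi : γ i = 0) {v : L} (hv : v ∈ D.R γ) :
    ⁅D.f i, v⁆ = 0 :=
  D.R_le (M := LinearMap.ker (ad K (D.f i))) (fun _ hv => (D.word_f hv i).2 hγ hi) hv

/-- As in an adjoint representation, raising and lowering words meet only in content zero, and an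
operator of the opposite kind shortens a word. The Chevalley involution reduces stability to the
raising half. -/
theorem Rg_le_sup : D.Rg ≤ (⨆ γ, D.R γ) ⊔ ⨆ γ, D.swap.R γ := by
  have key (D : Core K L I) (i : I) :
      (⨆ γ, D.R γ) ≤ ((⨆ γ, D.R γ) ⊔ ⨆ γ, D.swap.R γ).comap (ad K (D.f i)) := by
    refine iSup_le fun γ v hv => ?_
    rw [Submodule.mem_comap, ad_apply]
    by_cases hγ : γ = 0
    · subst hγ
      refine D.R_zero_le (M := ((⨆ γ, D.R γ) ⊔ ⨆ γ, D.swap.R γ).comap (ad K (D.f i)))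
        (fun k => ?_) hv
      exact Submodule.mem_sup_right
        (Submodule.mem_iSup_of_mem _ (Word.e (D := D.swap) i (Word.Φ (D := D.swap) k)).mem)
    · by_cases hi : γ i = 0
      · rw [D.f_R_eq_zero hγ hi hv]; exact zero_mem _
      · obtain ⟨δ, rfl⟩ := exists_eq_add_single hi
        exact Submodule.mem_sup_left (Submodule.mem_iSup_of_mem δ (D.f_mem_R hv))
  have key' (D : Core K L I) (i : I) :
      (⨆ γ, D.R γ) ≤ ((⨆ γ, D.R γ) ⊔ ⨆ γ, D.swap.R γ).comap (ad K (D.e i)) :=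
    iSup_le fun γ v hv => Submodule.mem_sup_left (Submodule.mem_iSup_of_mem _ (D.e_mem_R hv i))
  refine D.Rg_le (fun k => Submodule.mem_sup_left (Submodule.mem_iSup_of_mem 0 (Word.Φ k).mem))
    (fun i v _ hv => ?_) (fun i v _ hv => ?_)
  · refine sup_le (key' D i) ?_ hv
    rw [sup_comm]; simpa using key D.swap i
  · refine sup_le (key D i) ?_ hv
    rw [sup_comm]; simpa using key' D.swap i

/-- The condition that no nonzero sum of simple roots is antidominant. -/
def NotAntidominant : Prop := ∀ γ : I → ℕ, γ ≠ 0 → ∃ i, 0 < D.wt γ i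

variable {D} [CharZero K]

/-- Induction on the height of the content. Moving e_j across reduces [[e_j,v],Φ_l] to a multiple of
[v,[e_j,Φ_j]], which a suitable lowering operator kills although its weight is positive. -/
theorem R_Φ (pos : D.NotAntidominant) {γ : I → ℕ} {v : L} (hv : v ∈ D.R γ) (l : I) :
    ⁅v, D.Φ l⁆ = 0 := by
  suffices H : ∀ n, ∀ γ : I → ℕ, ∑ i, γ i ≤ n → ∀ v ∈ D.R γ, ∀ l, ⁅v, D.Φ l⁆ = 0 from
    H _ γ le_rfl v hv l
  clear hv l v γ
  intro n
  induction n with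
  | zero =>
    intro γ hγ v hv l
    obtain rfl : γ = 0 := by
      ext i
      simpa using (Finset.sum_eq_zero_iff.1 (Nat.le_zero.1 hγ)) i (Finset.mem_univ i)
    exact D.R_zero_le (M := LinearMap.ker (adRight K (D.Φ l))) (fun k => D.Φ_Φ k l) hv
  | succ n ih =>
    intro γ hγ v hv l
    revert v
    refine D.R_le (M := LinearMap.ker (adRight K (D.Φ l))) (fun v hv => ?_)
    simp only [LinearMap.mem_ker, adRight_apply]
    cases hv with
    | Φ k => exact D.Φ_Φ k l
    | @e j γ v hv =>
      have hsum (γ : I → ℕ) (i : I) : ∑ k, (γ + Pi.single i 1 : I → ℕ) k = ∑ k, γ k + 1 := by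
        simp [Finset.sum_add_distrib]
      rw [hsum] at hγ
      have hvΦ (k : I) : ⁅v, D.Φ k⁆ = 0 := ih γ (by omega) v hv.mem k
      have h1 := jac (D.e_ev j) v (D.Φ l)
      rw [hvΦ, br_zero, D.e_Φ, br_smul] at h1
      rw [eq_neg_of_add_eq_zero_left h1.symm]
      suffices hc : ⁅v, ⁅D.e j, D.Φ j⁆⁆ = 0 by rw [hc, smul_zero, neg_zero]
      obtain ⟨i, hi⟩ := pos (γ + Pi.single j 1) fun h => by simpa using congrFun h j
      refine D.eq_zero_of_f (a := i) hi ?_ ?_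
      · rw [br_of_wt (D.h_ev i) (D.h_R hv.mem i) (D.wt_e (D.wt_Φ _ _)), wt_add, wt_single]
        push_cast; rw [add_zero]
      rw [jac (D.f_ev i)]
      have h2 : ⁅v, ⁅D.f i, ⁅D.e j, D.Φ j⁆⁆⁆ = 0 := by
        by_cases hij : i = j
        · subst hij; rw [D.f_e_Φ, br_smul, hvΦ, smul_zero]
        · rw [D.f_e_Φ_ne _ hij, br_zero]
      rw [h2, add_zero]
      -- When v has content zero, [f_i,v] is a lowering word and the induction hypothesis does not
      -- apply. Here [Φ_k,[e_j,Φ_j]] vanishes directly: e_j applied to [Φ_j,Φ_j] = 0 settles k = j,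
      -- and `e_Φ` the rest.
      by_cases h0 : γ = 0
      · subst h0
        have hΦ (k : I) : ⁅D.Φ k, ⁅D.e j, D.Φ j⁆⁆ = 0 := by
          have h3 (k) := jac (D.e_ev j) (D.Φ k) (D.Φ j)
          simp only [D.Φ_Φ, br_zero] at h3
          have h4 := h3 j
          rw [symm (ev_od (D.e_ev j) (D.Φ_od j)) (D.Φ_od j), ← two_smul K, eq_comm,
            smul_eq_zero] at h4
          replace h4 := h4.resolve_left two_ne_zero
          have h5 := h3 k
          rwa [D.e_Φ, smul_br, symm (ev_od (D.e_ev j) (D.Φ_od j)) (D.Φ_od j), h4, smul_zero,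
            zero_add, eq_comm] at h5
        have h6 : ⁅v, ⁅D.e j, D.Φ j⁆⁆ = 0 :=
          D.R_zero_le (M := LinearMap.ker (adRight K ⁅D.e j, D.Φ j⁆)) hΦ hv.mem
        have h7 := jac (D.f_ev i) v ⁅D.e j, D.Φ j⁆
        rw [h6, br_zero, h2, add_zero] at h7
        exact h7.symm
      · by_cases hi0 : γ i = 0
        · rw [D.f_R_eq_zero h0 hi0 hv.mem, zero_br]
        · obtain ⟨δ, rfl⟩ := exists_eq_add_single hi0
          have hw := D.f_mem_R hv.mem
          rw [hsum] at hγ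
          have h3 := jac (D.e_ev j) ⁅D.f i, v⁆ (D.Φ j)
          rw [ih _ (by omega) _ hw, br_zero, ih _ (by rw [hsum]; omega) _ (D.e_mem_R hw j),
            zero_add] at h3
          exact h3.symm

theorem Rg_Φ (pos : D.NotAntidominant) {r : L} (hr : r ∈ D.Rg) (l : I) : ⁅r, D.Φ l⁆ = 0 :=
  (sup_le (iSup_le fun _ _ hv => R_Φ pos hv l) (iSup_le fun _ _ hv => R_Φ (D := D.swap) pos hv l) :
    _ ≤ LinearMap.ker (adRight K (D.Φ l))) (D.Rg_le_sup hr)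

theorem Rg_Rg (pos : D.NotAntidominant) {r r' : L} (hr : r ∈ D.Rg) (hr' : r' ∈ D.Rg) :
    -- The common annihilator of Rg contains the Φ_k by `Rg_Φ` and is stable under e_i and f_i
    -- because Rg is.
    ⁅r, r'⁆ = 0 := by
  have h : D.Rg ≤ ⨅ r ∈ D.Rg, LinearMap.ker (ad K r) := by
    refine D.Rg_le (fun k => ?_) (fun i v _ hv => ?_) (fun i v _ hv => ?_)
    · simp only [Submodule.mem_iInf, LinearMap.mem_ker, ad_apply]
      exact fun r hr => Rg_Φ pos hr k
    all_goals
      simp only [Submodule.mem_iInf, LinearMap.mem_ker, ad_apply] at hv ⊢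
      intro r hr
    · have := jac (D.e_ev i) r v
      rwa [hv r hr, hv _ (D.e_mem hr i), br_zero, zero_add, eq_comm] at this
    · have := jac (D.f_ev i) r v
      rwa [hv r hr, hv _ (D.f_mem hr i), br_zero, zero_add, eq_comm] at this
  have := h hr'
  simp only [Submodule.mem_iInf, LinearMap.mem_ker, ad_apply] at this
  exact this r hr

/-- `[[ε, r], r'] = -[[ε, r'], r]`. -/
theorem ε_Rg_br (pos : D.NotAntidominant) {r r' : L} (hr : r ∈ D.Rg) (hr' : r' ∈ D.Rg) :
    ⁅⁅D.ε, r⁆, r'⁆ = -⁅⁅D.ε, r'⁆, r⁆ := by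
  have := jac_od D.ε_od (D.Rg_od hr) r'
  rw [Rg_Rg pos hr hr', br_zero, anti (D.ε_Rg_ev hr') r] at *
  rw [neg_neg]
  exact (sub_eq_zero.1 this.symm)

theorem ε_Rg_Φ (pos : D.NotAntidominant) {r : L} (hr : r ∈ D.Rg) (k : I) :
    ⁅⁅D.ε, r⁆, D.Φ k⁆ = -⁅D.h k, r⁆ := by
  rw [ε_Rg_br pos hr (D.Φ_mem k), D.ε_Φ]

end wt

end Core

end Words

/-! ### The action of the node -1 on the words -/

section

variable {K L I : Type*} [Field K] [AddCommGroup L] [Module K L] [Bracket L L]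
  [BiadditiveBracket L] [SuperBracket K L]

namespace Core

/-! ### Words in a single simple root -/

section Single

variable [DecidableEq I] (D : Core K L I)

theorem R_single_succ_le (i : I) (m : ℕ) :
    D.R (Pi.single i (m + 1)) ≤ (D.R (Pi.single i m)).map (ad K (D.e i)) := by
  refine R_le _ fun v hv => ?_
  generalize hγ : (Pi.single i (m + 1) : I → ℕ) = γ at hv
  cases hv with
  | Φ k => simpa using congrFun hγ i
  | @e j γ v hv =>
    obtain rfl : j = i := by
      by_contra h
      simpa [h] using congrFun hγ j
    obtain rfl : Pi.single j m = γ := by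
      rw [Pi.single_add] at hγ; exact add_right_cancel hγ
    exact ⟨v, hv.mem, rfl⟩

variable [CharZero K]

theorem R_single_one {i : I} {v : L} (hv : v ∈ D.R (Pi.single i 1)) :
    ∃ c : K, v = c • ⁅D.e i, D.Φ i⁆ := by
  obtain ⟨u, hu, rfl⟩ := D.R_single_succ_le i 0 hv
  rw [Pi.single_zero] at hu
  have h : ad K (D.e i) u ∈ Submodule.span K {⁅D.e i, D.Φ i⁆} :=
    D.R_zero_le (M := (Submodule.span K {⁅D.e i, D.Φ i⁆}).comap (ad K (D.e i))) (fun k => by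
      rw [Submodule.mem_comap, ad_apply, D.e_Φ i k]
      exact Submodule.smul_mem _ _ (Submodule.subset_span rfl)) hu
  obtain ⟨c, hc⟩ := Submodule.mem_span_singleton.1 h
  exact ⟨c, hc.symm⟩

theorem R_single_add_two {i : I} {m : ℕ} {v : L} (hv : v ∈ D.R (Pi.single i (m + 2))) :
    v = 0 := by
  induction m generalizing v with
  | zero =>
    obtain ⟨u, hu, rfl⟩ := D.R_single_succ_le i 1 hv
    obtain ⟨c, rfl⟩ := D.R_single_one hu
    rw [ad_apply, br_smul, e_e_Φ, smul_zero]
  | succ m ih =>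
    obtain ⟨u, hu, rfl⟩ := D.R_single_succ_le i _ hv
    rw [ih hu, map_zero]

end Single

end Core

variable (K L I) in
/-- A `Core` with an even element `F` and an odd element `z` that commute with the `e i` and
`f i`. -/
structure FCore extends Core K L I where
  F : L
  z : L
  F_ev : F ∈ ev (K := K)
  z_od : z ∈ od (K := K)
  F_e (i : I) : ⁅F, e i⁆ = 0
  F_f (i : I) : ⁅F, f i⁆ = 0
  F_ε : ⁅F, ε⁆ = 0
  z_e (i : I) : ⁅z, e i⁆ = 0
  z_f (i : I) : ⁅z, f i⁆ = 0
  z_Φ (i : I) : ⁅z, Φ i⁆ = 0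
  Φ_ψ (i j : I) : ⁅Φ i, ⁅F, Φ j⁆⁆ = 0

namespace FCore

/-- The Chevalley involution. -/
@[simps toCore z] def swap (D : FCore K L I) : FCore K L I where
  toCore := D.toCore.swap
  F := D.F
  z := -D.z
  F_ev := D.F_ev
  z_od := neg_mem D.z_od
  F_e := D.F_f
  F_f := D.F_e
  F_ε := by simp [D.F_ε]
  z_e i := by simp [D.z_f]
  z_f i := by simp [D.z_e]
  z_Φ i := by simp [D.z_Φ]
  Φ_ψ := D.Φ_ψ

variable (D : FCore K L I)

theorem F_e_v (i : I) (v : L) : ⁅D.F, ⁅D.e i, v⁆⁆ = ⁅D.e i, ⁅D.F, v⁆⁆ := comm D.F_ev (D.F_e i) v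

theorem F_f_v (i : I) (v : L) : ⁅D.F, ⁅D.f i, v⁆⁆ = ⁅D.f i, ⁅D.F, v⁆⁆ := comm D.F_ev (D.F_f i) v

theorem F_h (i : I) : ⁅D.F, D.h i⁆ = 0 := by
  rw [← D.e_f_same, D.F_e_v, D.F_f, br_zero]

theorem h_F (i : I) : ⁅D.h i, D.F⁆ = 0 := br_eq_zero_symm D.F_ev (D.F_h i)

theorem z_h (i : I) : ⁅D.z, D.h i⁆ = 0 := by
  rw [← D.e_f_same, jac_od_ev (D.e_ev i), D.z_e, D.z_f]; simp

theorem F_ε_Rg {r : L} (hr : r ∈ D.Rg) : ⁅D.F, ⁅D.ε, r⁆⁆ = 0 :=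
  D.map_Rg (ad K D.F ∘ₗ ad K D.ε) (fun k => by simp [D.ε_Φ, D.F_h])
    (fun i v _ h => by
      simp only [LinearMap.comp_apply, ad_apply] at h ⊢
      rw [D.ε_e_v, D.F_e_v, h, br_zero])
    (fun i v _ h => by
      simp only [LinearMap.comp_apply, ad_apply] at h ⊢
      rw [D.ε_f_v, D.F_f_v, h, br_zero]) hr

theorem z_Rg {r : L} (hr : r ∈ D.Rg) : ⁅D.z, r⁆ = 0 := D.Rg_eq_zero D.z_e D.z_f D.z_Φ hr

theorem z_ε_Rg {r : L} (hr : r ∈ D.Rg) : ⁅D.z, ⁅D.ε, r⁆⁆ = 0 :=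
  D.map_Rg (ad K D.z ∘ₗ ad K D.ε) (fun k => by simp [D.ε_Φ, D.z_h])
    (fun i v _ h => by
      simp only [LinearMap.comp_apply, ad_apply] at h ⊢
      rw [D.ε_e_v, jac_od_ev (D.e_ev i), D.z_e, h]; simp)
    (fun i v _ h => by
      simp only [LinearMap.comp_apply, ad_apply] at h ⊢
      rw [D.ε_f_v, jac_od_ev (D.f_ev i), D.z_f, h]; simp) hr

/-- The difference between the bracket of `b` and `v` and its value prescribed by `z`. -/
def T (b v : L) : L := ⁅b, v⁆ - ⁅D.z, ⁅⁅D.ε, b⁆, v⁆⁆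

theorem swap_T (b v : L) : D.swap.T b v = D.T b v := by simp [T]

@[simp] theorem T_zero (b : L) : D.T b 0 = 0 := by simp [T]

@[simp] theorem zero_T (b : L) : D.T 0 b = 0 := by simp [T]

theorem T_neg (b v : L) : D.T b (-v) = -D.T b v := by simp [T]; abel

theorem neg_T (b v : L) : D.T (-b) v = -D.T b v := by simp [T]; abel

theorem T_smul (c : K) (b v : L) : D.T b (c • v) = c • D.T b v := by
  simp [T, br_smul, smul_sub]

theorem smul_T (c : K) (b v : L) : D.T (c • b) v = c • D.T b v := by
  simp [T, br_smul, smul_br, smul_sub]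

/-- The defect is built from its arguments using only brackets with z and ε, so an even element
commuting with both acts on it as a derivation. -/
theorem T_equivariant {x : L} (hx : x ∈ ev (K := K)) (hz : ⁅x, D.z⁆ = 0) (hε : ⁅x, D.ε⁆ = 0)
    (b v : L) : ⁅x, D.T b v⁆ = D.T ⁅x, b⁆ v + D.T b ⁅x, v⁆ := by
  rw [T, br_sub, jac hx b v, comm hx hz, jac hx ⁅D.ε, b⁆ v, comm hx hε, T, T, br_add]
  abel

theorem e_T (i : I) (b v : L) : ⁅D.e i, D.T b v⁆ = D.T ⁅D.e i, b⁆ v + D.T b ⁅D.e i, v⁆ :=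
  D.T_equivariant (D.e_ev i) (by rw [anti (D.e_ev i), D.z_e, neg_zero]) (D.e_ε i) b v

theorem f_T (i : I) (b v : L) : ⁅D.f i, D.T b v⁆ = D.T ⁅D.f i, b⁆ v + D.T b ⁅D.f i, v⁆ :=
  D.T_equivariant (D.f_ev i) (by rw [anti (D.f_ev i), D.z_f, neg_zero]) (D.f_ε i) b v

theorem h_T (i : I) (b v : L) : ⁅D.h i, D.T b v⁆ = D.T ⁅D.h i, b⁆ v + D.T b ⁅D.h i, v⁆ :=
  D.T_equivariant (D.h_ev i)
    (by rw [anti (D.h_ev i), D.z_h, neg_zero])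
    (D.h_ε i) b v

theorem T_Φ_ψ (k l : I) : D.T (D.Φ k) ⁅D.F, D.Φ l⁆ = 0 := by
  rw [T, D.Φ_ψ, D.ε_Φ, comm (D.h_ev k) (D.h_F k), D.h_Φ]; simp

variable [CharZero K]

theorem ε_ε_Rg {r : L} : ⁅D.ε, ⁅D.ε, r⁆⁆ = 0 := od_sq D.ε_od D.ε_ε r

/-! ### Vanishing of the defect T -/

variable [Fintype I] [DecidableEq I] {D}

/-- Applying F to [r,r'] = 0 makes [r,[F,r']] antisymmetric; the correction by z is antisymmetric
because of `ε_Rg_br`. -/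
theorem T_anti (pos : D.NotAntidominant) {r r' : L} (hr : r ∈ D.Rg) (hr' : r' ∈ D.Rg) :
    D.T r ⁅D.F, r'⁆ = -D.T r' ⁅D.F, r⁆ := by
  have h1 := jac D.F_ev r r'
  rw [D.Rg_Rg pos hr hr', br_zero, symm (ev_od D.F_ev (D.Rg_od hr)) (D.Rg_od hr')] at h1
  have h2 (r r' : L) (hr : r ∈ D.Rg) : ⁅⁅D.ε, r⁆, ⁅D.F, r'⁆⁆ = ⁅D.F, ⁅⁅D.ε, r⁆, r'⁆⁆ :=
    (comm D.F_ev (D.F_ε_Rg hr) _).symm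
  rw [T, T, h2 r r' hr, h2 r' r hr', D.ε_Rg_br pos hr hr', eq_neg_of_add_eq_zero_right h1.symm]
  simp; abel

/-- The even element [ε,r] commutes with z and ε and sends Φ_k to −w_k r. Acting with it on
T(Φ_l,[F,Φ_k]) = 0 gives two terms, which antisymmetry turns into this relation. Thus k ↦
T(Φ_k,[F,r]) is proportional to the weight of r whenever that weight is nonzero. -/
theorem T_Φ_F (pos : D.NotAntidominant) {r : L} (hr : r ∈ D.Rg) {w : I → K}
    (hw : ∀ a, ⁅D.h a, r⁆ = w a • r) (k l : I) :
    w l • D.T (D.Φ k) ⁅D.F, r⁆ = w k • D.T (D.Φ l) ⁅D.F, r⁆ := by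
  have h := D.T_equivariant (D.ε_Rg_ev hr)
    (by rw [anti (D.ε_Rg_ev hr), D.z_ε_Rg hr, neg_zero])
    (by rw [anti (D.ε_Rg_ev hr), D.ε_ε_Rg, neg_zero]) (D.Φ l) ⁅D.F, D.Φ k⁆
  rw [D.T_Φ_ψ, br_zero, ← comm D.F_ev (D.F_ε_Rg hr), D.ε_Rg_Φ pos hr, D.ε_Rg_Φ pos hr, hw, hw,
    br_neg, br_smul, neg_T, T_neg, smul_T, T_smul, T_anti pos hr (D.Φ_mem k), smul_neg, neg_neg,
    ← sub_eq_add_neg, eq_comm, sub_eq_zero] at h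
  exact h

/-- The Cartan matrix is nondegenerate. -/
def Nondegenerate (D : FCore K L I) : Prop := ∀ x : I → ℤ, (∀ l, ∑ j, D.A l j * x j = 0) → x = 0

/-- If the defect is a nonzero multiple of column i of the Cartan matrix, then by `T_Φ_F` the weight
of r is proportional to that of α_i, and nondegeneracy lifts this to the contents. -/
theorem content_of_T (pos : D.NotAntidominant) (nd : D.Nondegenerate) {γ : I → ℕ} {r : L}
    (hr : r ∈ D.R γ) {i : I} {u : L} (hu : ∀ k, D.T (D.Φ k) ⁅D.F, r⁆ = (D.A k i : K) • u) :
    γ = Pi.single i (γ i) ∨ u = 0 := by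
  by_contra! hne
  refine hne.1 ?_
  have h1 (k : I) : 2 * D.wt γ k = D.wt γ i * D.A k i := by
    have := T_Φ_F pos (D.R_le_Rg γ hr) (D.h_R hr) i k
    rw [hu, hu, smul_smul, smul_smul, ← sub_eq_zero, ← sub_smul, smul_eq_zero, D.A_diag] at this
    have := this.resolve_right hne.2
    rw [sub_eq_zero] at this
    have : D.wt γ k * 2 = D.wt γ i * D.A k i := by exact_mod_cast this
    rw [← this, mul_comm]
  -- By `h1`, the Cartan matrix takes the same values on 2γ and on (wt γ i)·α_i.
  have h2 := nd (fun j => 2 * γ j - if j = i then D.wt γ i else 0) fun l => by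
    have := h1 l
    simp only [mul_sub, Finset.sum_sub_distrib, mul_ite, mul_zero,
      Finset.sum_ite_eq', Finset.mem_univ, if_true]
    rw [sub_eq_zero, mul_comm (D.A l i), ← this, Core.wt, Finset.mul_sum]
    exact Finset.sum_congr rfl fun _ _ => by ring
  ext j
  by_cases hj : j = i
  · subst hj; simp
  · have := congrFun h2 j
    simpa [hj] using this

/-- A property of the `[F, r]` that is inherited along lowering operators passes from a nonzero
vector to some `[F, [e j, Φ j]]`. -/
theorem exists_F_e_Φ_mem (pos : D.NotAntidominant) (Z : Submodule K L)
    (hZ : ∀ (γ : I → ℕ) (i : I) (r : L), γ ≠ Pi.single i (γ i) → r ∈ D.R (γ + Pi.single i 1) →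
      ⁅D.F, r⁆ ∈ Z → ⁅D.F, ⁅D.f i, r⁆⁆ ∈ Z)
    {γ : I → ℕ} (hγ : γ ≠ 0) {r : L} (hr : r ∈ D.R γ) (hF : ⁅D.F, r⁆ ≠ 0) (hrZ : ⁅D.F, r⁆ ∈ Z) :
    ∃ j, ⁅D.F, ⁅D.e j, D.Φ j⁆⁆ ∈ Z := by
  induction hn : ∑ i, γ i generalizing γ r with
  | zero =>
    refine absurd ?_ hγ
    ext i
    simpa using (Finset.sum_eq_zero_iff.1 hn) i (Finset.mem_univ i)
  | succ n ih =>
    -- The vector [F,r] is nonzero of positive weight at i, so f_i does not kill it and the content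
    -- can be lowered. The descent stops at a multiple of a simple root, and only multiplicity one
    -- survives `R_single_add_two`.
    obtain ⟨i, hi⟩ := pos γ hγ
    have hw : ⁅D.h i, ⁅D.F, r⁆⁆ = (D.wt γ i : K) • ⁅D.F, r⁆ := by
      rw [comm (D.h_ev i) (D.h_F i), D.h_R hr, br_smul]
    have hf : ⁅D.f i, ⁅D.F, r⁆⁆ ≠ 0 := fun h => hF (D.eq_zero_of_f (a := i) hi hw h)
    rw [← D.F_f_v] at hf
    have hγi : γ i ≠ 0 := by
      intro h; rw [D.f_R_eq_zero hγ h hr, br_zero] at hf; exact hf rfl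
    obtain ⟨δ, rfl⟩ := Core.exists_eq_add_single hγi
    by_cases hδ : δ = Pi.single i (δ i)
    · rw [hδ, ← Pi.single_add] at hr
      cases hm : δ i with
      | zero =>
        rw [hm, zero_add] at hr
        obtain ⟨c, rfl⟩ := D.R_single_one hr
        have hc : c ≠ 0 := by rintro rfl; simp at hF
        rw [br_smul] at hrZ
        exact ⟨i, (Z.smul_mem_iff hc).1 hrZ⟩
      | succ m =>
        rw [hm] at hr
        rw [D.R_single_add_two hr, br_zero] at hF
        exact absurd rfl hF
    · refine ih (γ := δ) (fun h => hδ (by simp [h])) (D.f_mem_R hr) hf (hZ δ i r hδ hr hrZ) ?_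
      simp [Finset.sum_add_distrib] at hn
      exact hn

variable (D) in
/-- `D.T b` as a linear map. -/
def TL (b : L) : L →ₗ[K] L := ad K b - ad K D.z ∘ₗ ad K ⁅D.ε, b⁆

@[simp] theorem TL_apply (b v : L) : D.TL b v = D.T b v := rfl

/-- The dependence on k sits entirely in the factor A_ki, since [e_i,Φ_k] is A_ki/2 times [e_i,Φ_i].
This is the shape required by `content_of_T`. -/
theorem T_Φ_e (i k : I) {v : L} (hv : D.T (D.Φ k) v = 0) :
    D.T (D.Φ k) ⁅D.e i, v⁆ = (D.A k i : K) • (-(1 / 2 : K) • D.T ⁅D.e i, D.Φ i⁆ v) := by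
  have := D.e_T i (D.Φ k) v
  rw [hv, br_zero, D.e_Φ, smul_T] at this
  rw [eq_neg_of_add_eq_zero_right this.symm, smul_smul, ← neg_smul]
  congr 1; ring

theorem T_Φ_f (i k : I) {v : L} (hv : D.T (D.Φ k) v = 0) :
    D.T (D.Φ k) ⁅D.f i, v⁆ = (D.A k i : K) • (-(1 / 2 : K) • D.T ⁅D.f i, D.Φ i⁆ v) := by
  simpa only [swap_T, swap_toCore, Core.swap_e, Core.swap_A, Core.swap_Φ] using
    T_Φ_e (D := D.swap) i k (v := v) ((D.swap_T _ _).trans hv)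

/-- Induction on the word: a new letter e_i produces a column of the Cartan matrix, which by
`content_of_T` is harmless unless the content is a multiple of α_i. Those contents are covered by
the hypothesis or carry no nonzero word. -/
theorem T_word (pos : D.NotAntidominant) (nd : D.Nondegenerate)
    (h : ∀ j k, D.T (D.Φ k) ⁅D.F, ⁅D.e j, D.Φ j⁆⁆ = 0) {γ : I → ℕ} {r : L} (hr : r ∈ D.R γ) (k : I) :
    D.T (D.Φ k) ⁅D.F, r⁆ = 0 := by
  have H (γ : I → ℕ) (v : L) (hv : D.Word γ v) : ∀ k, D.T (D.Φ k) ⁅D.F, v⁆ = 0 := by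
    induction hv with
    | Φ l => exact fun k => D.T_Φ_ψ k l
    | @e i γ v hv ih =>
      have h1 (k : I) := T_Φ_e i k (ih k)
      simp only [← D.F_e_v] at h1
      have h3 := (Core.Word.e i hv).mem
      rcases content_of_T pos nd h3 h1 with h2 | h2
      · rw [h2] at h3
        cases hm : γ i with
        | zero =>
          intro k
          obtain ⟨c, hc⟩ := D.R_single_one (i := i) (v := ⁅D.e i, v⁆) (by simpa [hm] using h3)
          rw [hc, br_smul, T_smul, h, smul_zero]
        | succ m =>
          intro k
          rw [D.R_single_add_two (i := i) (m := m) (v := ⁅D.e i, v⁆) (by simpa [hm] using h3)]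
          simp
      · intro k
        rw [h1, h2, smul_zero]
  exact D.R_le (M := LinearMap.ker (D.TL (D.Φ k) ∘ₗ ad K D.F)) (fun v hv => H γ v hv k) hr

/-- The content α_i + α_j is no multiple of α_i, so T([e_i,Φ_i],[F,[e_j,Φ_j]]) = 0. After exchanging
the arguments, f_j gives T(Φ_j,[F,[e_i,Φ_i]]) = 0, and `T_Φ_F` transfers this first to Φ_i, since
A_ji ≠ 0, and then to every Φ_k. -/
theorem T_edge (pos : D.NotAntidominant) (nd : D.Nondegenerate) {i j : I} (hA : D.A j i ≠ 0)
    (hj : ∀ k, D.T (D.Φ k) ⁅D.F, ⁅D.e j, D.Φ j⁆⁆ = 0) (k : I) :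
    D.T (D.Φ k) ⁅D.F, ⁅D.e i, D.Φ i⁆⁆ = 0 := by
  by_cases hij : i = j
  · subst hij; exact hj k
  have hm (l : I) : ⁅D.e l, D.Φ l⁆ ∈ D.R (Pi.single l 1) := by
    simpa using (Core.Word.e l (Core.Word.Φ (D := D.toCore) l)).mem
  have h1 (k : I) := T_Φ_e i k (hj k)
  simp only [← D.F_e_v] at h1
  have h2 : D.T ⁅D.e i, D.Φ i⁆ ⁅D.F, ⁅D.e j, D.Φ j⁆⁆ = 0 := by
    rcases content_of_T pos nd (D.e_mem_R (hm j) i) h1 with h2 | h2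
    · simpa [Ne.symm hij] using congrFun h2 j
    · simpa using h2
  rw [T_anti pos (D.R_le_Rg _ (hm i)) (D.R_le_Rg _ (hm j)), neg_eq_zero] at h2
  have h3 := D.f_T j ⁅D.e j, D.Φ j⁆ ⁅D.F, ⁅D.e i, D.Φ i⁆⁆
  rw [h2, br_zero, D.f_e_Φ, smul_T, ← D.F_f_v, D.f_e_Φ_ne _ (Ne.symm hij), br_zero, T_zero,
    add_zero, eq_comm, smul_eq_zero] at h3
  replace h3 := h3.resolve_left two_ne_zero
  have h4 := T_Φ_F pos (D.R_le_Rg _ (hm i)) (D.h_R (hm i))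
  simp only [Core.wt_single] at h4
  have h5 := h4 i j
  rw [h3, smul_zero, smul_eq_zero, Int.cast_eq_zero] at h5
  have h6 := h4 k i
  rw [h5.resolve_left hA, smul_zero, D.A_diag, smul_eq_zero] at h6
  exact h6.resolve_left (by norm_num)

/-- The vector has weight −2 at node j and is killed by e_j: one term is a multiple of
T(Φ_k,[F,Φ_j]), the other comes from lowering T([e_j,Φ_j],[F,Φ_j]), which vanishes by antisymmetry.
-/
theorem T_f_Φ (pos : D.NotAntidominant)
    (h : ∀ j k, D.T (D.Φ k) ⁅D.F, ⁅D.e j, D.Φ j⁆⁆ = 0) (j k : I) :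
    D.T (D.Φ k) ⁅D.F, ⁅D.f j, D.Φ j⁆⁆ = 0 := by
  refine D.eq_zero_of_e (a := j) (m := -2) (by norm_num) ?_ ?_
  · rw [D.h_T, D.h_Φ, zero_T, zero_add, comm (D.h_ev j) (D.h_F j), D.wt_f (D.wt_Φ j j), br_smul,
      T_smul, D.A_diag]
    norm_num
  · have h1 := D.f_T j ⁅D.e j, D.Φ j⁆ ⁅D.F, D.Φ j⁆
    rw [T_anti pos (D.e_mem (D.Φ_mem j) j) (D.Φ_mem j), h, neg_zero, br_zero, D.f_e_Φ, smul_T,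
      D.T_Φ_ψ, smul_zero, zero_add, ← D.F_f_v] at h1
    rw [D.e_T, D.e_Φ, smul_T, ← h1, smul_zero, zero_add, ← D.F_e_v, D.e_f_Φ, br_smul, T_smul,
      D.T_Φ_ψ, smul_zero]

/-- `[Φ k, [F, r]] = [z, [F, [h k, r]]]` for all `r` in `Rg` if it holds for one nonzero `[F, r]`. -/
theorem T_eq_zero (pos : D.NotAntidominant) (nd : D.Nondegenerate)
    (conn : ∀ (Q : I → Prop) (i j : I), (∀ i j, D.A i j ≠ 0 → Q i → Q j) → Q i → Q j)
    {γ : I → ℕ} (hγ : γ ≠ 0) {r₀ : L} (hr₀ : r₀ ∈ D.R γ) (hF : ⁅D.F, r₀⁆ ≠ 0)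
    (h0 : ∀ k, D.T (D.Φ k) ⁅D.F, r₀⁆ = 0) {r : L} (hr : r ∈ D.Rg) (k : I) :
    D.T (D.Φ k) ⁅D.F, r⁆ = 0 := by
  -- Descend from r₀ to a single node, then spread along the edges of the connected diagram.
  have he : ∀ j k, D.T (D.Φ k) ⁅D.F, ⁅D.e j, D.Φ j⁆⁆ = 0 := by
    obtain ⟨j, hj⟩ := exists_F_e_Φ_mem pos (⨅ k, LinearMap.ker (D.TL (D.Φ k))) (fun γ i r hne hr h => by
      simp only [Submodule.mem_iInf, LinearMap.mem_ker, TL_apply] at h ⊢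
      have h1 (k : I) := T_Φ_f i k (h k)
      simp only [← D.F_f_v] at h1
      intro k
      rw [h1, (content_of_T pos nd (D.f_mem_R hr) h1).resolve_left hne, smul_zero]) hγ hr₀ hF
      (by simpa using h0)
    simp only [Submodule.mem_iInf, LinearMap.mem_ker, TL_apply] at hj
    exact fun i => conn (fun j => ∀ k, D.T (D.Φ k) ⁅D.F, ⁅D.e j, D.Φ j⁆⁆ = 0) j i
      (fun i j hA hi => T_edge pos nd hA hi) hj
  -- Crosses to the lowering side, so that the Chevalley involution of `T_word` covers the other
  -- half of Rg.
  have hf := T_f_Φ pos he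
  refine (sup_le (iSup_le fun γ r hr => T_word pos nd he hr k) (iSup_le fun γ r hr => ?_) :
    _ ≤ LinearMap.ker (D.TL (D.Φ k) ∘ₗ ad K D.F)) (D.Rg_le_sup hr)
  exact (D.swap_T _ _).symm.trans (T_word (D := D.swap) pos nd
    (fun j k => (D.swap_T _ _).trans (hf j k)) hr k)

end FCore

end

/-! ### Consequences of the relations -/

section

variable {K L I : Type*} [Field K] [AddCommGroup L] [Module K L] [Bracket L L]
  [BiadditiveBracket L] [SuperBracket K L]

variable (K L I) in
/-- The generators and relations of the tensor hierarchy algebra, together with the properties of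
the affine Cartan matrix that are used. -/
structure Hierarchy [Fintype I] [DecidableEq I] extends Core K L (Option I) where
  E : L
  F : L
  E_ev : E ∈ ev (K := K)
  F_ev : F ∈ ev (K := K)
  E_e (i : I) : ⁅E, e (some i)⁆ = 0
  E_f (a : Option I) : ⁅E, f a⁆ = 0
  F_e (a : Option I) : ⁅F, e a⁆ = 0
  F_f (i : I) : ⁅F, f (some i)⁆ = 0
  F_ε : ⁅F, ε⁆ = 0
  h_E : ⁅h none, E⁆ = -E
  h_F : ⁅h none, F⁆ = F
  H_E : ⁅⁅E, F⁆, E⁆ = (2 : K) • E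
  H_F : ⁅⁅E, F⁆, F⁆ = -(2 : K) • F
  H_ε : ⁅⁅E, F⁆, ε⁆ = -ε
  H_Φ (a : Option I) : ⁅⁅E, F⁆, Φ a⁆ = Φ a
  H_e : ⁅⁅E, F⁆, e none⁆ = -e none
  E_E_ε : ⁅E, ⁅E, ε⁆⁆ = 0
  E_Φ (a : Option I) : ⁅E, Φ a⁆ = 0
  F_F_Φ (a : Option I) : ⁅F, ⁅F, Φ a⁆⁆ = 0
  Φ_F_Φ (i j : I) : ⁅Φ (some i), ⁅F, Φ (some j)⁆⁆ = 0
  E_nil (v : L) : v ∈ nil K E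
  F_nil (v : L) : v ∈ nil K F
  comark : I → K
  comark_sum (b : Option I) : (A none b : K) + ∑ k, comark k * (A (some k) b : K) = 0
  pos (γ : I → ℕ) : γ ≠ 0 → ∃ i, 0 < ∑ j, A (some i) (some j) * γ j
  nondeg (x : I → ℤ) : (∀ l, ∑ j, A (some l) (some j) * x j = 0) → x = 0
  conn (Q : I → Prop) (i j : I) : (∀ i j, A (some i) (some j) ≠ 0 → Q i → Q j) → Q i → Q j

namespace Hierarchy

variable [Fintype I] [DecidableEq I] (D : Hierarchy K L I)

/-- The finite part. -/
def G : Core K L I := D.toCore.restrict some (Option.some_injective I)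

/-- The element of the span of the `Φ a` that commutes with the affine subalgebra. -/
def Φc : L := D.Φ none + ∑ k, D.comark k • D.Φ (some k)

theorem Φ_none : D.Φ none = D.Φc - ∑ k, D.comark k • D.Φ (some k) := by simp [Φc]

theorem Φc_od : D.Φc ∈ od (K := K) :=
  add_mem (D.Φ_od _) (sum_mem fun _ _ => Submodule.smul_mem _ _ (D.Φ_od _))

theorem map_Φc (T : L →ₗ[K] L) : T D.Φc = T (D.Φ none) + ∑ k, D.comark k • T (D.Φ (some k)) := by
  simp [Φc]

theorem map_Φc_eq_zero (T : L →ₗ[K] L) (hT : ∀ a, T (D.Φ a) = 0) : T D.Φc = 0 := by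
  simp [map_Φc, hT]

theorem E_Φc : ⁅D.E, D.Φc⁆ = 0 := D.map_Φc_eq_zero (ad K D.E) D.E_Φ

theorem F_F_Φc : ⁅D.F, ⁅D.F, D.Φc⁆⁆ = 0 := D.map_Φc_eq_zero (ad K D.F ∘ₗ ad K D.F) D.F_F_Φ

theorem Φ_Φc (a : Option I) : ⁅D.Φ a, D.Φc⁆ = 0 := D.map_Φc_eq_zero (ad K (D.Φ a)) (D.Φ_Φ a)

theorem Φc_Φ (a : Option I) : ⁅D.Φc, D.Φ a⁆ = 0 := by rw [symm D.Φc_od (D.Φ_od a), D.Φ_Φc]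

theorem Φc_Φc : ⁅D.Φc, D.Φc⁆ = 0 := D.map_Φc_eq_zero (ad K D.Φc) D.Φc_Φ

theorem h_Φc (a : Option I) : ⁅D.h a, D.Φc⁆ = 0 := D.map_Φc_eq_zero (ad K (D.h a)) (D.h_Φ a)

theorem H_Φc : ⁅⁅D.E, D.F⁆, D.Φc⁆ = D.Φc := by
  rw [← ad_apply (K := K), map_Φc]
  simp [D.H_Φ, Φc]

theorem H_ev : ⁅D.E, D.F⁆ ∈ ev (K := K) := ev_ev D.E_ev D.F_ev

theorem F_E : ⁅D.F, D.E⁆ = -⁅D.E, D.F⁆ := anti D.F_ev _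

theorem F_e_v (a : Option I) (v : L) : ⁅D.F, ⁅D.e a, v⁆⁆ = ⁅D.e a, ⁅D.F, v⁆⁆ :=
  comm D.F_ev (D.F_e a) v

theorem F_f_v (i : I) (v : L) : ⁅D.F, ⁅D.f (some i), v⁆⁆ = ⁅D.f (some i), ⁅D.F, v⁆⁆ :=
  comm D.F_ev (D.F_f i) v

theorem E_e_v (i : I) (v : L) : ⁅D.E, ⁅D.e (some i), v⁆⁆ = ⁅D.e (some i), ⁅D.E, v⁆⁆ :=
  comm D.E_ev (D.E_e i) v

theorem E_f_v (a : Option I) (v : L) : ⁅D.E, ⁅D.f a, v⁆⁆ = ⁅D.f a, ⁅D.E, v⁆⁆ :=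
  comm D.E_ev (D.E_f a) v

theorem E_F_v (v : L) : ⁅D.E, ⁅D.F, v⁆⁆ = ⁅⁅D.E, D.F⁆, v⁆ + ⁅D.F, ⁅D.E, v⁆⁆ := jac D.E_ev _ _

theorem F_E_v (v : L) : ⁅D.F, ⁅D.E, v⁆⁆ = ⁅D.E, ⁅D.F, v⁆⁆ - ⁅⁅D.E, D.F⁆, v⁆ := by
  rw [E_F_v]; abel

theorem ε_F_v (v : L) : ⁅D.ε, ⁅D.F, v⁆⁆ = ⁅D.F, ⁅D.ε, v⁆⁆ := (comm D.F_ev D.F_ε v).symm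

variable [CharZero K]

/-- The brackets [e_a,Φ_c] are A_ca/2 times one fixed vector, and the comarks are a linear
dependence between the rows of A. -/
theorem e_Φc (a : Option I) : ⁅D.e a, D.Φc⁆ = 0 := by
  rw [← ad_apply (K := K), map_Φc]
  simp only [ad_apply, D.e_Φ a none, fun k => D.e_Φ a (some k), smul_smul, ← Finset.sum_smul,
    ← add_smul]
  convert zero_smul K _
  rw [← zero_div (2 : K), ← D.comark_sum a, add_div, Finset.sum_div]
  simp only [mul_div_assoc]

theorem f_Φc (a : Option I) : ⁅D.f a, D.Φc⁆ = 0 := by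
  rw [← ad_apply (K := K), map_Φc]
  simp only [ad_apply, D.f_Φ a none, fun k => D.f_Φ a (some k), smul_smul, ← Finset.sum_smul,
    ← add_smul]
  convert zero_smul K _
  rw [← zero_div (2 : K), ← D.comark_sum a, add_div, Finset.sum_div]
  simp only [mul_div_assoc]

theorem Φc_e (a : Option I) : ⁅D.Φc, D.e a⁆ = 0 := br_eq_zero_symm (D.e_ev a) (D.e_Φc a)

theorem Φc_f (a : Option I) : ⁅D.Φc, D.f a⁆ = 0 := br_eq_zero_symm (D.f_ev a) (D.f_Φc a)

theorem eq_zero_of_E {v : L} {m : ℤ} (hm : m < 0) (hw : ⁅⁅D.E, D.F⁆, v⁆ = (m : K) • v)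
    (hE : ⁅D.E, v⁆ = 0) : v = 0 := by
  refine TensorHierarchy.eq_zero_of_f (h := -⁅D.E, D.F⁆) D.F_ev (neg_mem D.H_ev) D.F_E ?_
    (D.F_nil v) (m := -m) (by omega) hE ?_
  · simp [D.H_F]
  · simp [hw]

theorem E_eq_zero {v : L} (hw : ⁅⁅D.E, D.F⁆, v⁆ = 0) (hF : ⁅D.F, v⁆ = 0) : ⁅D.E, v⁆ = 0 :=
  TensorHierarchy.br_e_eq_zero D.E_ev D.F_ev D.H_ev rfl D.H_E (D.E_nil v) hF hw

/-- The weight under h₀ is 1, and f₀ leads to 2[E,Φ₀] = 0. -/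
theorem E_a₀ : ⁅D.E, ⁅D.e none, D.Φ none⁆⁆ = 0 := by
  refine D.eq_zero_of_f (a := none) (m := 1) (by norm_num) ?_ ?_
  · rw [br_of_wt (D.h_ev none) (p := -1) (by rw [D.h_E]; simp) (D.wt_e (D.wt_Φ none none)),
      D.A_diag]
    congr 1; norm_num
  · rw [← D.E_f_v, D.f_e_Φ, br_smul, D.E_Φ, smul_zero]

/-- For the sl₂ of node −1, [e₀,Φ₀] has weight 0 and is killed by E. Hence its image under F has
weight −2 and is killed by E as well. -/
theorem F_a₀ : ⁅D.F, ⁅D.e none, D.Φ none⁆⁆ = 0 := by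
  have hH : ⁅⁅D.E, D.F⁆, ⁅D.e none, D.Φ none⁆⁆ = 0 := by
    rw [jac D.H_ev, D.H_e, D.H_Φ]; simp
  refine D.eq_zero_of_E (m := -2) (by norm_num) ?_ ?_
  · rw [br_of_wt D.H_ev D.H_F (q := 0) (by simp [hH])]; congr 1; norm_num
  · rw [E_F_v, hH, E_a₀]; simp

theorem e_none_ψ (c : Option I) : ⁅D.e none, ⁅D.F, D.Φ c⁆⁆ = 0 := by
  rw [← F_e_v, D.e_Φ, br_smul, F_a₀, smul_zero]

theorem h_none_F_v {v : L} {q : K} (hv : ⁅D.h none, v⁆ = q • v) :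
    ⁅D.h none, ⁅D.F, v⁆⁆ = (1 + q) • ⁅D.F, v⁆ :=
  br_of_wt (D.h_ev none) (by rw [D.h_F, one_smul]) hv

/-- Both sides have weight −1 under h₀, and e₀ sends both to [F,Φ₀]. -/
theorem f_none_ψ_none : ⁅D.f none, ⁅D.F, D.Φ none⁆⁆ =
    (1 / 2 : K) • ⁅D.F, ⁅D.f none, D.Φ none⁆⁆ := by
  rw [← sub_eq_zero]
  refine D.eq_zero_of_e (a := none) (m := -1) (by norm_num) ?_ ?_
  · rw [br_sub, br_smul, D.wt_f (D.h_none_F_v (D.wt_Φ none none)),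
      D.h_none_F_v (D.wt_f (D.wt_Φ none none)), D.A_diag, smul_comm, smul_sub]
    congr 2 <;> norm_num
  · rw [br_sub, br_smul, D.e_f_v_same, e_none_ψ, D.h_none_F_v (D.wt_Φ none none), ← F_e_v,
      D.e_f_Φ, br_smul, smul_smul]
    simp

/-- The finite part with `F` and `Φc`. -/
def FG : FCore K L I where
  toCore := D.G
  F := D.F
  z := D.Φc
  F_ev := D.F_ev
  z_od := D.Φc_od
  F_e i := D.F_e (some i)
  F_f i := D.F_f i
  F_ε := D.F_ε
  z_e i := D.Φc_e (some i)
  z_f i := D.Φc_f (some i)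
  z_Φ i := D.Φc_Φ (some i)
  Φ_ψ := D.Φ_F_Φ

/-- The module generated by the `Φ k` under the finite part. -/
def Rg : Submodule K L := D.G.Rg

/-- The span of the words of a given content. -/
def R (γ : I → ℕ) : Submodule K L := D.G.R γ

theorem R_le_Rg (γ : I → ℕ) : D.R γ ≤ D.Rg := D.G.R_le_Rg γ

theorem map_Rg (T : L →ₗ[K] L) (hΦ : ∀ k, T (D.Φ (some k)) = 0)
    (he : ∀ i v, v ∈ D.Rg → T v = 0 → T ⁅D.e (some i), v⁆ = 0)
    (hf : ∀ i v, v ∈ D.Rg → T v = 0 → T ⁅D.f (some i), v⁆ = 0) {r : L} (hr : r ∈ D.Rg) : T r = 0 :=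
  D.G.map_Rg T hΦ he hf hr

theorem Rg_od {r : L} (hr : r ∈ D.Rg) : r ∈ od (K := K) := D.G.Rg_od hr

theorem ε_Rg_ev {r : L} (hr : r ∈ D.Rg) : ⁅D.ε, r⁆ ∈ ev (K := K) := D.G.ε_Rg_ev hr

theorem Φ_mem (i : I) : D.Φ (some i) ∈ D.Rg := D.G.Φ_mem i

theorem e_mem {r : L} (hr : r ∈ D.Rg) (i : I) : ⁅D.e (some i), r⁆ ∈ D.Rg := D.G.e_mem hr i

theorem f_mem {r : L} (hr : r ∈ D.Rg) (i : I) : ⁅D.f (some i), r⁆ ∈ D.Rg := D.G.f_mem hr i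

theorem Rg_Rg {r r' : L} (hr : r ∈ D.Rg) (hr' : r' ∈ D.Rg) : ⁅r, r'⁆ = 0 :=
  Core.Rg_Rg (D := D.G) D.pos hr hr'

theorem Φc_Rg {r : L} (hr : r ∈ D.Rg) : ⁅D.Φc, r⁆ = 0 := D.FG.z_Rg hr

theorem Rg_Φc {r : L} (hr : r ∈ D.Rg) : ⁅r, D.Φc⁆ = 0 := by
  rw [symm (D.Rg_od hr) D.Φc_od, D.Φc_Rg hr]

theorem Rg_Φ {r : L} (hr : r ∈ D.Rg) (a : Option I) : ⁅r, D.Φ a⁆ = 0 := by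
  cases a with
  | some i => exact D.Rg_Rg hr (D.Φ_mem i)
  | none =>
    rw [Φ_none, br_sub, D.Rg_Φc hr, br_sum, zero_sub, neg_eq_zero]
    exact Finset.sum_eq_zero fun k _ => by rw [br_smul, D.Rg_Rg hr (D.Φ_mem k), smul_zero]

theorem ε_Rg_Φ {r : L} (hr : r ∈ D.Rg) (a : Option I) : ⁅⁅D.ε, r⁆, D.Φ a⁆ = -⁅D.h a, r⁆ := by
  have := jac_od D.ε_od (D.Rg_od hr) (D.Φ a)
  rw [D.Rg_Φ hr, br_zero, D.ε_Φ, eq_comm, sub_eq_zero] at this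
  rw [this, anti (D.h_ev a), neg_neg]

theorem ε_ε_v (v : L) : ⁅D.ε, ⁅D.ε, v⁆⁆ = 0 := od_sq D.ε_od D.ε_ε v

theorem E_Rg {r : L} (hr : r ∈ D.Rg) : ⁅D.E, r⁆ = 0 :=
  D.G.Rg_eq_zero D.E_e (fun i => D.E_f (some i)) (fun i => D.E_Φ (some i)) hr

theorem E_h (i : I) : ⁅D.E, D.h (some i)⁆ = 0 := by
  rw [← D.e_f_same, E_e_v, D.E_f, br_zero]

theorem E_ε_Rg {r : L} (hr : r ∈ D.Rg) : ⁅D.E, ⁅D.ε, r⁆⁆ = 0 :=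
  D.map_Rg (ad K D.E ∘ₗ ad K D.ε) (fun k => by
      simp only [LinearMap.comp_apply, ad_apply]
      exact (congrArg _ (D.ε_Φ (some k))).trans (D.E_h k))
    (fun i v _ h => by
      simp only [LinearMap.comp_apply, ad_apply] at h ⊢
      rw [D.ε_e_v, D.E_e_v, h, br_zero])
    (fun i v _ h => by
      simp only [LinearMap.comp_apply, ad_apply] at h ⊢
      rw [D.ε_f_v, D.E_f_v, h, br_zero]) hr

theorem F_ε_Rg {r : L} (hr : r ∈ D.Rg) : ⁅D.F, ⁅D.ε, r⁆⁆ = 0 := D.FG.F_ε_Rg hr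

theorem Φc_ε_Rg {r : L} (hr : r ∈ D.Rg) : ⁅D.Φc, ⁅D.ε, r⁆⁆ = 0 := D.FG.z_ε_Rg hr

theorem ε_Rg_F_v {r : L} (hr : r ∈ D.Rg) (v : L) :
    ⁅⁅D.ε, r⁆, ⁅D.F, v⁆⁆ = ⁅D.F, ⁅⁅D.ε, r⁆, v⁆⁆ := (comm D.F_ev (D.F_ε_Rg hr) v).symm

theorem H_Rg {r : L} (hr : r ∈ D.Rg) : ⁅⁅D.E, D.F⁆, r⁆ = r := by
  have he (i : I) : ⁅⁅D.E, D.F⁆, D.e (some i)⁆ = 0 := by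
    have := D.E_F_v (D.e (some i))
    rw [D.F_e, D.E_e] at this; simpa using this.symm
  have hf (i : I) : ⁅⁅D.E, D.F⁆, D.f (some i)⁆ = 0 := by
    have := D.E_F_v (D.f (some i))
    rw [D.F_f, D.E_f] at this; simpa using this.symm
  have := D.map_Rg (ad K ⁅D.E, D.F⁆ - LinearMap.id) (fun k => by
      simpa [sub_eq_zero] using D.H_Φ (some k))
    (fun i v _ h => by
      simp only [LinearMap.sub_apply, ad_apply, LinearMap.id_apply, sub_eq_zero] at h ⊢
      rw [comm D.H_ev (he i), h])
    (fun i v _ h => by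
      simp only [LinearMap.sub_apply, ad_apply, LinearMap.id_apply, sub_eq_zero] at h ⊢
      rw [comm D.H_ev (hf i), h]) hr
  simpa [sub_eq_zero] using this

theorem E_F_Rg {r : L} (hr : r ∈ D.Rg) : ⁅D.E, ⁅D.F, r⁆⁆ = r := by
  rw [E_F_v, D.H_Rg hr, D.E_Rg hr]; simp

theorem F_F_Rg {r : L} (hr : r ∈ D.Rg) : ⁅D.F, ⁅D.F, r⁆⁆ = 0 :=
  D.map_Rg (ad K D.F ∘ₗ ad K D.F) (fun k => D.F_F_Φ (some k))
    (fun i v _ h => by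
      simp only [LinearMap.comp_apply, ad_apply] at h ⊢
      rw [D.F_e_v, D.F_e_v, h, br_zero])
    (fun i v _ h => by
      simp only [LinearMap.comp_apply, ad_apply] at h ⊢
      rw [D.F_f_v, D.F_f_v, h, br_zero]) hr

/-- The operator f₀ passes every e_i with i ≥ 1, and a nonempty word ends in some [e_i,Φ_k], which
f₀ kills. -/
theorem f_none_R {γ : I → ℕ} (hγ : γ ≠ 0) {v : L} (hv : v ∈ D.R γ) : ⁅D.f none, v⁆ = 0 := by
  have h (γ : I → ℕ) (v : L) (hv : D.G.Word γ v) : γ ≠ 0 → ⁅D.f none, v⁆ = 0 := by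
    induction hv with
    | Φ k => exact fun h => absurd rfl h
    | @e i γ v hv ih =>
      intro _
      rw [show D.G.e i = D.e (some i) from rfl, D.f_e_v_ne (by simp)]
      by_cases hγ : γ = 0
      · subst hγ
        exact D.G.R_zero_le (M := LinearMap.ker (ad K (D.e (some i)) ∘ₗ ad K (D.f none)))
          (fun k => D.e_f_Φ_ne (some k) (by simp)) hv.mem
      · rw [ih hγ, br_zero]
  exact D.G.R_le (M := LinearMap.ker (ad K (D.f none))) (fun v hv => h γ v hv hγ) hv

/-- The words on the other side are annihilated by `e none`. -/
theorem e_none_swap_R {γ : I → ℕ} (hγ : γ ≠ 0) {v : L} (hv : v ∈ D.G.swap.R γ) :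
    ⁅D.e none, v⁆ = 0 := by
  have h (γ : I → ℕ) (v : L) (hv : D.G.swap.Word γ v) : γ ≠ 0 → ⁅D.e none, v⁆ = 0 := by
    induction hv with
    | Φ k => exact fun h => absurd rfl h
    | @e i γ v hv ih =>
      intro _
      rw [show D.G.swap.e i = D.f (some i) from rfl, ← D.f_e_v_ne (by simp)]
      by_cases hγ : γ = 0
      · subst hγ
        exact D.G.swap.R_zero_le (M := LinearMap.ker (ad K (D.f (some i)) ∘ₗ ad K (D.e none)))
          (fun k => D.f_e_Φ_ne (some k) (by simp)) hv.mem
      · rw [ih hγ, br_zero]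
  exact D.G.swap.R_le (M := LinearMap.ker (ad K (D.e none))) (fun v hv => h γ v hv hγ) hv

/-- `[[ε, r], Φ₀]` determines `[F, r]`. -/
theorem F_Rg_eq {r : L} (hr : r ∈ D.Rg) {a : Option I} {w : K} (hw : ⁅D.h a, r⁆ = w • r) :
    w • ⁅D.F, r⁆ = -⁅⁅D.ε, r⁆, ⁅D.F, D.Φ a⁆⁆ := by
  rw [D.ε_Rg_F_v hr, D.ε_Rg_Φ hr, hw]; simp [br_smul]

/-- By `F_Rg_eq`, w[F,r] is −[[ε,r],[F,Φ₀]]. Since f₀ commutes with [ε,r], it meets only [F,Φ₀], and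
`f_none_ψ_none` leaves a multiple of [F,[f₀,r]] = 0. -/
theorem f_none_F_Rg {r : L} (hr : r ∈ D.Rg) (hf : ⁅D.f none, r⁆ = 0) {w : K} (hw0 : w ≠ 0)
    (hw : ⁅D.h none, r⁆ = w • r) : ⁅D.f none, ⁅D.F, r⁆⁆ = 0 := by
  have h1 := D.F_Rg_eq hr hw
  have h2 : ⁅D.f none, ⁅⁅D.ε, r⁆, ⁅D.F, D.Φ none⁆⁆⁆ = 0 := by
    have h3 : ⁅D.f none, ⁅D.ε, r⁆⁆ = 0 := by rw [← D.ε_f_v, hf, br_zero]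
    rw [jac (D.f_ev none), h3, f_none_ψ_none, br_smul, D.ε_Rg_F_v hr,
      comm (D.ε_Rg_ev hr) (br_eq_zero_symm (D.f_ev none) h3), D.ε_Rg_Φ hr, hw]
    simp [br_smul, hf]
  have h4 := congrArg (fun x => ⁅D.f none, x⁆) h1
  simp only [br_smul, br_neg, h2, neg_zero, smul_eq_zero] at h4
  exact h4.resolve_left hw0

end Hierarchy

end

/-! ### The subalgebra of degree zero at the affine node -/

section

variable {K L I : Type*} [Field K] [AddCommGroup L] [Module K L] [Bracket L L]
  [BiadditiveBracket L] [SuperBracket K L]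

/-- The elements that map a given space to itself. -/
def normalizer (M : Submodule K L) : Submodule K L where
  carrier := {y | ∀ m ∈ M, ⁅y, m⁆ ∈ M}
  zero_mem' := by simp
  add_mem' hx hy m hm := by rw [add_br]; exact add_mem (hx m hm) (hy m hm)
  smul_mem' c x hx m hm := by rw [smul_br]; exact M.smul_mem _ (hx m hm)

theorem br_mem_normalizer {M : Submodule K L} {x y : L} (hx : x ∈ ev (K := K))
    (hxM : x ∈ normalizer M) (hyM : y ∈ normalizer M) : ⁅x, y⁆ ∈ normalizer M := fun m hm => by
  rw [eq_sub_of_add_eq (jac hx y m).symm]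
  exact sub_mem (hxM _ (hyM m hm)) (hyM _ (hxM m hm))

theorem od_br_mem_normalizer {M : Submodule K L} {x y : L} (hx : x ∈ od (K := K))
    (hy : y ∈ od (K := K)) (hxM : x ∈ normalizer M) (hyM : y ∈ normalizer M) :
    ⁅x, y⁆ ∈ normalizer M := fun m hm => by
  rw [← add_eq_of_eq_sub (jac_od hx hy m)]
  exact add_mem (hxM _ (hyM m hm)) (hyM _ (hxM m hm))

theorem br_ev_mem_normalizer {M : Submodule K L} {x y : L} (hy : y ∈ ev (K := K))
    (hxM : x ∈ normalizer M) (hyM : y ∈ normalizer M) : ⁅x, y⁆ ∈ normalizer M := by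
  rw [← neg_neg ⁅x, y⁆, ← anti hy]
  exact neg_mem (br_mem_normalizer hy hyM hxM)

variable [Fintype I] [DecidableEq I] [CharZero K]

namespace Hierarchy

variable (D : Hierarchy K L I)

/-- The span of a set that turns out to be closed under the bracket, and contains all generators
except for `e none` and `f none`. -/
def L0 : Submodule K L :=
  Submodule.span K {D.ε, ⁅D.ε, D.E⁆, D.E, D.F, ⁅D.E, D.F⁆, D.h none, D.Φc, ⁅D.F, D.Φc⁆} ⊔
    (D.Rg.map (ad K D.ε) ⊔ (D.Rg ⊔ (D.Rg.map (ad K D.F) ⊔ D.Rg.map (ad K D.Φc ∘ₗ ad K D.F))))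

theorem L0_le {M : Submodule K L} (h1 : D.ε ∈ M) (h2 : ⁅D.ε, D.E⁆ ∈ M) (h3 : D.E ∈ M)
    (h4 : D.F ∈ M) (h5 : ⁅D.E, D.F⁆ ∈ M) (h6 : D.h none ∈ M) (h7 : D.Φc ∈ M)
    (h8 : ⁅D.F, D.Φc⁆ ∈ M) (h9 : ∀ r ∈ D.Rg, ⁅D.ε, r⁆ ∈ M) (h10 : ∀ r ∈ D.Rg, r ∈ M)
    (h11 : ∀ r ∈ D.Rg, ⁅D.F, r⁆ ∈ M) (h12 : ∀ r ∈ D.Rg, ⁅D.Φc, ⁅D.F, r⁆⁆ ∈ M) : D.L0 ≤ M := by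
  refine sup_le (Submodule.span_le.2 ?_) (sup_le ?_ (sup_le h10 (sup_le ?_ ?_)))
  · rintro _ (rfl | rfl | rfl | rfl | rfl | rfl | rfl | rfl) <;> assumption
  · rintro _ ⟨r, hr, rfl⟩; exact h9 r hr
  · rintro _ ⟨r, hr, rfl⟩; exact h11 r hr
  · rintro _ ⟨r, hr, rfl⟩; exact h12 r hr

theorem span_le_L0 : Submodule.span K {D.ε, ⁅D.ε, D.E⁆, D.E, D.F, ⁅D.E, D.F⁆, D.h none, D.Φc,
    ⁅D.F, D.Φc⁆} ≤ D.L0 := le_sup_left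

theorem ε_mem_L0 : D.ε ∈ D.L0 := D.span_le_L0 (Submodule.subset_span (by simp))

theorem ε_E_mem_L0 : ⁅D.ε, D.E⁆ ∈ D.L0 := D.span_le_L0 (Submodule.subset_span (by simp))

theorem E_mem_L0 : D.E ∈ D.L0 := D.span_le_L0 (Submodule.subset_span (by simp))

theorem F_mem_L0 : D.F ∈ D.L0 := D.span_le_L0 (Submodule.subset_span (by simp))

theorem H_mem_L0 : ⁅D.E, D.F⁆ ∈ D.L0 := D.span_le_L0 (Submodule.subset_span (by simp))

theorem h_none_mem_L0 : D.h none ∈ D.L0 := D.span_le_L0 (Submodule.subset_span (by simp))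

theorem Φc_mem_L0 : D.Φc ∈ D.L0 := D.span_le_L0 (Submodule.subset_span (by simp))

theorem F_Φc_mem_L0 : ⁅D.F, D.Φc⁆ ∈ D.L0 := D.span_le_L0 (Submodule.subset_span (by simp))

variable {r : L}

theorem ε_Rg_mem_L0 (hr : r ∈ D.Rg) : ⁅D.ε, r⁆ ∈ D.L0 :=
  Submodule.mem_sup_right (Submodule.mem_sup_left ⟨r, hr, rfl⟩)

theorem Rg_mem_L0 (hr : r ∈ D.Rg) : r ∈ D.L0 :=
  Submodule.mem_sup_right (Submodule.mem_sup_right (Submodule.mem_sup_left hr))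

theorem F_Rg_mem_L0 (hr : r ∈ D.Rg) : ⁅D.F, r⁆ ∈ D.L0 :=
  Submodule.mem_sup_right (Submodule.mem_sup_right (Submodule.mem_sup_right
    (Submodule.mem_sup_left ⟨r, hr, rfl⟩)))

theorem Φc_F_Rg_mem_L0 (hr : r ∈ D.Rg) : ⁅D.Φc, ⁅D.F, r⁆⁆ ∈ D.L0 :=
  Submodule.mem_sup_right (Submodule.mem_sup_right (Submodule.mem_sup_right
    (Submodule.mem_sup_right ⟨r, hr, rfl⟩)))

theorem Φ_mem_L0 (a : Option I) : D.Φ a ∈ D.L0 := by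
  cases a with
  | some i => exact D.Rg_mem_L0 (D.Φ_mem i)
  | none =>
    rw [Φ_none]
    exact sub_mem D.Φc_mem_L0
      (sum_mem fun k _ => Submodule.smul_mem _ _ (D.Rg_mem_L0 (D.Φ_mem k)))

theorem h_mem_L0 (a : Option I) : D.h a ∈ D.L0 := by
  cases a with
  | some i => exact D.ε_Φ (some i) ▸ D.ε_Rg_mem_L0 (D.Φ_mem i)
  | none => exact D.h_none_mem_L0

theorem ε_Φc : ⁅D.ε, D.Φc⁆ = D.h none + ∑ k, D.comark k • D.h (some k) := by
  rw [← ad_apply (K := K), map_Φc]; simp [D.ε_Φ]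

theorem ε_Φc_mem_L0 : ⁅D.ε, D.Φc⁆ ∈ D.L0 := by
  rw [ε_Φc]
  exact add_mem D.h_none_mem_L0 (sum_mem fun k _ => Submodule.smul_mem _ _ (D.h_mem_L0 _))

/-- A space that is stable under the generators is stable under `L0`. -/
theorem L0_le_normalizer {M : Submodule K L} (hE : D.E ∈ normalizer M) (hF : D.F ∈ normalizer M)
    (hε : D.ε ∈ normalizer M) (hΦc : D.Φc ∈ normalizer M)
    (he : ∀ i, D.e (some i) ∈ normalizer M) (hf : ∀ i, D.f (some i) ∈ normalizer M)
    (hΦ : ∀ i, D.Φ (some i) ∈ normalizer M) : D.L0 ≤ normalizer M := by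
  have hr : D.Rg ≤ normalizer M := D.G.Rg_le hΦ
    (fun i v _ hv => br_mem_normalizer (D.e_ev _) (he i) hv)
    (fun i v _ hv => br_mem_normalizer (D.f_ev _) (hf i) hv)
  refine D.L0_le hε (br_ev_mem_normalizer D.E_ev hε hE) hE hF (br_mem_normalizer D.E_ev hE hF) ?_
    hΦc (br_mem_normalizer D.F_ev hF hΦc)
    (fun r hr' => od_br_mem_normalizer D.ε_od (D.Rg_od hr') hε (hr hr')) hr
    (fun r hr' => br_mem_normalizer D.F_ev hF (hr hr'))
    (fun r hr' => od_br_mem_normalizer D.Φc_od (ev_od D.F_ev (D.Rg_od hr')) hΦc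
      (br_mem_normalizer D.F_ev hF (hr hr')))
  -- There is no separate assumption on h₀: it is recovered from [ε,Φc] and the h_k = [ε,Φ_k].
  rw [eq_sub_of_add_eq D.ε_Φc.symm]
  refine sub_mem (od_br_mem_normalizer D.ε_od D.Φc_od hε hΦc)
    (sum_mem fun k _ => Submodule.smul_mem _ _ ?_)
  rw [← D.ε_Φ]
  exact od_br_mem_normalizer D.ε_od (D.Φ_od _) hε (hΦ k)

theorem mem_normalizer_L0 {g : L} (h1 : ⁅g, D.ε⁆ ∈ D.L0) (h2 : ⁅g, ⁅D.ε, D.E⁆⁆ ∈ D.L0)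
    (h3 : ⁅g, D.E⁆ ∈ D.L0) (h4 : ⁅g, D.F⁆ ∈ D.L0) (h5 : ⁅g, ⁅D.E, D.F⁆⁆ ∈ D.L0)
    (h6 : ⁅g, D.h none⁆ ∈ D.L0) (h7 : ⁅g, D.Φc⁆ ∈ D.L0) (h8 : ⁅g, ⁅D.F, D.Φc⁆⁆ ∈ D.L0)
    (h9 : ∀ r ∈ D.Rg, ⁅g, ⁅D.ε, r⁆⁆ ∈ D.L0) (h10 : ∀ r ∈ D.Rg, ⁅g, r⁆ ∈ D.L0)
    (h11 : ∀ r ∈ D.Rg, ⁅g, ⁅D.F, r⁆⁆ ∈ D.L0)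
    (h12 : ∀ r ∈ D.Rg, ⁅g, ⁅D.Φc, ⁅D.F, r⁆⁆⁆ ∈ D.L0) : g ∈ normalizer D.L0 :=
  D.L0_le (M := D.L0.comap (ad K g)) h1 h2 h3 h4 h5 h6 h7 h8 h9 h10 h11 h12

theorem E_ε_E : ⁅D.E, ⁅D.ε, D.E⁆⁆ = 0 := by
  rw [← neg_neg ⁅D.ε, D.E⁆, ← anti D.E_ev, br_neg, D.E_E_ε, neg_zero]

theorem F_ε_E : ⁅D.F, ⁅D.ε, D.E⁆⁆ = -D.ε := by
  rw [← D.ε_F_v, D.F_E, br_neg, ← anti D.H_ev, D.H_ε]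

theorem ε_E_od : ⁅D.ε, D.E⁆ ∈ od (K := K) := od_ev D.ε_od D.E_ev

theorem ε_E_Φ (i : I) : ⁅⁅D.ε, D.E⁆, D.Φ (some i)⁆ = 0 := by
  have h := jac_od_ev (x := D.ε) D.E_ev (D.Φ (some i))
  rw [D.E_Φ, br_zero, D.ε_Φ, D.E_h, add_zero] at h
  exact h.symm

theorem E_h_none : ⁅D.E, D.h none⁆ = D.E := by rw [anti D.E_ev, D.h_E, neg_neg]

theorem F_h_none : ⁅D.F, D.h none⁆ = -D.F := by rw [anti D.F_ev, D.h_F]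

theorem F_h (i : I) : ⁅D.F, D.h (some i)⁆ = 0 := by
  rw [← D.e_f_same, F_e_v, D.F_f, br_zero]

theorem E_ε_Φc : ⁅D.E, ⁅D.ε, D.Φc⁆⁆ = D.E := by
  rw [ε_Φc, br_add, E_h_none, br_sum, Finset.sum_eq_zero, add_zero]
  exact fun k _ => by rw [br_smul, E_h, smul_zero]

theorem F_ε_Φc : ⁅D.F, ⁅D.ε, D.Φc⁆⁆ = -D.F := by
  rw [ε_Φc, br_add, F_h_none, br_sum, Finset.sum_eq_zero, add_zero]
  exact fun k _ => by rw [br_smul, F_h, smul_zero]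

theorem ε_Φc_ev : ⁅D.ε, D.Φc⁆ ∈ ev (K := K) := od_od D.ε_od D.Φc_od

theorem Φc_Φc_v (v : L) : ⁅D.Φc, ⁅D.Φc, v⁆⁆ = 0 := od_sq D.Φc_od D.Φc_Φc v

theorem Φc_F_Φc : ⁅D.Φc, ⁅D.F, D.Φc⁆⁆ = 0 := by
  have h := jac D.F_ev D.Φc D.Φc
  rw [D.Φc_Φc, br_zero, symm (ev_od D.F_ev D.Φc_od) D.Φc_od, ← two_smul K, eq_comm,
    smul_eq_zero] at h
  exact h.resolve_left two_ne_zero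

theorem F_Φc_F_Φc : ⁅⁅D.F, D.Φc⁆, ⁅D.F, D.Φc⁆⁆ = 0 := by
  have h := jac D.F_ev D.Φc ⁅D.F, D.Φc⁆
  rw [D.Φc_F_Φc, br_zero, D.F_F_Φc, br_zero, add_zero] at h
  exact h.symm

theorem ε_E_Φc : ⁅⁅D.ε, D.E⁆, D.Φc⁆ = -D.E := by
  have h := jac_od_ev (x := D.ε) D.E_ev D.Φc
  rw [D.E_Φc, br_zero, E_ε_Φc] at h
  exact eq_neg_of_add_eq_zero_left h.symm

theorem ε_Φc_Rg (hr : r ∈ D.Rg) : ⁅⁅D.ε, D.Φc⁆, r⁆ = 0 := by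
  have h := jac_od D.ε_od D.Φc_od r
  rw [D.Φc_Rg hr, br_zero, D.Φc_ε_Rg hr, sub_zero] at h
  exact h.symm

theorem ε_Φc_F_Rg (hr : r ∈ D.Rg) : ⁅⁅D.ε, D.Φc⁆, ⁅D.F, r⁆⁆ = ⁅D.F, r⁆ := by
  rw [jac D.ε_Φc_ev, D.ε_Φc_Rg hr, br_zero, anti D.ε_Φc_ev, F_ε_Φc, neg_neg, add_zero]

/-- Since F² kills both Φc and r, applying F² to [Φc,r] = 0 leaves twice this bracket. -/
theorem F_Φc_F_Rg (hr : r ∈ D.Rg) : ⁅⁅D.F, D.Φc⁆, ⁅D.F, r⁆⁆ = 0 := by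
  have h1 := jac D.F_ev D.Φc r
  rw [D.Φc_Rg hr, br_zero] at h1
  have h2 := jac D.F_ev ⁅D.F, D.Φc⁆ r
  rw [D.F_F_Φc, zero_br, zero_add] at h2
  have h3 := jac D.F_ev D.Φc ⁅D.F, r⁆
  rw [D.F_F_Rg hr, br_zero, add_zero, eq_neg_of_add_eq_zero_right h1.symm, br_neg, h2] at h3
  have h4 : (2 : K) • ⁅⁅D.F, D.Φc⁆, ⁅D.F, r⁆⁆ = 0 := by
    rw [two_smul]; nth_rw 1 [← h3]; simp
  exact (smul_eq_zero.1 h4).resolve_left two_ne_zero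

theorem H_ε_E : ⁅⁅D.E, D.F⁆, ⁅D.ε, D.E⁆⁆ = ⁅D.ε, D.E⁆ := by
  rw [jac D.H_ev, D.H_ε, D.H_E, neg_br, br_smul, two_smul]; abel

theorem E_mem_normalizer : D.E ∈ normalizer D.L0 := by
  refine D.mem_normalizer_L0 ?_ ?_ ?_ D.H_mem_L0 ?_ ?_ ?_ ?_ (fun r hr => ?_) (fun r hr => ?_)
    (fun r hr => ?_) (fun r hr => ?_)
  · rw [anti D.E_ev]; exact neg_mem D.ε_E_mem_L0
  · rw [E_ε_E]; exact zero_mem _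
  · rw [br_self D.E_ev]; exact zero_mem _
  · rw [anti D.E_ev, D.H_E]; exact neg_mem (Submodule.smul_mem _ _ D.E_mem_L0)
  · rw [E_h_none]; exact D.E_mem_L0
  · rw [E_Φc]; exact zero_mem _
  · rw [E_F_v, H_Φc, E_Φc, br_zero, add_zero]; exact D.Φc_mem_L0
  · rw [D.E_ε_Rg hr]; exact zero_mem _
  · rw [D.E_Rg hr]; exact zero_mem _
  · rw [D.E_F_Rg hr]; exact D.Rg_mem_L0 hr
  · rw [comm D.E_ev D.E_Φc, D.E_F_Rg hr, D.Φc_Rg hr]; exact zero_mem _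

theorem F_mem_normalizer : D.F ∈ normalizer D.L0 := by
  refine D.mem_normalizer_L0 ?_ ?_ ?_ ?_ ?_ ?_ D.F_Φc_mem_L0 ?_ (fun r hr => ?_)
    (fun r hr => D.F_Rg_mem_L0 hr) (fun r hr => ?_) (fun r hr => ?_)
  · rw [D.F_ε]; exact zero_mem _
  · rw [F_ε_E]; exact neg_mem D.ε_mem_L0
  · rw [F_E]; exact neg_mem D.H_mem_L0
  · rw [br_self D.F_ev]; exact zero_mem _
  · rw [anti D.F_ev, D.H_F]; exact neg_mem (Submodule.smul_mem _ _ D.F_mem_L0)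
  · rw [F_h_none]; exact neg_mem D.F_mem_L0
  · rw [F_F_Φc]; exact zero_mem _
  · rw [D.F_ε_Rg hr]; exact zero_mem _
  · rw [D.F_F_Rg hr]; exact zero_mem _
  · rw [jac D.F_ev, D.F_Φc_F_Rg hr, D.F_F_Rg hr]; simp

theorem ε_mem_normalizer : D.ε ∈ normalizer D.L0 := by
  refine D.mem_normalizer_L0 ?_ ?_ D.ε_E_mem_L0 ?_ ?_ ?_ D.ε_Φc_mem_L0 ?_ (fun r hr => ?_)
    (fun r hr => D.ε_Rg_mem_L0 hr) (fun r hr => ?_) (fun r hr => ?_)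
  · rw [D.ε_ε]; exact zero_mem _
  · rw [ε_ε_v]; exact zero_mem _
  · rw [br_eq_zero_symm D.F_ev D.F_ε]; exact zero_mem _
  · rw [← neg_neg ⁅D.ε, _⁆, ← anti D.H_ev, D.H_ε, neg_neg]; exact D.ε_mem_L0
  · rw [D.ε_h]; exact zero_mem _
  · rw [ε_F_v, F_ε_Φc]; exact neg_mem D.F_mem_L0
  · rw [ε_ε_v]; exact zero_mem _
  · rw [ε_F_v, D.F_ε_Rg hr]; exact zero_mem _
  · rw [jac_od D.ε_od D.Φc_od, ε_F_v, D.F_ε_Rg hr, br_zero, sub_zero, D.ε_Φc_F_Rg hr]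
    exact D.F_Rg_mem_L0 hr

theorem Φc_mem_normalizer : D.Φc ∈ normalizer D.L0 := by
  refine D.mem_normalizer_L0 ?_ ?_ ?_ ?_ ?_ ?_ ?_ ?_ (fun r hr => ?_)
    (fun r hr => ?_) (fun r hr => D.Φc_F_Rg_mem_L0 hr) (fun r hr => ?_)
  · rw [symm D.Φc_od D.ε_od]; exact D.ε_Φc_mem_L0
  · rw [symm D.Φc_od D.ε_E_od, ε_E_Φc]; exact neg_mem D.E_mem_L0
  · rw [br_eq_zero_symm D.E_ev D.E_Φc]; exact zero_mem _
  · rw [← neg_neg ⁅D.Φc, _⁆, ← anti D.F_ev]; exact neg_mem D.F_Φc_mem_L0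
  · rw [← neg_neg ⁅D.Φc, _⁆, ← anti D.H_ev, H_Φc]; exact neg_mem D.Φc_mem_L0
  · rw [br_eq_zero_symm (D.h_ev _) (D.h_Φc _)]; exact zero_mem _
  · rw [D.Φc_Φc]; exact zero_mem _
  · rw [D.Φc_F_Φc]; exact zero_mem _
  · rw [D.Φc_ε_Rg hr]; exact zero_mem _
  · rw [D.Φc_Rg hr]; exact zero_mem _
  · rw [D.Φc_Φc_v]; exact zero_mem _

theorem mem_normalizer_of_comm {x : L} (hx : x ∈ ev (K := K)) (hE : ⁅x, D.E⁆ = 0)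
    (hF : ⁅x, D.F⁆ = 0) (hε : ⁅x, D.ε⁆ = 0) (hΦc : ⁅x, D.Φc⁆ = 0)
    (hh : ⁅x, D.h none⁆ ∈ D.L0) (hR : ∀ r ∈ D.Rg, ⁅x, r⁆ ∈ D.Rg) : x ∈ normalizer D.L0 := by
  refine D.mem_normalizer_L0 ?_ ?_ ?_ ?_ ?_ hh ?_ ?_ (fun r hr => ?_)
    (fun r hr => D.Rg_mem_L0 (hR r hr)) (fun r hr => ?_) (fun r hr => ?_)
  · rw [hε]; exact zero_mem _
  · rw [comm hx hε, hE, br_zero]; exact zero_mem _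
  · rw [hE]; exact zero_mem _
  · rw [hF]; exact zero_mem _
  · rw [comm hx hE, hF, br_zero]; exact zero_mem _
  · rw [hΦc]; exact zero_mem _
  · rw [comm hx hF, hΦc, br_zero]; exact zero_mem _
  · rw [comm hx hε]; exact D.ε_Rg_mem_L0 (hR r hr)
  · rw [comm hx hF]; exact D.F_Rg_mem_L0 (hR r hr)
  · rw [comm hx hΦc, comm hx hF]; exact D.Φc_F_Rg_mem_L0 (hR r hr)

theorem e_mem_L0 (i : I) : D.e (some i) ∈ D.L0 := by
  -- The e_i are not among the spanning elements; up to a factor they are images of Rg under ε.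
  have h : ⁅D.ε, ⁅D.e (some i), D.Φ (some i)⁆⁆ = -(2 : K) • D.e (some i) := by
    rw [D.ε_e_v, D.ε_Φ, anti (D.e_ev _), D.h_e_same, neg_smul]
  exact (D.L0.smul_mem_iff (by norm_num : -(2 : K) ≠ 0)).1
    (h ▸ D.ε_Rg_mem_L0 (D.e_mem (D.Φ_mem i) i))

theorem f_mem_L0 (i : I) : D.f (some i) ∈ D.L0 := by
  have h : ⁅D.ε, ⁅D.f (some i), D.Φ (some i)⁆⁆ = (2 : K) • D.f (some i) := by
    rw [D.ε_f_v, D.ε_Φ, anti (D.f_ev _), D.h_f, D.A_diag]; norm_num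
  exact (D.L0.smul_mem_iff (by norm_num : (2 : K) ≠ 0)).1
    (h ▸ D.ε_Rg_mem_L0 (D.f_mem (D.Φ_mem i) i))

theorem e_mem_normalizer (i : I) : D.e (some i) ∈ normalizer D.L0 :=
  D.mem_normalizer_of_comm (D.e_ev _) (br_eq_zero_symm D.E_ev (D.E_e i))
    (br_eq_zero_symm D.F_ev (D.F_e _)) (D.e_ε _) (D.e_Φc _)
    (by
      rw [anti (D.e_ev _), D.h_e]
      exact neg_mem (Submodule.smul_mem _ _ (D.e_mem_L0 i)))
    (fun r hr => D.e_mem hr i)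

theorem f_mem_normalizer (i : I) : D.f (some i) ∈ normalizer D.L0 :=
  D.mem_normalizer_of_comm (D.f_ev _) (br_eq_zero_symm D.E_ev (D.E_f _))
    (br_eq_zero_symm D.F_ev (D.F_f _)) (D.f_ε _) (D.f_Φc _)
    (by
      rw [anti (D.f_ev _), D.h_f]
      exact neg_mem (Submodule.smul_mem _ _ (D.f_mem_L0 i)))
    (fun r hr => D.f_mem hr i)

variable {D}

/-- The brackets of the `Φ k` with the `[F, r]` are those prescribed by `Φc`. -/
def Good (D : Hierarchy K L I) : Prop := ∀ k, ∀ r ∈ D.Rg,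
  ⁅D.Φ (some k), ⁅D.F, r⁆⁆ = ⁅D.Φc, ⁅D.F, ⁅D.h (some k), r⁆⁆⁆

/-- Only here is `Good` needed: the relations used for the other generators already determine their
action on the spanning set, but not the brackets of Φ_k with [F,Rg]. -/
theorem Φ_mem_normalizer (hD : D.Good) (k : I) : D.Φ (some k) ∈ normalizer D.L0 := by
  refine D.mem_normalizer_L0 ?_ ?_ ?_ ?_ ?_ ?_ ?_ ?_ (fun r hr => ?_)
    (fun r hr => ?_) (fun r hr => ?_) (fun r hr => ?_)
  · rw [D.Φ_ε]; exact D.h_mem_L0 _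
  · rw [symm (D.Φ_od _) D.ε_E_od, ε_E_Φ]; exact zero_mem _
  · rw [br_eq_zero_symm D.E_ev (D.E_Φ _)]; exact zero_mem _
  · rw [← neg_neg ⁅D.Φ _, _⁆, ← anti D.F_ev]; exact neg_mem (D.F_Rg_mem_L0 (D.Φ_mem k))
  · rw [← neg_neg ⁅D.Φ _, _⁆, ← anti D.H_ev, D.H_Φ]; exact neg_mem (D.Φ_mem_L0 _)
  · rw [br_eq_zero_symm (D.h_ev _) (D.h_Φ _ _)]; exact zero_mem _
  · rw [D.Φ_Φc]; exact zero_mem _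
  · have h := jac D.F_ev (D.Φ (some k)) D.Φc
    rw [D.Φ_Φc, br_zero, symm (ev_od D.F_ev (D.Φ_od _)) D.Φc_od] at h
    rw [eq_neg_of_add_eq_zero_right h.symm]
    exact neg_mem (D.Φc_F_Rg_mem_L0 (D.Φ_mem k))
  · rw [← neg_neg ⁅D.Φ _, _⁆, ← anti (D.ε_Rg_ev hr), D.ε_Rg_Φ hr, neg_neg]
    exact D.Rg_mem_L0 (D.G.h_mem hr k)
  · rw [D.Rg_Rg (D.Φ_mem k) hr]; exact zero_mem _
  · rw [hD k r hr]; exact D.Φc_F_Rg_mem_L0 (D.G.h_mem hr k)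
  · rw [anticomm (D.Φ_od _) D.Φc_od (D.Φ_Φc _), hD k r hr, D.Φc_Φc_v, neg_zero]; exact zero_mem _

theorem L0_L0 (hD : D.Good) {x y : L} (hx : x ∈ D.L0) (hy : y ∈ D.L0) : ⁅x, y⁆ ∈ D.L0 :=
  D.L0_le_normalizer D.E_mem_normalizer D.F_mem_normalizer D.ε_mem_normalizer D.Φc_mem_normalizer
    D.e_mem_normalizer D.f_mem_normalizer (Φ_mem_normalizer hD) hx y hy

end Hierarchy

end

/-! ### The ideal generated by a lowest weight vector -/

section

variable {K L I : Type*} [Field K] [AddCommGroup L] [Module K L] [Bracket L L]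
  [BiadditiveBracket L] [SuperBracket K L]

variable [Fintype I] [DecidableEq I] [CharZero K]

namespace Hierarchy

variable (D : Hierarchy K L I)

/-- The elements that commute with `f none`. -/
def centralizer (P : Submodule K L) : Submodule K L :=
  (D.L0 ⊓ P) ⊓ LinearMap.ker (ad K (D.f none))

/-- The elements that map `e none` to a multiple of itself. -/
def stabilizer (P : Submodule K L) : Submodule K L :=
  (D.L0 ⊓ P) ⊓ (Submodule.span K {D.e none}).comap (adRight K (D.e none))

variable {D}

theorem mem_centralizer {P : Submodule K L} {x : L} (h1 : x ∈ D.L0) (h2 : x ∈ P)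
    (h3 : ⁅D.f none, x⁆ = 0) : x ∈ D.centralizer P := ⟨⟨h1, h2⟩, h3⟩

theorem mem_stabilizer_of_mem {P : Submodule K L} {x : L} (h1 : x ∈ D.L0) (h2 : x ∈ P)
    (h3 : ⁅x, D.e none⁆ ∈ Submodule.span K {D.e none}) : x ∈ D.stabilizer P := ⟨⟨h1, h2⟩, h3⟩

theorem mem_stabilizer {P : Submodule K L} {x : L} (h1 : x ∈ D.L0) (h2 : x ∈ P)
    (h3 : ⁅D.e none, x⁆ = 0) : x ∈ D.stabilizer P :=
  mem_stabilizer_of_mem h1 h2 (by rw [br_eq_zero_symm (D.e_ev _) h3]; exact zero_mem _)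

theorem swap_R_le_Rg (γ : I → ℕ) : D.G.swap.R γ ≤ D.Rg :=
  (D.G.swap.R_le_Rg γ).trans D.G.swap_Rg.le

variable (D) in
/-- The span of the elements of `L0` for which the bracket with `e none` or with `f none` is under
control. -/
def split : Submodule K L :=
  (D.centralizer ev ⊔ D.centralizer od) ⊔ (D.stabilizer ev ⊔ D.stabilizer od) ⊔
    Submodule.span K {D.Φ none}

theorem centralizer_ev_le : D.centralizer ev ≤ D.split :=
  le_sup_of_le_left (le_sup_of_le_left le_sup_left)

theorem centralizer_od_le : D.centralizer od ≤ D.split :=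
  le_sup_of_le_left (le_sup_of_le_left le_sup_right)

theorem stabilizer_ev_le : D.stabilizer ev ≤ D.split :=
  le_sup_of_le_left (le_sup_of_le_right le_sup_left)

theorem stabilizer_od_le : D.stabilizer od ≤ D.split :=
  le_sup_of_le_left (le_sup_of_le_right le_sup_right)

theorem h_none_R {γ : I → ℕ} {v : L} (hv : v ∈ D.R γ) :
    ∃ w : K, ⁅D.h none, v⁆ = w • v := by
  have h (γ : I → ℕ) : ∃ w : K, ∀ v, D.G.Word γ v → ⁅D.h none, v⁆ = w • v := by
    refine ⟨∑ j, (D.A none (some j) : K) * γ j, fun v hv => ?_⟩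
    induction hv with
    | Φ k => exact (D.h_Φ _ _).trans (by simp)
    | e i _ ih =>
      refine (D.wt_e ih).trans ?_
      congr 1
      simp [mul_add, Finset.sum_add_distrib, Pi.single_apply, add_comm]
  obtain ⟨w, hw⟩ := h γ
  refine ⟨w, ?_⟩
  have := D.G.R_le (M := LinearMap.ker (ad K (D.h none) - w • LinearMap.id))
    (fun v hv => by simp [hw v hv]) hv
  simpa [sub_eq_zero] using this

/-- For nonzero h₀-weight, `f_none_F_Rg` applies. For weight zero, [ε,r] is killed by f₀, hence by
e₀. Writing [F,r] through [ε,r] and [F,Φ_i] at a node i where its weight is positive shows that e₀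
kills it too. -/
theorem f_or_e_F_R {γ : I → ℕ} {r : L} (hr : r ∈ D.R γ) (hγ : γ ≠ 0) :
    ⁅D.f none, ⁅D.F, r⁆⁆ = 0 ∨ ⁅D.e none, ⁅D.F, r⁆⁆ = 0 := by
  have hf := D.f_none_R hγ hr
  obtain ⟨w, hw⟩ := h_none_R hr
  by_cases h0 : w = 0
  · right
    obtain ⟨i, hi⟩ := D.pos γ hγ
    have he : ⁅D.e none, ⁅D.ε, r⁆⁆ = 0 := by
      refine D.br_e_eq_zero ?_ ?_
      · rw [comm (D.h_ev _) (D.h_ε _), hw, h0]; simp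
      · rw [← D.ε_f_v, hf, br_zero]
    have h1 := D.F_Rg_eq (D.R_le_Rg γ hr) (a := some i) (D.G.h_R hr i)
    have h2 : ⁅D.e none, ⁅⁅D.ε, r⁆, ⁅D.F, D.Φ (some i)⁆⁆⁆ = 0 := by
      rw [comm (D.e_ev _) he, e_none_ψ, br_zero]
    have h3 := congrArg (fun x => ⁅D.e none, x⁆) h1
    simp only [br_smul, br_neg, h2, neg_zero, smul_eq_zero, Int.cast_eq_zero] at h3
    exact h3.resolve_left hi.ne'
  · left
    exact D.f_none_F_Rg (D.R_le_Rg γ hr) hf h0 hw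

/-- This prepares the control of [f₀, V1]. Nonempty raising words in Rg commute with f₀ and nonempty
lowering words with e₀; [ε,·] preserves this, and `f_or_e_F_R` handles [F,·] of raising words. What
remains are the words Φ_k and the eight individual elements. -/
theorem L0_le_split : D.L0 ≤ D.split := by
  refine D.L0_le (centralizer_od_le ⟨⟨D.ε_mem_L0, D.ε_od⟩, D.f_ε _⟩)
    (centralizer_od_le (mem_centralizer D.ε_E_mem_L0 D.ε_E_od ?_))
    (centralizer_ev_le ⟨⟨D.E_mem_L0, D.E_ev⟩, br_eq_zero_symm D.E_ev (D.E_f _)⟩)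
    (stabilizer_ev_le (mem_stabilizer_of_mem D.F_mem_L0 D.F_ev ?_))
    (stabilizer_ev_le (mem_stabilizer_of_mem D.H_mem_L0 D.H_ev ?_))
    (stabilizer_ev_le (mem_stabilizer_of_mem D.h_none_mem_L0 (D.h_ev _) ?_))
    (centralizer_od_le ⟨⟨D.Φc_mem_L0, D.Φc_od⟩, D.f_Φc _⟩)
    (stabilizer_od_le (mem_stabilizer D.F_Φc_mem_L0 (ev_od D.F_ev D.Φc_od) ?_))
    (fun r hr => ?_) (fun r hr => ?_) (fun r hr => ?_) (fun r hr => ?_)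
  · rw [← D.ε_f_v, br_eq_zero_symm D.E_ev (D.E_f _), br_zero]
  · rw [D.F_e]; exact zero_mem _
  · rw [D.H_e]
    exact neg_mem (Submodule.mem_span_singleton_self _)
  · rw [D.h_e_same]
    exact Submodule.smul_mem _ _ (Submodule.mem_span_singleton_self _)
  · rw [← F_e_v, e_Φc, br_zero]
  · refine (sup_le (iSup_le fun γ r hr => ?_) (iSup_le fun γ r hr => ?_) :
      _ ≤ D.split.comap (ad K D.ε)) (D.G.Rg_le_sup hr)
    · have hr' := D.R_le_Rg γ hr
      by_cases hγ : γ = 0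
      · subst hγ
        refine D.G.R_zero_le (M := D.split.comap (ad K D.ε)) (fun k => stabilizer_ev_le
          (x := ⁅D.ε, D.Φ (some k)⁆) (mem_stabilizer_of_mem
            (D.ε_Rg_mem_L0 (D.Φ_mem k)) (D.ε_Rg_ev (D.Φ_mem k)) ?_)) hr
        rw [D.ε_Φ, D.h_e]
        exact Submodule.smul_mem _ _ (Submodule.mem_span_singleton_self _)
      · refine centralizer_ev_le (x := ⁅D.ε, r⁆)
          (mem_centralizer (D.ε_Rg_mem_L0 hr') (D.ε_Rg_ev hr') ?_)
        rw [← D.ε_f_v, D.f_none_R hγ hr, br_zero]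
    · have hr' : r ∈ D.Rg := swap_R_le_Rg γ hr
      by_cases hγ : γ = 0
      · subst hγ
        refine D.G.swap.R_zero_le (M := D.split.comap (ad K D.ε)) (fun k => stabilizer_ev_le
          (x := ⁅D.ε, D.Φ (some k)⁆) (mem_stabilizer_of_mem
            (D.ε_Rg_mem_L0 (D.Φ_mem k)) (D.ε_Rg_ev (D.Φ_mem k)) ?_)) hr
        rw [D.ε_Φ, D.h_e]
        exact Submodule.smul_mem _ _ (Submodule.mem_span_singleton_self _)
      · refine stabilizer_ev_le (x := ⁅D.ε, r⁆)
          (mem_stabilizer (D.ε_Rg_mem_L0 hr') (D.ε_Rg_ev hr') ?_)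
        rw [← D.ε_e_v, D.e_none_swap_R hγ hr, br_zero]
  · have hΦ (k : I) : D.Φ (some k) ∈ D.split := by
      -- The multiple of Φ₀ is chosen so that the difference commutes with f₀; this is why Φ₀
      -- appears in `split`.
      rw [← sub_add_cancel (D.Φ (some k)) (((D.A (some k) none : K) / 2) • D.Φ none)]
      refine add_mem (centralizer_od_le (mem_centralizer (sub_mem (D.Φ_mem_L0 _)
        (Submodule.smul_mem _ _ (D.Φ_mem_L0 _))) (sub_mem (D.Φ_od _)
        (Submodule.smul_mem _ _ (D.Φ_od _))) ?_))
        (Submodule.mem_sup_right (Submodule.smul_mem _ _ (Submodule.mem_span_singleton_self _)))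
      rw [br_sub, br_smul, D.f_Φ none (some k), sub_self]
    refine (sup_le (iSup_le fun γ r hr => ?_) (iSup_le fun γ r hr => ?_) :
      _ ≤ D.split) (D.G.Rg_le_sup hr)
    · have hr' := D.R_le_Rg γ hr
      by_cases hγ : γ = 0
      · subst hγ
        exact D.G.R_zero_le hΦ hr
      · exact centralizer_od_le ⟨⟨D.Rg_mem_L0 hr', D.Rg_od hr'⟩, D.f_none_R hγ hr⟩
    · have hr' : r ∈ D.Rg := swap_R_le_Rg γ hr
      by_cases hγ : γ = 0
      · subst hγ
        exact D.G.swap.R_zero_le hΦ hr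
      · exact stabilizer_od_le (mem_stabilizer (D.Rg_mem_L0 hr') (D.Rg_od hr')
          (D.e_none_swap_R hγ hr))
  · refine (sup_le (iSup_le fun γ r hr => ?_) (iSup_le fun γ r hr => ?_) :
      _ ≤ D.split.comap (ad K D.F)) (D.G.Rg_le_sup hr)
    · have hr' := D.R_le_Rg γ hr
      have ho : ⁅D.F, r⁆ ∈ od (K := K) := ev_od D.F_ev (D.Rg_od hr')
      by_cases hγ : γ = 0
      · subst hγ
        exact D.G.R_zero_le (M := D.split.comap (ad K D.F)) (fun k => stabilizer_od_le
          (mem_stabilizer (D.F_Rg_mem_L0 (D.Φ_mem k)) (ev_od D.F_ev (D.Φ_od _))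
            (D.e_none_ψ (some k)))) hr
      · rcases f_or_e_F_R hr hγ with h | h
        · exact centralizer_od_le ⟨⟨D.F_Rg_mem_L0 hr', ho⟩, h⟩
        · exact stabilizer_od_le (mem_stabilizer (D.F_Rg_mem_L0 hr') ho h)
    · have hr' : r ∈ D.Rg := swap_R_le_Rg γ hr
      by_cases hγ : γ = 0
      · subst hγ
        exact D.G.swap.R_zero_le (M := D.split.comap (ad K D.F)) (fun k => stabilizer_od_le
          (mem_stabilizer (D.F_Rg_mem_L0 (D.Φ_mem k)) (ev_od D.F_ev (D.Φ_od _))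
            (D.e_none_ψ (some k)))) hr
      · exact stabilizer_od_le (x := ⁅D.F, r⁆) (mem_stabilizer (D.F_Rg_mem_L0 hr')
          (ev_od D.F_ev (D.Rg_od hr')) (by rw [← F_e_v, D.e_none_swap_R hγ hr, br_zero]))
  · have he (r : L) (hr : r ∈ D.Rg) (h : ⁅D.e none, ⁅D.F, r⁆⁆ = 0) :
        ⁅D.Φc, ⁅D.F, r⁆⁆ ∈ D.split :=
      stabilizer_ev_le (mem_stabilizer (D.Φc_F_Rg_mem_L0 hr)
        (od_od D.Φc_od (ev_od D.F_ev (D.Rg_od hr)))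
        (by rw [comm (D.e_ev _) (D.e_Φc _), h, br_zero]))
    refine (sup_le (iSup_le fun γ r hr => ?_) (iSup_le fun γ r hr => ?_) :
      _ ≤ D.split.comap (ad K D.Φc ∘ₗ ad K D.F)) (D.G.Rg_le_sup hr)
    · have hr' := D.R_le_Rg γ hr
      by_cases hγ : γ = 0
      · subst hγ
        exact D.G.R_zero_le (M := D.split.comap (ad K D.Φc ∘ₗ ad K D.F))
          (fun k => he _ (D.Φ_mem k) (D.e_none_ψ (some k))) hr
      · rcases f_or_e_F_R hr hγ with h | h
        · refine centralizer_ev_le (x := ⁅D.Φc, ⁅D.F, r⁆⁆) (mem_centralizer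
            (D.Φc_F_Rg_mem_L0 hr') (od_od D.Φc_od (ev_od D.F_ev (D.Rg_od hr'))) ?_)
          rw [comm (D.f_ev _) (D.f_Φc _), h, br_zero]
        · exact he r hr' h
    · have hr' : r ∈ D.Rg := swap_R_le_Rg γ hr
      by_cases hγ : γ = 0
      · subst hγ
        exact D.G.swap.R_zero_le (M := D.split.comap (ad K D.Φc ∘ₗ ad K D.F))
          (fun k => he _ (D.Φ_mem k) (D.e_none_ψ (some k))) hr
      · exact he r hr' (by rw [← F_e_v, D.e_none_swap_R hγ hr, br_zero])

theorem split_le {M : Submodule K L} (h1 : D.centralizer ev ≤ M) (h2 : D.centralizer od ≤ M)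
    (h3 : D.stabilizer ev ≤ M) (h4 : D.stabilizer od ≤ M) (h5 : D.Φ none ∈ M) : D.split ≤ M :=
  sup_le (sup_le (sup_le h1 h2) (sup_le h3 h4)) (Submodule.span_le.2 (by simpa using h5))

theorem L0_le_ev_od : D.L0 ≤ (D.L0 ⊓ ev) ⊔ (D.L0 ⊓ od) :=
  L0_le_split.trans <| split_le (inf_le_left.trans le_sup_left) (inf_le_left.trans le_sup_right)
    (inf_le_left.trans le_sup_left) (inf_le_left.trans le_sup_right)
    (Submodule.mem_sup_right ⟨D.Φ_mem_L0 _, D.Φ_od _⟩)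

/-- The elements that are obtained from `e none` by the adjoint action of `L0`. -/
inductive V1Word (D : Hierarchy K L I) : L → Prop
  | e : D.V1Word (D.e none)
  | eΦ : D.V1Word ⁅D.e none, D.Φ none⁆
  | even {c v : L} (hc : c ∈ D.centralizer ev) (hv : D.V1Word v) : D.V1Word ⁅c, v⁆
  | odd {c v : L} (hc : c ∈ D.centralizer od) (hv : D.V1Word v) : D.V1Word ⁅c, v⁆

variable (D) in
/-- The span of the elements that are obtained from `e none` by the adjoint action of `L0`. -/
def V1 : Submodule K L := Submodule.span K {v | D.V1Word v}

theorem V1Word.mem {v : L} (hv : D.V1Word v) : v ∈ D.V1 := Submodule.subset_span hv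

theorem V1Word.hom {v : L} (hv : D.V1Word v) : v ∈ ev (K := K) ∨ v ∈ od (K := K) := by
  induction hv with
  | e => exact .inl (D.e_ev _)
  | eΦ => exact .inr (ev_od (D.e_ev _) (D.Φ_od _))
  | even hc _ ih =>
    exact ih.imp (ev_ev hc.1.2) (ev_od hc.1.2)
  | odd hc _ ih =>
    exact ih.symm.imp (od_od hc.1.2) (od_ev hc.1.2)

theorem L0_e_mem_V1 {l : L} (hl : l ∈ D.L0) : ⁅l, D.e none⁆ ∈ D.V1 := by
  refine (split_le (M := D.V1.comap (adRight K (D.e none))) (fun c hc => (V1Word.even hc .e).mem)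
    (fun c hc => (V1Word.odd hc .e).mem) (fun c hc => ?_) (fun c hc => ?_) ?_) (L0_le_split hl)
  · exact (Submodule.span_le.2 (by simpa using V1Word.e.mem) :
      Submodule.span K {D.e none} ≤ D.V1) hc.2
  · exact (Submodule.span_le.2 (by simpa using V1Word.e.mem) :
      Submodule.span K {D.e none} ≤ D.V1) hc.2
  · rw [Submodule.mem_comap, adRight_apply, ← neg_neg ⁅D.Φ none, _⁆, ← anti (D.e_ev _)]
    exact neg_mem V1Word.eΦ.mem

theorem L0_eΦ_mem_V1 (hD : D.Good) {l : L} (hl : l ∈ D.L0) : ⁅l, ⁅D.e none, D.Φ none⁆⁆ ∈ D.V1 := by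
  have hk (k : L) (hk : k ∈ D.L0) (hke : ⁅k, D.e none⁆ ∈ Submodule.span K {D.e none}) :
      ⁅k, ⁅D.e none, D.Φ none⁆⁆ ∈ D.V1 := by
    rw [jac_od_ev (D.e_ev _)]
    obtain ⟨c, hc⟩ := Submodule.mem_span_singleton.1 hke
    rw [← hc, smul_br, anti (D.e_ev _) ⁅k, _⁆]
    exact add_mem (Submodule.smul_mem _ _ V1Word.eΦ.mem)
      (neg_mem (L0_e_mem_V1 (L0_L0 hD hk (D.Φ_mem_L0 _))))
  refine (split_le (M := D.V1.comap (adRight K ⁅D.e none, D.Φ none⁆))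
    (fun c hc => (V1Word.even hc .eΦ).mem)
    (fun c hc => (V1Word.odd hc .eΦ).mem) (fun c hc => hk c hc.1.1 hc.2)
    (fun c hc => hk c hc.1.1 hc.2) ?_) (L0_le_split hl)
  rw [Submodule.mem_comap, adRight_apply]
  have h := jac (D.e_ev none) (D.Φ none) (D.Φ none)
  rw [D.Φ_Φ, br_zero, symm (ev_od (D.e_ev none) (D.Φ_od _)) (D.Φ_od _), ← two_smul K, eq_comm,
    smul_eq_zero] at h
  rw [h.resolve_left two_ne_zero]
  exact zero_mem _

/-- Super-Jacobi moves l past a centralizing letter c, and [l,c] stays in L0 because L0 is a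
subalgebra. The parity of l matters only for odd letters. -/
theorem L0_V1Word (hD : D.Good) {v : L} (hv : D.V1Word v) {l : L} (hl : l ∈ D.L0) : ⁅l, v⁆ ∈ D.V1 := by
  have hV (c v : L) (hc : (∀ v, D.V1Word v → D.V1Word ⁅c, v⁆)) (hv : v ∈ D.V1) : ⁅c, v⁆ ∈ D.V1 :=
    (Submodule.span_le.2 fun v hv => (hc v hv).mem : D.V1 ≤ D.V1.comap (ad K c)) hv
  induction hv generalizing l with
  | e => exact L0_e_mem_V1 hl
  | eΦ => exact L0_eΦ_mem_V1 hD hl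
  | even hc hv ih =>
    rw [jac_od_ev hc.1.2]
    exact add_mem (ih (L0_L0 hD hl hc.1.1)) (hV _ _ (fun v hv => .even hc hv) (ih hl))
  | @odd c v hc hv ih =>
    refine (sup_le (fun l hl => ?_) (fun l hl => ?_) :
      _ ≤ D.V1.comap (adRight K ⁅c, v⁆)) (L0_le_ev_od hl)
    · rw [Submodule.mem_comap, adRight_apply, jac hl.2]
      exact add_mem (ih (L0_L0 hD hl.1 hc.1.1)) (hV _ _ (fun v hv => .odd hc hv) (ih hl.1))
    · rw [Submodule.mem_comap, adRight_apply, jac_od hl.2 hc.1.2]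
      exact sub_mem (ih (L0_L0 hD hl.1 hc.1.1)) (hV _ _ (fun v hv => .odd hc hv) (ih hl.1))

/-- All letters commute with f₀, so it reaches the innermost e₀ or [e₀,Φ₀] and produces −h₀ or 2Φ₀.
This is the reason for allowing only centralizing letters. -/
theorem f_none_V1Word (hD : D.Good) {v : L} (hv : D.V1Word v) : ⁅D.f none, v⁆ ∈ D.L0 := by
  induction hv with
  | e => rw [D.f_e_same]; exact neg_mem D.h_none_mem_L0
  | eΦ => rw [D.f_e_Φ]; exact Submodule.smul_mem _ _ (D.Φ_mem_L0 _)
  | even hc _ ih => rw [comm (D.f_ev _) hc.2]; exact L0_L0 hD hc.1.1 ih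
  | odd hc _ ih => rw [comm (D.f_ev _) hc.2]; exact L0_L0 hD hc.1.1 ih

/-- The elements that are obtained from a subspace by the adjoint action of `V1`. -/
inductive WWord (D : Hierarchy K L I) (X : Submodule K L) : L → Prop
  | base {x : L} (hx : x ∈ X) : D.WWord X x
  | br {v w : L} (hv : D.V1Word v) (hw : D.WWord X w) : D.WWord X ⁅v, w⁆

variable (D) in
/-- The span of the elements that are obtained from a subspace by the adjoint action of `V1`. -/
def W (X : Submodule K L) : Submodule K L := Submodule.span K {w | D.WWord X w}

theorem WWord.mem {X : Submodule K L} {w : L} (hw : D.WWord X w) : w ∈ D.W X :=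
  Submodule.subset_span hw

theorem V1_W {X : Submodule K L} {v w : L} (hv : v ∈ D.V1) (hw : w ∈ D.W X) : ⁅v, w⁆ ∈ D.W X :=
  (Submodule.span_le.2 fun v hv => (Submodule.span_le.2 fun _ hw => (WWord.br hv hw).mem :
    D.W X ≤ (D.W X).comap (ad K v)) hw : D.V1 ≤ (D.W X).comap (adRight K w)) hv

theorem L0_W (hD : D.Good) {X : Submodule K L} (hX : D.L0 ≤ normalizer X) {l w : L} (hl : l ∈ D.L0)
    (hw : w ∈ D.W X) : ⁅l, w⁆ ∈ D.W X := by
  have h (w : L) (hw : D.WWord X w) : ∀ l ∈ D.L0, ⁅l, w⁆ ∈ D.W X := by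
    induction hw with
    | base hx => exact fun l hl => (WWord.base (hX hl _ hx)).mem
    | @br v w hv hw ih =>
      intro l hl
      rcases hv.hom with hv' | hv'
      · rw [jac_od_ev hv']
        exact add_mem (V1_W (L0_V1Word hD hv hl) hw.mem) (V1_W hv.mem (ih l hl))
      · refine (sup_le (fun l hl => ?_) (fun l hl => ?_) :
          _ ≤ (D.W X).comap (adRight K ⁅v, w⁆)) (L0_le_ev_od hl)
        · rw [Submodule.mem_comap, adRight_apply, jac hl.2]
          exact add_mem (V1_W (L0_V1Word hD hv hl.1) hw.mem) (V1_W hv.mem (ih l hl.1))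
        · rw [Submodule.mem_comap, adRight_apply, jac_od hl.2 hv']
          exact sub_mem (V1_W (L0_V1Word hD hv hl.1) hw.mem) (V1_W hv.mem (ih l hl.1))
  exact (Submodule.span_le.2 fun w hw => h w hw l hl : D.W X ≤ (D.W X).comap (ad K l)) hw

/-- In [f₀,[v,w]] the term [[f₀,v],w] is an action of L0, and the other term is shorter; the
recursion ends on X, which f₀ kills. -/
theorem f_none_W (hD : D.Good) {X : Submodule K L} (hX : D.L0 ≤ normalizer X)
    (hf : ∀ x ∈ X, ⁅D.f none, x⁆ = 0) {w : L} (hw : w ∈ D.W X) : ⁅D.f none, w⁆ ∈ D.W X := by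
  have h (w : L) (hw : D.WWord X w) : ⁅D.f none, w⁆ ∈ D.W X := by
    induction hw with
    | base hx => rw [hf _ hx]; exact zero_mem _
    | br hv hw ih =>
      rw [jac (D.f_ev _)]
      exact add_mem (L0_W hD hX (f_none_V1Word hD hv) hw.mem) (V1_W hv.mem ih)
  exact (Submodule.span_le.2 fun w hw => h w hw : D.W X ≤ (D.W X).comap (ad K (D.f none))) hw

/-- The degree with respect to the affine node: spaces of elements of degree zero and of
positive degree, such that no nonzero ideal has positive degree. -/
structure Grading (D : Hierarchy K L I) where
  P0 : Submodule K L
  Ppos : Submodule K L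
  P0_P0 {x y : L} : x ∈ P0 → y ∈ P0 → ⁅x, y⁆ ∈ P0
  P0_Ppos {x y : L} : x ∈ P0 → y ∈ Ppos → ⁅x, y⁆ ∈ Ppos
  Ppos_P0 {x y : L} : x ∈ Ppos → y ∈ P0 → ⁅x, y⁆ ∈ Ppos
  Ppos_Ppos {x y : L} : x ∈ Ppos → y ∈ Ppos → ⁅x, y⁆ ∈ Ppos
  e_P0 (i : I) : D.e (some i) ∈ P0
  f_P0 (i : I) : D.f (some i) ∈ P0
  E_P0 : D.E ∈ P0
  F_P0 : D.F ∈ P0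
  ε_P0 : D.ε ∈ P0
  Φ_P0 (a : Option I) : D.Φ a ∈ P0
  e_Ppos : D.e none ∈ Ppos
  eq_bot (W : Submodule K L) : W ≤ Ppos → (∀ a, D.e a ∈ normalizer W) →
    (∀ a, D.f a ∈ normalizer W) → D.E ∈ normalizer W → D.F ∈ normalizer W → D.ε ∈ normalizer W →
    (∀ a, D.Φ a ∈ normalizer W) → W = ⊥

namespace Grading

variable (P : D.Grading)

theorem Φc_P0 : D.Φc ∈ P.P0 :=
  add_mem (P.Φ_P0 _) (sum_mem fun _ _ => Submodule.smul_mem _ _ (P.Φ_P0 _))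

theorem Rg_le : D.Rg ≤ P.P0 :=
  D.G.Rg_le (fun k => P.Φ_P0 (some k)) (fun i _ _ hv => P.P0_P0 (P.e_P0 i) hv)
    (fun i _ _ hv => P.P0_P0 (P.f_P0 i) hv)

theorem L0_le : D.L0 ≤ P.P0 :=
  D.L0_le P.ε_P0 (P.P0_P0 P.ε_P0 P.E_P0) P.E_P0 P.F_P0 (P.P0_P0 P.E_P0 P.F_P0)
    (D.ε_Φ none ▸ P.P0_P0 P.ε_P0 (P.Φ_P0 _)) P.Φc_P0 (P.P0_P0 P.F_P0 P.Φc_P0)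
    (fun _ hr => P.P0_P0 P.ε_P0 (P.Rg_le hr)) (fun _ hr => P.Rg_le hr)
    (fun _ hr => P.P0_P0 P.F_P0 (P.Rg_le hr))
    (fun _ hr => P.P0_P0 P.Φc_P0 (P.P0_P0 P.F_P0 (P.Rg_le hr)))

theorem V1Word_mem {v : L} (hv : D.V1Word v) : v ∈ P.Ppos := by
  induction hv with
  | e => exact P.e_Ppos
  | eΦ => exact P.Ppos_P0 P.e_Ppos (P.Φ_P0 _)
  | even hc _ ih => exact P.P0_Ppos (P.L0_le hc.1.1) ih
  | odd hc _ ih => exact P.P0_Ppos (P.L0_le hc.1.1) ih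

/-- The space `W X` is stable under L0, e₀ and f₀, hence under all generators, and V1 only raises
the degree. So it vanishes, and X with it. -/
theorem eq_bot_of_L0 (hD : D.Good) {X : Submodule K L} (hX : D.L0 ≤ normalizer X)
    (hf : ∀ x ∈ X, ⁅D.f none, x⁆ = 0) (hXP : X ≤ P.Ppos) : X = ⊥ := by
  have hW : D.W X = ⊥ := by
    refine P.eq_bot (D.W X) (Submodule.span_le.2 fun w hw => ?_) (fun a => ?_) (fun a => ?_)
      (fun w hw => L0_W hD hX D.E_mem_L0 hw) (fun w hw => L0_W hD hX D.F_mem_L0 hw)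
      (fun w hw => L0_W hD hX D.ε_mem_L0 hw) (fun a w hw => L0_W hD hX (D.Φ_mem_L0 a) hw)
    · induction hw with
      | base hx => exact hXP hx
      | br hv _ ih => exact P.Ppos_Ppos (P.V1Word_mem hv) ih
    · cases a with
      | none => exact fun w hw => V1_W V1Word.e.mem hw
      | some i => exact fun w hw => L0_W hD hX (D.e_mem_L0 i) hw
    · cases a with
      | none => exact fun w hw => f_none_W hD hX hf hw
      | some i => exact fun w hw => L0_W hD hX (D.f_mem_L0 i) hw
  rw [eq_bot_iff, ← hW]
  exact fun x hx => (WWord.base hx).mem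

end Grading

end Hierarchy

end

/-! ### Vectors killed by almost all generators -/

section

variable {K L I : Type*} [Field K] [AddCommGroup L] [Module K L] [Bracket L L]
  [BiadditiveBracket L] [SuperBracket K L]

variable [Fintype I] [DecidableEq I] [CharZero K]

namespace Hierarchy

variable {D : Hierarchy K L I}

/-- An element of positive degree that is annihilated by all generators except `e none` and
`Φ none` vanishes. -/
theorem Grading.eq_zero_of_killed (P : D.Grading) (hD : D.Good) {x : L} (hx : x ∈ P.Ppos)
    (hE : ⁅D.E, x⁆ = 0) (hF : ⁅D.F, x⁆ = 0) (hε : ⁅D.ε, x⁆ = 0) (he : ∀ i, ⁅D.e (some i), x⁆ = 0)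
    (hf : ∀ a, ⁅D.f a, x⁆ = 0) (hΦ : ∀ i, ⁅D.Φ (some i), x⁆ = 0) {κ : K}
    (hc : ⁅⁅D.ε, D.Φc⁆, x⁆ = κ • x) : x = 0 := by
  -- The odd elements Φc and ψ = [F,Φc] square to zero and anticommute, so X is the orbit of x under
  -- the exterior algebra on them.
  set X : Submodule K L := Submodule.span K
    {x, ⁅D.Φc, x⁆, ⁅⁅D.F, D.Φc⁆, x⁆, ⁅D.Φc, ⁅⁅D.F, D.Φc⁆, x⁆⁆} with hXdef
  have hX1 : x ∈ X := Submodule.subset_span (by simp)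
  have hX2 : ⁅D.Φc, x⁆ ∈ X := Submodule.subset_span (by simp)
  have hX3 : ⁅⁅D.F, D.Φc⁆, x⁆ ∈ X := Submodule.subset_span (by simp)
  have hX4 : ⁅D.Φc, ⁅⁅D.F, D.Φc⁆, x⁆⁆ ∈ X := Submodule.subset_span (by simp)
  have hX (M : Submodule K L) (g : L) (h1 : ⁅g, x⁆ ∈ M) (h2 : ⁅g, ⁅D.Φc, x⁆⁆ ∈ M)
      (h3 : ⁅g, ⁅⁅D.F, D.Φc⁆, x⁆⁆ ∈ M) (h4 : ⁅g, ⁅D.Φc, ⁅⁅D.F, D.Φc⁆, x⁆⁆⁆ ∈ M) :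
      ∀ y ∈ X, ⁅g, y⁆ ∈ M := by
    refine (Submodule.span_le.2 ?_ : X ≤ M.comap (ad K g))
    rintro _ (rfl | rfl | rfl | rfl) <;> assumption
  have hψo : ⁅D.F, D.Φc⁆ ∈ od (K := K) := ev_od D.F_ev D.Φc_od
  have hψx : ⁅⁅D.F, D.Φc⁆, x⁆ = ⁅D.F, ⁅D.Φc, x⁆⁆ := by
    rw [jac D.F_ev, hF, br_zero, add_zero]
  have hcomm (g : L) (hg : g ∈ ev (K := K)) (hgF : ⁅g, D.F⁆ = 0) (hgΦ : ⁅g, D.Φc⁆ = 0)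
      (hgx : ⁅g, x⁆ = 0) : g ∈ normalizer X := by
    have h1 : ⁅g, ⁅D.Φc, x⁆⁆ = 0 := by rw [comm hg hgΦ, hgx, br_zero]
    have h2 : ⁅g, ⁅⁅D.F, D.Φc⁆, x⁆⁆ = 0 := by rw [hψx, comm hg hgF, h1, br_zero]
    refine hX X g ?_ ?_ ?_ ?_
    · rw [hgx]; exact zero_mem _
    · rw [h1]; exact zero_mem _
    · rw [h2]; exact zero_mem _
    · rw [comm hg hgΦ, h2, br_zero]; exact zero_mem _
  -- Applying f_k to `Good` for r = [e_k,Φ_k] expresses 4[Φc,[F,Φ_k]] as the bracket of [f_k,Φ_k]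
  -- and [F,[e_k,Φ_k]], each of which kills x.
  have hΦcψ (k : I) : ⁅⁅D.Φc, ⁅D.F, D.Φ (some k)⁆⁆, x⁆ = 0 := by
    have h1 := hD k _ (D.e_mem (D.Φ_mem k) k)
    have h2 : ⁅D.h (some k), ⁅D.e (some k), D.Φ (some k)⁆⁆ =
        (2 : K) • ⁅D.e (some k), D.Φ (some k)⁆ := by
      rw [D.wt_e (D.wt_Φ _ _), D.A_diag]; norm_num
    have h3 : ⁅D.f (some k), ⁅D.F, ⁅D.e (some k), D.Φ (some k)⁆⁆⁆ =
        (2 : K) • ⁅D.F, D.Φ (some k)⁆ := by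
      rw [← F_f_v, D.f_e_Φ, br_smul]
    have h4 := jac (D.f_ev (some k)) (D.Φ (some k)) ⁅D.F, ⁅D.e (some k), D.Φ (some k)⁆⁆
    rw [h1, h2, br_smul, br_smul, br_smul, comm (D.f_ev _) (D.f_Φc _), h3, br_smul, br_smul,
      D.Φ_F_Φ, smul_zero, add_zero, smul_smul] at h4
    have h5 : ⁅⁅D.f (some k), D.Φ (some k)⁆, x⁆ = 0 := by
      have := jac (D.f_ev (some k)) (D.Φ (some k)) x
      rwa [hΦ, hf, br_zero, br_zero, add_zero, eq_comm] at this
    have h6 : ⁅⁅D.F, ⁅D.e (some k), D.Φ (some k)⁆⁆, x⁆ = 0 := by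
      have h7 : ⁅⁅D.e (some k), D.Φ (some k)⁆, x⁆ = 0 := by
        have := jac (D.e_ev (some k)) (D.Φ (some k)) x
        rwa [hΦ, he, br_zero, br_zero, add_zero, eq_comm] at this
      have := jac D.F_ev ⁅D.e (some k), D.Φ (some k)⁆ x
      rwa [h7, hF, br_zero, br_zero, add_zero, eq_comm] at this
    have h8 := jac_od (ev_od (D.f_ev (some k)) (D.Φ_od (some k)))
      (ev_od D.F_ev (ev_od (D.e_ev (some k)) (D.Φ_od (some k)))) x
    rw [h6, h5, br_zero, br_zero, sub_zero, ← h4, smul_br, eq_comm, smul_eq_zero] at h8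
    exact h8.resolve_left (by norm_num)
  have hcΦ : ⁅⁅D.ε, D.Φc⁆, D.Φc⁆ = 0 := by
    rw [ε_Φc, add_br, D.h_Φc, sum_br, Finset.sum_eq_zero, add_zero]
    exact fun k _ => by rw [smul_br, D.h_Φc, smul_zero]
  have hεψ : ⁅D.ε, ⁅⁅D.F, D.Φc⁆, x⁆⁆ = 0 := by
    rw [hψx, ε_F_v, jac_od D.ε_od D.Φc_od, hc, hε, br_zero, sub_zero, br_smul, hF, smul_zero]
  have hL0 : D.L0 ≤ normalizer X := by
    refine D.L0_le_normalizer (hX X _ ?_ ?_ ?_ ?_) (hX X _ ?_ ?_ ?_ ?_) (hX X _ ?_ ?_ ?_ ?_)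
      (hX X _ hX2 ?_ hX4 ?_) (fun i => hcomm _ (D.e_ev _) (br_eq_zero_symm D.F_ev (D.F_e _))
        (D.e_Φc _) (he i)) (fun i => hcomm _ (D.f_ev _) (br_eq_zero_symm D.F_ev (D.F_f _))
        (D.f_Φc _) (hf _)) (fun i => hX X _ ?_ ?_ ?_ ?_)
    · rw [hE]; exact zero_mem _
    · rw [comm D.E_ev D.E_Φc, hE, br_zero]; exact zero_mem _
    · rw [hψx, E_F_v, comm D.E_ev D.E_Φc, hE, br_zero, br_zero, add_zero, jac D.H_ev, H_Φc]
      have h1 := D.E_F_v x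
      rw [hF, hE, br_zero, br_zero, add_zero] at h1
      rw [← h1, br_zero, add_zero]; exact hX2
    · rw [hψx, comm D.E_ev D.E_Φc, E_F_v, comm D.E_ev D.E_Φc, hE, br_zero, br_zero, add_zero,
        jac D.H_ev, H_Φc, br_add, D.Φc_Φc_v, zero_add]
      have h1 := D.E_F_v x
      rw [hF, hE, br_zero, br_zero, add_zero] at h1
      rw [← h1, br_zero, br_zero]; exact zero_mem _
    · rw [hF]; exact zero_mem _
    · rw [← hψx]; exact hX3
    · rw [jac D.F_ev, D.F_F_Φc, hF]; simp
    · rw [jac D.F_ev, od_sq hψo D.F_Φc_F_Φc, jac D.F_ev ⁅D.F, D.Φc⁆, D.F_F_Φc, hF]; simp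
    · rw [hε]; exact zero_mem _
    · rw [jac_od D.ε_od D.Φc_od, hc, hε, br_zero, sub_zero]; exact Submodule.smul_mem _ _ hX1
    · rw [hεψ]; exact zero_mem _
    · rw [jac_od D.ε_od D.Φc_od, hεψ, br_zero, sub_zero, jac D.ε_Φc_ev, jac D.ε_Φc_ev, hcΦ,
        anti D.ε_Φc_ev, F_ε_Φc, hc, br_zero, add_zero, neg_neg, br_smul]
      exact add_mem hX3 (Submodule.smul_mem _ _ hX3)
    · rw [D.Φc_Φc_v]; exact zero_mem _
    · rw [D.Φc_Φc_v]; exact zero_mem _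
    · rw [hΦ]; exact zero_mem _
    · rw [anticomm (D.Φ_od _) D.Φc_od (D.Φ_Φc _), hΦ, br_zero, neg_zero]; exact zero_mem _
    all_goals
      have h1 : ⁅D.Φ (some i), ⁅⁅D.F, D.Φc⁆, x⁆⁆ = 0 := by
        have h2 := jac D.F_ev (D.Φ (some i)) D.Φc
        rw [D.Φ_Φc, br_zero, symm (ev_od D.F_ev (D.Φ_od _)) D.Φc_od] at h2
        rw [jac_od (D.Φ_od _) hψo, hΦ, br_zero, sub_zero, eq_neg_of_add_eq_zero_right h2.symm,
          neg_br, hΦcψ, neg_zero]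
    · rw [h1]; exact zero_mem _
    · rw [anticomm (D.Φ_od _) D.Φc_od (D.Φ_Φc _), h1, br_zero, neg_zero]; exact zero_mem _
  -- Each [F,Φ_k] with k ≥ 1 kills x, so only the Φ₀ part of Φc contributes, and `f_none_ψ_none`
  -- reduces it to [f₀,Φ₀]·x = 0.
  have hfψ : ⁅D.f none, ⁅⁅D.F, D.Φc⁆, x⁆⁆ = 0 := by
    have hΦx : ⁅D.Φ none, x⁆ = ⁅D.Φc, x⁆ := by
      rw [Φ_none, sub_br, sum_br, Finset.sum_eq_zero, sub_zero]
      exact fun k _ => by rw [smul_br, hΦ, smul_zero]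
    have hfΦ : ⁅D.f none, ⁅D.Φc, x⁆⁆ = 0 := by rw [comm (D.f_ev _) (D.f_Φc _), hf, br_zero]
    have hs : ⁅⁅D.f none, D.Φ none⁆, x⁆ = 0 := by
      have := jac (D.f_ev none) (D.Φ none) x
      rwa [hΦx, hfΦ, hf, br_zero, add_zero, eq_comm] at this
    have h0 : ⁅D.f none, ⁅⁅D.F, D.Φ none⁆, x⁆⁆ = 0 := by
      have h1 := jac D.F_ev ⁅D.f none, D.Φ none⁆ x
      rw [hs, hF, br_zero, br_zero, add_zero] at h1
      rw [jac (D.f_ev _), f_none_ψ_none, smul_br, ← h1, hf]; simp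
    have hk (k : I) : ⁅⁅D.F, D.Φ (some k)⁆, x⁆ = 0 := by
      have h1 := jac D.F_ev (D.Φ (some k)) x
      rwa [hΦ, hF, br_zero, br_zero, add_zero, eq_comm] at h1
    have := D.map_Φc (ad K (D.f none) ∘ₗ adRight K x ∘ₗ ad K D.F)
    simp only [LinearMap.comp_apply, ad_apply, adRight_apply] at this
    rw [this, h0, zero_add]
    exact Finset.sum_eq_zero fun k _ => by rw [hk, br_zero, smul_zero]
  have hXbot : X = ⊥ := by
    refine P.eq_bot_of_L0 hD hL0 (hX ⊥ _ (by simp [hf]) ?_ (by simp [hfψ]) ?_)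
      (Submodule.span_le.2 ?_)
    · rw [comm (D.f_ev _) (D.f_Φc _), hf, br_zero]; exact zero_mem _
    · rw [comm (D.f_ev _) (D.f_Φc _), hfψ, br_zero]; exact zero_mem _
    · have hψP := P.P0_P0 P.F_P0 P.Φc_P0
      rintro _ (rfl | rfl | rfl | rfl)
      · exact hx
      · exact P.P0_Ppos P.Φc_P0 hx
      · exact P.P0_Ppos hψP hx
      · exact P.P0_Ppos P.Φc_P0 (P.P0_Ppos hψP hx)
  rw [hXbot] at hX1
  exact hX1

end Hierarchy

end

/-! ### The square of J -/

section

variable {K L I : Type*} [Field K] [AddCommGroup L] [Module K L] [Bracket L L]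
  [BiadditiveBracket L] [SuperBracket K L]

variable [Fintype I] [DecidableEq I]

/-- A highest root vector `x` with the coefficients `n` of the highest root, and a node `i₁`
adjacent to the affine node. -/
structure HighestRoot (D : Hierarchy K L I) where
  x : L
  n : I → ℕ
  i₁ : I
  x_ev : x ∈ ev (K := K)
  -- Encodes that x is a combination of brackets of the e_i of total content n, without a grading on
  -- the whole algebra.
  content (M : (I → ℕ) → Submodule K L)
    (hM : ∀ γ i v, v ∈ M γ → ⁅D.e (some i), v⁆ ∈ M (γ + Pi.single i 1)) (γ : I → ℕ) (v : L) :
    v ∈ M γ → ⁅x, v⁆ ∈ M (γ + n)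
  n_ne (i : I) : n i ≠ 0
  h_x (i : I) : ⁅D.h (some i), x⁆ = -(D.A (some i) none : K) • x
  e_x (i : I) : ⁅D.e (some i), x⁆ = 0
  i₁_ne : D.A none (some i₁) ≠ 0
  A_nonpos (i : I) : D.A (some i) none ≤ 0
  A_eq_zero (i : I) : D.A none (some i) ≠ 0 → D.A (some i) none ≠ 0
  -- The second alternative is rank one, where θ is itself the simple root.
  A_eq (i : I) : D.A (some i) none ≠ 0 → D.A none (some i) = -1 ∨ n = Pi.single i 1

namespace HighestRoot

open Hierarchy

variable [CharZero K] {D : Hierarchy K L I} (X : HighestRoot D)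

theorem n_ne_zero : X.n ≠ 0 := fun h => X.n_ne X.i₁ (by simp [h])

/-- Apply `content` to the family that is spanned by y in content 0 and zero elsewhere. -/
theorem x_comm {y : L} (hy : ∀ i, ⁅D.e (some i), y⁆ = 0) : ⁅X.x, y⁆ = 0 := by
  have h := X.content (fun γ => if γ = 0 then Submodule.span K {y} else ⊥) (fun γ i v hv => by
    by_cases hγ : γ = 0
    · simp only [hγ, if_true] at hv
      obtain ⟨c, rfl⟩ := Submodule.mem_span_singleton.1 hv
      rw [br_smul, hy, smul_zero]; exact zero_mem _
    · simp only [hγ, if_false, Submodule.mem_bot] at hv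
      rw [hv, br_zero]; exact zero_mem _) 0 y
      (by simp)
  simpa [X.n_ne_zero] using h

theorem x_comm' {y : L} (hy : ∀ i, ⁅y, D.e (some i)⁆ = 0) : ⁅X.x, y⁆ = 0 :=
  X.x_comm fun i => by rw [anti (D.e_ev _), hy, neg_zero]

theorem x_F : ⁅X.x, D.F⁆ = 0 := X.x_comm' fun _ => D.F_e _

theorem x_E : ⁅X.x, D.E⁆ = 0 := X.x_comm' fun i => D.E_e i

theorem x_ε : ⁅X.x, D.ε⁆ = 0 := X.x_comm' fun _ => D.ε_e _

theorem f_none_x : ⁅D.f none, X.x⁆ = 0 :=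
  br_eq_zero_symm X.x_ev (X.x_comm fun _ => D.e_f_ne (by simp))

theorem h_x' (a : Option I) : ⁅D.h a, X.x⁆ = -(D.A a none : K) • X.x := by
  cases a with
  | some i => exact X.h_x i
  | none =>
    -- The element [ε,Φc] = h₀ + Σ comark·h_k commutes with every e_i, so the weight at node 0
    -- follows from the others.
    have h1 : ⁅⁅D.ε, D.Φc⁆, X.x⁆ = 0 := by
      rw [anti D.ε_Φc_ev, X.x_comm' (fun i => ?_), neg_zero]
      have := jac_od D.ε_od D.Φc_od (D.e (some i))
      rw [D.Φc_e, D.ε_e, br_zero, br_zero, sub_zero] at this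
      exact this.symm
    rw [ε_Φc, add_br, sum_br] at h1
    rw [eq_neg_of_add_eq_zero_left h1, eq_neg_of_add_eq_zero_left (D.comark_sum none), neg_neg,
      Finset.sum_smul, ← Finset.sum_neg_distrib]
    exact Finset.sum_congr rfl fun k _ => by
      rw [smul_br, X.h_x, smul_smul, ← neg_smul]; congr 1; ring

theorem A_i₁_ne : (D.A (some X.i₁) none : K) ≠ 0 := by
  exact_mod_cast X.A_eq_zero _ X.i₁_ne

/-- The highest weight vector of the module generated by the `Φ k`. -/
def φ : L := ⁅X.x, D.Φ (some X.i₁)⁆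

theorem φ_mem_R : X.φ ∈ D.R X.n := by
  have := X.content D.R (fun γ i v hv => D.G.e_mem_R hv i) 0 (D.Φ (some X.i₁))
    (Core.Word.Φ (D := D.G) X.i₁).mem
  rwa [zero_add] at this

theorem φ_mem : X.φ ∈ D.Rg := D.R_le_Rg _ X.φ_mem_R

theorem h_φ (a : Option I) : ⁅D.h a, X.φ⁆ = -(D.A a none : K) • X.φ := by
  rw [φ, br_of_wt (D.h_ev a) (X.h_x' a) (D.wt_Φ _ _), add_zero]

theorem ε_φ : ⁅D.ε, X.φ⁆ = (D.A (some X.i₁) none : K) • X.x := by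
  rw [φ, ← comm X.x_ev X.x_ε, D.ε_Φ, anti X.x_ev, X.h_x, ← neg_smul, neg_neg]

theorem x_Φ (a : Option I) : (D.A (some X.i₁) none : K) • ⁅X.x, D.Φ a⁆ =
    (D.A a none : K) • X.φ := by
  rw [← smul_br, ← X.ε_φ, D.ε_Rg_Φ X.φ_mem, X.h_φ, neg_smul, neg_neg]

theorem f_none_φ : ⁅D.f none, X.φ⁆ = 0 := D.f_none_R X.n_ne_zero X.φ_mem_R

/-- As ε sends φ to a multiple of x, it kills [e_i,φ]; then `ε_Rg_Φ` makes h_i kill it, although its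
weight is 2 − A_i0 > 0. -/
theorem e_φ (i : I) : ⁅D.e (some i), X.φ⁆ = 0 := by
  have h := D.ε_Rg_Φ (D.e_mem X.φ_mem i) (some i)
  rw [D.ε_e_v, X.ε_φ, br_smul, X.e_x, smul_zero, zero_br, D.wt_e (X.h_φ _), eq_comm, neg_eq_zero,
    smul_eq_zero, D.A_diag] at h
  refine h.resolve_left ?_
  have := X.A_nonpos i
  have h2 : (2 + -D.A (some i) none : ℤ) ≠ 0 := by omega
  exact_mod_cast h2

theorem f_φ_mem (i : I) : ⁅D.f (some i), X.φ⁆ ∈ D.R (X.n - Pi.single i 1) := by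
  obtain ⟨δ, hδ⟩ := Core.exists_eq_add_single (X.n_ne i)
  have h := X.φ_mem_R
  rw [hδ] at h ⊢
  rw [add_tsub_cancel_right]
  exact D.G.f_mem_R h

/-- If A_i0 = 0, then f_i kills φ by sl₂ theory. In rank one φ is a multiple of [e_i,Φ_i]. Otherwise
f_i φ is a raising word of nonzero content, hence killed by f₀. -/
theorem f_φ (i : I) : (∃ μ : K, ⁅D.f (some i), X.φ⁆ = μ • D.Φ (some i)) ∨
    (⁅D.f none, ⁅D.f (some i), X.φ⁆⁆ = 0 ∧ D.A none (some i) = -1) := by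
  by_cases h0 : D.A (some i) none = 0
  · refine .inl ⟨0, ?_⟩
    rw [zero_smul]
    exact D.br_f_eq_zero (by rw [X.h_φ, h0]; simp) (X.e_φ i)
  by_cases hn : X.n = Pi.single i 1
  · left
    have h := X.φ_mem_R
    rw [hn] at h
    obtain ⟨c, hc⟩ := D.G.R_single_one h
    refine ⟨c * 2, ?_⟩
    rw [hc, br_smul, mul_smul]
    exact congrArg _ (D.f_e_Φ (some i))
  · right
    have hA := (X.A_eq i h0).resolve_right hn
    refine ⟨D.f_none_R (fun h => hn ?_) (X.f_φ_mem i), hA⟩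
    obtain ⟨δ, hδ⟩ := Core.exists_eq_add_single (X.n_ne i)
    rw [hδ, add_tsub_cancel_right] at h
    rw [hδ, h, zero_add]

theorem h_none_f_φ {i : I} (hA : D.A none (some i) = -1) :
    ⁅D.h none, ⁅D.f (some i), X.φ⁆⁆ = (-1 : K) • ⁅D.f (some i), X.φ⁆ := by
  rw [D.wt_f (X.h_φ _), hA, D.A_diag]; norm_num

theorem f_none_F_φ : ⁅D.f none, ⁅D.F, X.φ⁆⁆ = 0 :=
  D.f_none_F_Rg X.φ_mem X.f_none_φ (w := -2) (by norm_num)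
    (by rw [X.h_φ, D.A_diag]; norm_num)

/-- The vector `[e₀, [F, φ]]`. -/
def Y : L := ⁅D.e none, ⁅D.F, X.φ⁆⁆

theorem φ_od : X.φ ∈ od (K := K) := D.Rg_od X.φ_mem

theorem F_φ_od : ⁅D.F, X.φ⁆ ∈ od (K := K) := ev_od D.F_ev X.φ_od

theorem Y_od : X.Y ∈ od (K := K) := ev_od (D.e_ev _) X.F_φ_od

theorem h_none_F_φ : ⁅D.h none, ⁅D.F, X.φ⁆⁆ = (-1 : K) • ⁅D.F, X.φ⁆ := by
  rw [D.h_none_F_v (X.h_φ _), D.A_diag]; norm_num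

theorem f_none_Y : ⁅D.f none, X.Y⁆ = ⁅D.F, X.φ⁆ := by
  rw [Y, D.f_e_v_same, f_none_F_φ, h_none_F_φ]; simp

theorem F_Y : ⁅D.F, X.Y⁆ = 0 := by
  rw [Y, F_e_v, D.F_F_Rg X.φ_mem, br_zero]

theorem ε_Y : ⁅D.ε, X.Y⁆ = 0 := by
  rw [Y, D.ε_e_v, ε_F_v, D.F_ε_Rg X.φ_mem, br_zero]

theorem h_some_F_φ (i : I) : ⁅D.h (some i), ⁅D.F, X.φ⁆⁆ =
    -(D.A (some i) none : K) • ⁅D.F, X.φ⁆ := by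
  rw [comm (D.h_ev _) (br_eq_zero_symm D.F_ev (D.F_h i)), X.h_φ, br_smul]

/-- In the first case of `f_φ` one uses [e₀,[F,Φ_i]] = 0; in the second, [F,[f_i,φ]] has h₀-weight 0
and is killed by f₀, hence by e₀. -/
theorem f_Y (i : I) : ⁅D.f (some i), X.Y⁆ = 0 := by
  rw [Y, D.f_e_v_ne (by simp), ← F_f_v]
  rcases X.f_φ i with ⟨μ, h⟩ | ⟨h, hA⟩
  · rw [h, br_smul, br_smul, e_none_ψ, smul_zero]
  · have hw := X.h_none_f_φ hA
    refine D.br_e_eq_zero ?_ (D.f_none_F_Rg (D.f_mem X.φ_mem i) h (by norm_num) hw)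
    rw [D.h_none_F_v hw]; simp

theorem e_Y (i : I) : ⁅D.e (some i), X.Y⁆ = 0 := by
  refine D.br_e_eq_zero ?_ (X.f_Y i)
  rw [Y, D.wt_e (X.h_some_F_φ i)]; simp

/-- The raising operator of the root `θ + α₀`. -/
def ξ : L := ⁅D.e none, X.x⁆

theorem ξ_ev : X.ξ ∈ ev (K := K) := ev_ev (D.e_ev _) X.x_ev

theorem ξ_v (v : L) : ⁅X.ξ, v⁆ = ⁅D.e none, ⁅X.x, v⁆⁆ - ⁅X.x, ⁅D.e none, v⁆⁆ := by
  rw [jac (D.e_ev none) X.x v, ξ]; abel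

theorem h_ξ (a : Option I) : ⁅D.h a, X.ξ⁆ = 0 := by
  rw [ξ, D.wt_e (X.h_x' a)]; simp

/-- The vector `[[e₀, x], Φ]`. -/
def j : L := ⁅X.ξ, D.Φ (some X.i₁)⁆

theorem j_od : X.j ∈ od (K := K) := ev_od X.ξ_ev (D.Φ_od _)

theorem j_eq : X.j = ⁅D.e none, X.φ⁆ -
    ((D.A (some X.i₁) none : K) / 2) • ⁅X.x, ⁅D.e none, D.Φ none⁆⁆ := by
  rw [j, ξ_v, D.e_Φ none, br_smul, φ]

theorem ξ_Φ (a : Option I) : (D.A (some X.i₁) none : K) • ⁅X.ξ, D.Φ a⁆ =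
    (D.A a none : K) • X.j := by
  rw [ξ_v, D.e_Φ none, br_smul, smul_sub, ← br_smul, X.x_Φ, br_smul, j_eq, smul_sub, smul_smul,
    smul_smul]
  congr 2; ring

theorem F_j : ⁅D.F, X.j⁆ = X.Y := by
  rw [j_eq, br_sub, br_smul, F_e_v, ← comm X.x_ev X.x_F, F_a₀, br_zero, smul_zero, sub_zero, Y]

theorem h_j (a : Option I) : ⁅D.h a, X.j⁆ = 0 := by
  rw [j, jac (D.h_ev a), X.h_ξ, D.h_Φ]; simp

/-- The two terms of `j_eq` contribute 2φ and A_00 φ with opposite signs. -/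
theorem f_none_j : ⁅D.f none, X.j⁆ = 0 := by
  rw [j_eq, br_sub, br_smul, D.f_e_v_same, f_none_φ, X.h_φ, comm (D.f_ev _) X.f_none_x, D.f_e_Φ,
    br_smul, smul_smul, div_mul_cancel₀ _ two_ne_zero, X.x_Φ, D.A_diag]
  simp

theorem e_none_j : ⁅D.e none, X.j⁆ = 0 := D.br_e_eq_zero (X.h_j _) X.f_none_j

/-- In the first case of `f_φ` the two terms cancel. In the second, [f_i,j] has h₀-weight 1 and is
killed by f₀. -/
theorem f_j (i : I) : ⁅D.f (some i), X.j⁆ = 0 := by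
  have hx : (D.A (some X.i₁) none : K) • ⁅D.f (some i), X.x⁆ = ⁅D.ε, ⁅D.f (some i), X.φ⁆⁆ := by
    rw [D.ε_f_v, X.ε_φ, br_smul]
  have h1 : ⁅D.f (some i), X.j⁆ = ⁅D.e none, ⁅D.f (some i), X.φ⁆⁆ -
      (1 / 2 : K) • ⁅⁅D.ε, ⁅D.f (some i), X.φ⁆⁆, ⁅D.e none, D.Φ none⁆⁆ := by
    rw [j_eq, br_sub, br_smul, D.f_e_v_ne (by simp), jac (D.f_ev _) X.x,
      D.f_e_Φ_ne none (by simp), br_zero, add_zero, ← hx, smul_br, smul_smul]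
    congr 2; ring
  rcases X.f_φ i with ⟨μ, h⟩ | ⟨h, hA⟩
  · rw [h1, h, br_smul, br_smul, D.e_Φ none, smul_br, D.ε_Φ, D.wt_e (D.wt_Φ _ _), add_zero,
      sub_eq_zero, smul_smul, smul_smul, smul_smul]
    congr 1; ring
  · have hu := D.f_mem X.φ_mem i
    have hw := X.h_none_f_φ hA
    refine D.eq_zero_of_f (a := none) (m := 1) (by norm_num) ?_ ?_
    · rw [D.wt_f (q := 0) (by rw [X.h_j, zero_smul]), hA]; norm_num
    · have h2 : ⁅D.f none, ⁅D.ε, ⁅D.f (some i), X.φ⁆⁆⁆ = 0 := by rw [← D.ε_f_v, h, br_zero]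
      rw [h1, br_sub, br_smul, D.f_e_v_same, h, comm (D.f_ev _) h2, D.f_e_Φ, br_smul,
        D.ε_Rg_Φ hu, hw, smul_smul]
      norm_num

theorem e_j (i : I) : ⁅D.e (some i), X.j⁆ = 0 := D.br_e_eq_zero (X.h_j _) (X.f_j i)

theorem ξ_j : ⁅X.ξ, X.j⁆ = 0 := by
  rw [ξ_v, X.x_comm X.e_j, X.e_none_j]; simp

/-- Applying ξ to [Φ_a,Φ_i₁] = 0 relates [Φ_a,j] to [Φ_i₁,j]; the case a = i₁ kills the latter since
A_i₁0 ≠ 0. -/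
theorem Φ_j (a : Option I) : ⁅D.Φ a, X.j⁆ = 0 := by
  have h1 (a) : (D.A a none : K) • ⁅D.Φ (some X.i₁), X.j⁆ +
      (D.A (some X.i₁) none : K) • ⁅D.Φ a, X.j⁆ = 0 := by
    have := jac X.ξ_ev (D.Φ a) (D.Φ (some X.i₁))
    rw [D.Φ_Φ, br_zero] at this
    have h := congrArg (fun y => (D.A (some X.i₁) none : K) • y) this
    simp only [smul_zero, smul_add] at h
    rw [← smul_br _ ⁅X.ξ, D.Φ a⁆, X.ξ_Φ, smul_br, ← j, symm X.j_od (D.Φ_od _)] at h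
    exact h.symm
  have h2 := h1 (some X.i₁)
  rw [← two_smul K, smul_eq_zero, smul_eq_zero] at h2
  have h3 := h1 a
  rw [(h2.resolve_left two_ne_zero).resolve_left X.A_i₁_ne, smul_zero, zero_add,
    smul_eq_zero] at h3
  exact h3.resolve_left X.A_i₁_ne

theorem j_j : ⁅X.j, X.j⁆ = 0 := by
  have := jac X.ξ_ev (D.Φ (some X.i₁)) X.j
  rw [Φ_j, X.ξ_j, br_zero, br_zero, add_zero] at this
  exact this.symm

theorem j_Y : ⁅X.j, X.Y⁆ = 0 := by
  have := jac D.F_ev X.j X.j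
  rw [j_j, br_zero, F_j, symm X.Y_od X.j_od, ← two_smul K, eq_comm, smul_eq_zero] at this
  exact this.resolve_left two_ne_zero

theorem j_f {a : Option I} {v : L} (ha : ⁅D.f a, X.j⁆ = 0) (hv : ⁅X.j, v⁆ = 0) :
    ⁅X.j, ⁅D.f a, v⁆⁆ = 0 := by
  rw [← comm (D.f_ev _) ha, hv, br_zero]

theorem j_e {a : Option I} {v : L} (ha : ⁅D.e a, X.j⁆ = 0) (hv : ⁅X.j, v⁆ = 0) :
    ⁅X.j, ⁅D.e a, v⁆⁆ = 0 := by
  rw [← comm (D.e_ev _) ha, hv, br_zero]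

theorem j_F_φ : ⁅X.j, ⁅D.F, X.φ⁆⁆ = 0 := by
  rw [← f_none_Y]; exact X.j_f X.f_none_j X.j_Y

/-! ### From the vector j to the missing brackets of L0 -/

variable {X}

/-- The operators e_i and f_i commute with j, so they preserve its centralizer. Descending from
[F,φ] reaches some [F,[e_i,Φ_i]], then f_i gives [F,Φ_i], and e_l followed by f_l moves along each
edge of the diagram. -/
theorem j_ψ (hX : ⁅D.F, X.φ⁆ ≠ 0) (k : I) : ⁅X.j, ⁅D.F, D.Φ (some k)⁆⁆ = 0 := by
  have hf (k : I) (h : ⁅X.j, ⁅D.F, ⁅D.e (some k), D.Φ (some k)⁆⁆⁆ = 0) :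
      ⁅X.j, ⁅D.F, D.Φ (some k)⁆⁆ = 0 := by
    have := X.j_f (X.f_j k) h
    rw [← F_f_v, D.f_e_Φ, br_smul, br_smul, smul_eq_zero] at this
    exact this.resolve_left two_ne_zero
  obtain ⟨i, hi⟩ := FCore.exists_F_e_Φ_mem (D := D.FG) D.pos (LinearMap.ker (ad K X.j))
    (fun γ i r _ _ h => by
      change ⁅X.j, ⁅D.F, ⁅D.f (some i), r⁆⁆⁆ = 0
      rw [F_f_v]
      exact X.j_f (X.f_j i) h) X.n_ne_zero X.φ_mem_R hX X.j_F_φ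
  refine D.conn (fun k => ⁅X.j, ⁅D.F, D.Φ (some k)⁆⁆ = 0) i k (fun i l hA h => hf l ?_) (hf i hi)
  have := X.j_e (X.e_j l) h
  rw [← F_e_v, D.e_Φ, br_smul, br_smul, smul_eq_zero] at this
  refine this.resolve_left ?_
  simpa using hA

theorem Φ_Y (hX : ⁅D.F, X.φ⁆ ≠ 0) (k : I) : ⁅D.Φ (some k), X.Y⁆ = 0 := by
  have := jac D.F_ev (D.Φ (some k)) X.j
  rw [Φ_j, br_zero, F_j, symm (ev_od D.F_ev (D.Φ_od _)) X.j_od, j_ψ hX, zero_add] at this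
  exact this.symm

/-- Lowering [Φ_k,Y] = 0 by f₀ makes [Φ_k,[F,φ]] equal to −A_k0/2 times [s,Y]. Identifying [s,Y]
with 2[Φc,[F,φ]] gives the required identity at r = φ, and `FCore.T_eq_zero` extends it. -/
theorem good (hX : ⁅D.F, X.φ⁆ ≠ 0) : D.Good := by
  set s := ⁅D.f none, D.Φ none⁆ with hs
  -- Obtained by applying F to [s,j] = 0 and using [F,s] = 2[f₀,[F,Φ₀]].
  have h1 : ⁅s, X.Y⁆ = (2 : K) • (⁅s, X.Y⁆ + ⁅D.Φ none, ⁅D.F, X.φ⁆⁆) := by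
    have e1 : ⁅s, X.j⁆ = 0 := by
      have := jac (D.f_ev none) (D.Φ none) X.j
      rwa [Φ_j, f_none_j, br_zero, br_zero, add_zero, eq_comm] at this
    have e2 := jac D.F_ev s X.j
    have e3 : ⁅D.F, s⁆ = (2 : K) • ⁅D.f none, ⁅D.F, D.Φ none⁆⁆ := by
      rw [D.f_none_ψ_none, smul_smul, hs]; norm_num
    have e4 := jac (D.f_ev none) ⁅D.F, D.Φ none⁆ X.j
    rw [f_none_j, br_zero, add_zero] at e4
    have e5 := jac D.F_ev (D.Φ none) X.j
    rw [Φ_j, br_zero, F_j] at e5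
    rw [e1, br_zero, F_j, e3, smul_br, ← e4, eq_neg_of_add_eq_zero_left e5.symm, br_neg,
      jac (D.f_ev none), f_none_Y, smul_neg, ← hs] at e2
    exact (eq_neg_of_add_eq_zero_right e2.symm).trans (neg_neg _)
  have h2 (k : I) : ⁅D.Φ (some k), ⁅D.F, X.φ⁆⁆ = -((D.A (some k) none : K) / 2) • ⁅s, X.Y⁆ := by
    have := jac (D.f_ev none) (D.Φ (some k)) X.Y
    rw [Φ_Y hX, br_zero, f_none_Y, D.f_Φ none, smul_br] at this
    rw [eq_neg_of_add_eq_zero_right this.symm, neg_smul]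
  have h3 : (2 : K) • ⁅D.Φc, ⁅D.F, X.φ⁆⁆ = ⁅s, X.Y⁆ := by
    have e1 := D.map_Φc (adRight K ⁅D.F, X.φ⁆)
    simp only [adRight_apply, h2, smul_smul] at e1
    -- The comark relation in column 0, where the diagonal entry is 2.
    have e2 : ∑ k, D.comark k * -((D.A (some k) none : K) / 2) = 1 := by
      have := D.comark_sum none
      rw [D.A_diag] at this
      simp only [mul_neg, mul_div_assoc', Finset.sum_neg_distrib, ← Finset.sum_div]
      rw [eq_neg_of_add_eq_zero_right this]; norm_num
    rw [← Finset.sum_smul, e2, one_smul] at e1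
    rw [e1, add_comm, ← h1]
  refine fun k r hr => ?_
  have hT := FCore.T_eq_zero (D := D.FG) D.pos D.nondeg D.conn X.n_ne_zero X.φ_mem_R hX (fun k => ?_)
    hr k
  · have : ⁅D.Φ (some k), ⁅D.F, r⁆⁆ - ⁅D.Φc, ⁅⁅D.ε, D.Φ (some k)⁆, ⁅D.F, r⁆⁆⁆ = 0 := hT
    rw [D.ε_Φ, comm (D.h_ev _) (br_eq_zero_symm D.F_ev (D.F_h k)), sub_eq_zero] at this
    exact this
  · change ⁅D.Φ (some k), ⁅D.F, X.φ⁆⁆ - ⁅D.Φc, ⁅⁅D.ε, D.Φ (some k)⁆, ⁅D.F, X.φ⁆⁆⁆ = 0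
    rw [D.ε_Φ, h_some_F_φ, br_smul, h2, ← h3, smul_smul, ← sub_smul]
    convert zero_smul K _
    ring

variable (X) in
/-- The vector `[[ε, E], Y]`. -/
def J : L := ⁅⁅D.ε, D.E⁆, X.Y⁆

/-- The square of `J` vanishes. -/
theorem J_E_J (P : D.Grading) (X : HighestRoot D) : ⁅X.J, ⁅D.E, X.J⁆⁆ = 0 := by
  by_cases hX : ⁅D.F, X.φ⁆ = 0
  · simp [J, Y, hX]
  have hJev : X.J ∈ ev (K := K) := od_od D.ε_E_od X.Y_od
  have hM : ⁅D.E, X.J⁆ ∈ ev (K := K) := ev_ev D.E_ev hJev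
  have hεJ : ⁅D.ε, X.J⁆ = 0 := by
    rw [J, anticomm D.ε_od D.ε_E_od (D.ε_ε_v _), ε_Y]; simp
  have hε'J : ⁅⁅D.ε, D.E⁆, X.J⁆ = 0 := by
    refine od_sq D.ε_E_od ?_ _
    have := jac_od_ev (x := D.ε) D.E_ev ⁅D.ε, D.E⁆
    rw [D.E_ε_E, D.ε_ε_v, br_zero, br_zero, add_zero] at this
    exact this.symm
  have hFJ : ⁅D.F, X.J⁆ = 0 := by
    rw [J, jac D.F_ev, D.F_ε_E, neg_br, ε_Y, F_Y]; simp
  have heJ (i) : ⁅D.e (some i), X.J⁆ = 0 := by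
    rw [J, comm (D.e_ev _), e_Y, br_zero]
    rw [comm (D.e_ev _) (D.e_ε _), br_eq_zero_symm D.E_ev (D.E_e i), br_zero]
  have hfε (a) : ⁅D.f a, ⁅D.ε, D.E⁆⁆ = 0 := by
    rw [comm (D.f_ev _) (D.f_ε _), br_eq_zero_symm D.E_ev (D.E_f a), br_zero]
  have hfJ (i) : ⁅D.f (some i), X.J⁆ = 0 := by
    rw [J, comm (D.f_ev _) (hfε _), f_Y, br_zero]
  have hf0J : ⁅D.f none, X.J⁆ = (D.A (some X.i₁) none : K) • X.x := by
    rw [J, comm (D.f_ev _) (hfε _), f_none_Y]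
    have := jac_od_ev (x := D.ε) D.E_ev ⁅D.F, X.φ⁆
    rw [D.E_F_Rg X.φ_mem, X.ε_φ, ε_F_v, D.F_ε_Rg X.φ_mem, br_zero, add_zero] at this
    exact this.symm
  have hΦJ (k) : ⁅D.Φ (some k), X.J⁆ = 0 := by
    rw [J, anticomm (D.Φ_od _) D.ε_E_od (by rw [symm (D.Φ_od _) D.ε_E_od, D.ε_E_Φ]), Φ_Y hX]
    simp
  have hHφ : ⁅⁅D.E, D.F⁆, ⁅D.F, X.φ⁆⁆ = (-1 : K) • ⁅D.F, X.φ⁆ := by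
    rw [br_of_wt D.H_ev D.H_F (q := 1) (by rw [D.H_Rg X.φ_mem, one_smul])]; norm_num
  have hHY : ⁅⁅D.E, D.F⁆, X.Y⁆ = (-2 : K) • X.Y := by
    rw [Y, br_of_wt D.H_ev (p := -1) (by rw [D.H_e, neg_smul, one_smul]) hHφ]; norm_num
  have hHJ : ⁅⁅D.E, D.F⁆, X.J⁆ = (-1 : K) • X.J := by
    rw [J, br_of_wt D.H_ev (p := 1) (by rw [D.H_ε_E, one_smul]) hHY]; norm_num
  have hFM : ⁅D.F, ⁅D.E, X.J⁆⁆ = X.J := by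
    rw [F_E_v, hFJ, hHJ]; simp
  have hHM : ⁅⁅D.E, D.F⁆, ⁅D.E, X.J⁆⁆ = (1 : K) • ⁅D.E, X.J⁆ := by
    rw [br_of_wt D.H_ev D.H_E hHJ]; norm_num
  have heM (i) : ⁅D.e (some i), ⁅D.E, X.J⁆⁆ = 0 := by rw [← D.E_e_v, heJ, br_zero]
  have hfM (i) : ⁅D.f (some i), ⁅D.E, X.J⁆⁆ = 0 := by rw [← D.E_f_v, hfJ, br_zero]
  have hf0M : ⁅D.f none, ⁅D.E, X.J⁆⁆ = 0 := by
    rw [← D.E_f_v, hf0J, br_smul, br_eq_zero_symm X.x_ev X.x_E, smul_zero]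
  have hF : ⁅D.F, ⁅X.J, ⁅D.E, X.J⁆⁆⁆ = 0 := by
    rw [jac D.F_ev, hFJ, hFM, br_self hJev]; simp
  have hεM : ⁅D.ε, ⁅D.E, X.J⁆⁆ = 0 := by
    rw [jac_od_ev D.E_ev, hε'J, hεJ]; simp
  have hkill (y : L) (h1 : ⁅y, X.J⁆ = 0) (h2 : ⁅y, ⁅D.E, X.J⁆⁆ = 0) :
      ⁅y, ⁅X.J, ⁅D.E, X.J⁆⁆⁆ = 0 := by
    rw [jac_od_ev hJev, h1, h2]; simp
  have hcΦ (v : L) : ⁅⁅D.ε, D.Φc⁆, ⁅D.e none, v⁆⁆ = ⁅D.e none, ⁅⁅D.ε, D.Φc⁆, v⁆⁆ := by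
    refine comm D.ε_Φc_ev ?_ v
    have := jac_od D.ε_od D.Φc_od (D.e none)
    rw [D.Φc_e, D.ε_e, br_zero, br_zero, sub_zero] at this
    exact this.symm
  have hcε' : ⁅⁅D.ε, D.Φc⁆, ⁅D.ε, D.E⁆⁆ = (-1 : K) • ⁅D.ε, D.E⁆ := by
    rw [comm D.ε_Φc_ev, anti D.ε_Φc_ev, D.E_ε_Φc]
    · simp
    · have := D.ε_ε_v D.Φc
      rw [anti D.ε_Φc_ev, this, neg_zero]
  have hcY : ⁅⁅D.ε, D.Φc⁆, X.Y⁆ = (1 : K) • X.Y := by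
    rw [Y, hcΦ, D.ε_Φc_F_Rg X.φ_mem, one_smul]
  have hcJ : ⁅⁅D.ε, D.Φc⁆, X.J⁆ = (0 : K) • X.J := by
    rw [J, br_of_wt D.ε_Φc_ev hcε' hcY]; norm_num
  have hcM : ⁅⁅D.ε, D.Φc⁆, ⁅D.E, X.J⁆⁆ = (-1 : K) • ⁅D.E, X.J⁆ := by
    rw [br_of_wt D.ε_Φc_ev (p := -1) (by rw [anti D.ε_Φc_ev, D.E_ε_Φc]; simp) hcJ]; norm_num
  refine P.eq_zero_of_killed (good hX) ?_ ?_ hF (hkill _ hεJ hεM) (fun i => hkill _ (heJ i) (heM i))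
    (fun a => ?_) (fun k => hkill _ (hΦJ k) ?_) (br_of_wt D.ε_Φc_ev hcJ hcM)
  · have hY : X.Y ∈ P.Ppos := P.Ppos_P0 P.e_Ppos (P.P0_P0 P.F_P0 (P.Rg_le X.φ_mem))
    have hJ : X.J ∈ P.Ppos := P.P0_Ppos (P.P0_P0 P.ε_P0 P.E_P0) hY
    exact P.Ppos_Ppos hJ (P.P0_Ppos P.E_P0 hJ)
  · refine D.E_eq_zero ?_ hF
    rw [br_of_wt D.H_ev hHJ hHM]; simp
  · cases a with
    | some i => exact hkill _ (hfJ i) (hfM i)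
    -- Here f₀ turns J into a multiple of x, which commutes with [E,J] because all e_i with i ≥ 1
    -- kill [E,J]; and f₀ kills [E,J] since [E,x] = 0.
    | none =>
      rw [jac (D.f_ev _), hf0J, hf0M, smul_br, X.x_comm heM]; simp
  · rw [jac_od_ev D.E_ev, br_eq_zero_symm D.E_ev (D.E_Φ _), hΦJ]; simp

end HighestRoot

end

/-! ### The tensor hierarchy algebra as a graded Lie superalgebra -/

section Grading

variable {I : Type*} (K : Type*) [Field K]

theorem freeBracket_mon (u v : FreeMagma (Gen I)) :
    freeBracket I K (mon K u) (mon K v) = mon K (u * v) := by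
  simp [freeBracket, mon, MonoidAlgebra.single_mul_single]

theorem span_mon : Submodule.span K (Set.range (mon K (I := I))) = ⊤ := by
  rw [eq_top_iff]
  rintro x -
  have h (x : FreeMagma (Gen I) →₀ K) : MonoidAlgebra.ofCoeff x ∈
      Submodule.span K (Set.range (mon K (I := I))) := by
    induction x using Finsupp.induction_linear with
    | zero => exact zero_mem _
    | add f g hf hg => exact add_mem hf hg
    | single u c =>
      have : MonoidAlgebra.ofCoeff (Finsupp.single u c) = c • mon K u := by
        simp [mon]
      rw [this]
      exact Submodule.smul_mem _ _ (Submodule.subset_span ⟨u, rfl⟩)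
  exact h x.coeff

theorem ext_mon {N : Type*} [AddCommGroup N] [Module K N] {f g : FreeAlg I K →ₗ[K] N}
    (h : ∀ u, f (mon K u) = g (mon K u)) : f = g :=
  LinearMap.ext_on (span_mon K) (by rintro _ ⟨u, rfl⟩; exact h u)

open scoped Classical in
/-- The projection of the free algebra onto a multidegree. -/
def freeProj (d : SuperNode I →₀ ℤ) : FreeAlg I K →ₗ[K] FreeAlg I K :=
  Finsupp.linearCombination K (fun u => if degree u = d then mon K u else 0) ∘ₗ
    (MonoidAlgebra.coeffLinearEquiv K).toLinearMap

open scoped Classical in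
theorem freeProj_mon (d : SuperNode I →₀ ℤ) (u : FreeMagma (Gen I)) :
    freeProj K d (mon K u) = if degree u = d then mon K u else 0 := by
  exact (Finsupp.linearCombination_single _ _ _).trans (one_smul _ _)

/-- Elements of a single multidegree in the free algebra. -/
def freePart (d : SuperNode I →₀ ℤ) : Submodule K (FreeAlg I K) :=
  Submodule.span K {x | ∃ u, degree u = d ∧ x = mon K u}

variable {K}

theorem mon_mem_freePart (u : FreeMagma (Gen I)) : mon K u ∈ freePart K (degree u) :=
  Submodule.subset_span ⟨u, rfl, rfl⟩

theorem br_mem_freePart {c d : SuperNode I →₀ ℤ} {x y : FreeAlg I K} (hx : x ∈ freePart K c)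
    (hy : y ∈ freePart K d) : freeBracket I K x y ∈ freePart K (c + d) := by
  have h := Submodule.apply_mem_map₂ (freeBracket I K) hx hy
  rw [freePart, freePart, Submodule.map₂_span_span] at h
  refine Submodule.span_mono ?_ h
  rintro _ ⟨_, ⟨u, rfl, rfl⟩, _, ⟨v, rfl, rfl⟩, rfl⟩
  exact ⟨u * v, rfl, freeBracket_mon K u v⟩

theorem freeProj_of_mem {c : SuperNode I →₀ ℤ} {x : FreeAlg I K} (hx : x ∈ freePart K c) :
    freeProj K c x = x := by
  have : freePart K c ≤ LinearMap.eqLocus (freeProj K c) LinearMap.id :=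
    Submodule.span_le.2 (by rintro _ ⟨u, rfl, rfl⟩; simp [freeProj_mon])
  exact this hx

theorem freeProj_of_mem_ne {c d : SuperNode I →₀ ℤ} (hcd : c ≠ d) {x : FreeAlg I K}
    (hx : x ∈ freePart K c) : freeProj K d x = 0 := by
  have : freePart K c ≤ LinearMap.ker (freeProj K d) :=
    Submodule.span_le.2 (by rintro _ ⟨u, rfl, rfl⟩; simp [freeProj_mon, hcd])
  exact this hx

theorem freeProj_br_mon (d : SuperNode I →₀ ℤ) (x : FreeAlg I K) (u : FreeMagma (Gen I)) :
    freeProj K d (freeBracket I K x (mon K u)) =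
      freeBracket I K (freeProj K (d - degree u) x) (mon K u) := by
  have : freeProj K d ∘ₗ (freeBracket I K).flip (mon K u) =
      (freeBracket I K).flip (mon K u) ∘ₗ freeProj K (d - degree u) := by
    refine ext_mon K fun v => ?_
    have : degree v = d - degree u ↔ degree (v * u) = d := eq_sub_iff_add_eq
    by_cases h : degree (v * u) = d <;>
      simp [freeProj_mon, freeBracket_mon, this, h]
  exact LinearMap.congr_fun this x

theorem freeProj_mon_br (d : SuperNode I →₀ ℤ) (x : FreeAlg I K) (u : FreeMagma (Gen I)) :
    freeProj K d (freeBracket I K (mon K u) x) =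
      freeBracket I K (mon K u) (freeProj K (d - degree u) x) := by
  have : freeProj K d ∘ₗ freeBracket I K (mon K u) =
      freeBracket I K (mon K u) ∘ₗ freeProj K (d - degree u) := by
    refine ext_mon K fun v => ?_
    have : degree v = d - degree u ↔ degree (u * v) = d := eq_sub_iff_add_eq'
    by_cases h : degree (u * v) = d <;>
      simp [freeProj_mon, freeBracket_mon, this, h]
  exact LinearMap.congr_fun this x

variable (A : Matrix (AffineNode I) (AffineNode I) ℤ)

theorem iterate_mem_freePart {c d : SuperNode I →₀ ℤ} {x y : FreeAlg I K} (hx : x ∈ freePart K c)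
    (hy : y ∈ freePart K d) (n : ℕ) :
    (fun z => freeBracket I K x z)^[n] y ∈ freePart K (n • c + d) := by
  induction n with
  | zero => simpa using hy
  | succ n ih =>
    rw [Function.iterate_succ_apply', succ_nsmul', add_assoc]
    exact br_mem_freePart hx ih

theorem gen_mem_freePart (x : Gen I) : gen K x ∈ freePart K x.degree :=
  mon_mem_freePart (.of x)

theorem Rel.homogeneous {x : FreeAlg I K} (hx : Rel K A x) : ∃ d, x ∈ freePart K d := by
  have G (x : Gen I) {d} (h : x.degree = d) : gen K x ∈ freePart K d := h ▸ gen_mem_freePart x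
  have S {c d} {x : FreeAlg I K} (h : x ∈ freePart K c) (hcd : c = d) : x ∈ freePart K d := hcd ▸ h
  induction hx with
  | antisymm u v =>
    refine ⟨_, add_mem (br_mem_freePart (mon_mem_freePart u) (mon_mem_freePart v))
      (Submodule.smul_mem _ _ (S (br_mem_freePart (mon_mem_freePart v) (mon_mem_freePart u))
        (add_comm _ _)))⟩
  | jacobi u v w =>
    refine ⟨_, sub_mem (sub_mem (br_mem_freePart (mon_mem_freePart u) (br_mem_freePart
      (mon_mem_freePart v) (mon_mem_freePart w)))
      (S (br_mem_freePart (br_mem_freePart (mon_mem_freePart u) (mon_mem_freePart v))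
        (mon_mem_freePart w)) ?_))
      (Submodule.smul_mem _ _ (S (br_mem_freePart (mon_mem_freePart v) (br_mem_freePart
      (mon_mem_freePart u) (mon_mem_freePart w))) ?_))⟩ <;> abel
  | h_e i j => exact ⟨_, sub_mem (br_mem_freePart (G (.h i) rfl) (G (.e j) rfl))
      (Submodule.smul_mem _ _ (G _ (by simp [Gen.degree])))⟩
  | h_f i j => exact ⟨_, add_mem (br_mem_freePart (G (.h i) rfl) (G (.f j) rfl))
      (Submodule.smul_mem _ _ (G _ (by simp [Gen.degree])))⟩
  | e_f_same i => exact ⟨_, sub_mem (br_mem_freePart (G (.e (some i)) rfl) (G (.f i) rfl))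
      (G _ (by simp [Gen.degree]))⟩
  | e_f_ne i j hij => exact ⟨_, br_mem_freePart (G _ rfl) (G _ rfl)⟩
  | serre_e i j hij => exact ⟨_, iterate_mem_freePart (G _ rfl) (G _ rfl) _⟩
  | serre_f i j hij => exact ⟨_, iterate_mem_freePart (G _ rfl) (G _ rfl) _⟩
  | ε_φ i => exact ⟨_, sub_mem (br_mem_freePart (G (.e none) rfl) (G (.φ i) rfl))
      (G _ (by simp [Gen.degree]))⟩
  | h_φ i j => exact ⟨_, add_mem (br_mem_freePart (G (.h i) rfl) (G (.φ j) rfl))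
      (Submodule.smul_mem _ _ (G _ (by simp [Gen.degree])))⟩
  | e_f_φ_same i k => exact ⟨_, sub_mem (br_mem_freePart (G (.e _) rfl)
      (br_mem_freePart (G (.f (some i)) rfl) (G (.φ k) rfl)))
      (Submodule.smul_mem _ _ (G _ (by simp [Gen.degree])))⟩
  | e_f_φ_ne i j k hij => exact ⟨_, br_mem_freePart (G _ rfl) (br_mem_freePart (G _ rfl) (G _ rfl))⟩
  | e_φ i => exact ⟨_, br_mem_freePart (G _ rfl) (G _ rfl)⟩
  | f_f_φ i => exact ⟨_, br_mem_freePart (G _ rfl) (br_mem_freePart (G _ rfl) (G _ rfl))⟩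
  | φ_φ i j => exact ⟨_, br_mem_freePart (G _ rfl) (G _ rfl)⟩
  | φ_φ_f i j => exact ⟨_, br_mem_freePart (G _ rfl) (br_mem_freePart (G _ rfl) (G _ rfl))⟩

/-- The elements all of whose components lie in the ideal form an ideal, and it contains the
relations because each of them is homogeneous. -/
theorem relIdeal_le_comap_freeProj (d : SuperNode I →₀ ℤ) :
    relIdeal K A ≤ (relIdeal K A).comap (freeProj K d) := by
  have hI := isIdeal_relIdeal K A
  have hrel {x} (hx : Rel K A x) : x ∈ relIdeal K A := Submodule.mem_sInf.2 fun V hV => hV.2 x hx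
  have : relIdeal K A ≤ ⨅ d, (relIdeal K A).comap (freeProj K d) := by
    refine sInf_le ⟨fun x hx y => ?_, fun x hx => ?_⟩
    · have hx' (d) : freeProj K d x ∈ relIdeal K A := (Submodule.mem_iInf _).1 hx d
      have hy : y ∈ Submodule.span K (Set.range (mon K (I := I))) := by rw [span_mon]; trivial
      induction hy using Submodule.span_induction with
      | mem y hy =>
        obtain ⟨u, rfl⟩ := hy
        simp only [Submodule.mem_iInf, Submodule.mem_comap, freeProj_br_mon, freeProj_mon_br]
        exact ⟨fun d => (hI _ (hx' _) _).1, fun d => (hI _ (hx' _) _).2⟩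
      | zero => simp
      | add y z _ _ hy hz =>
        rw [map_add, map_add, LinearMap.add_apply]
        exact ⟨add_mem hy.1 hz.1, add_mem hy.2 hz.2⟩
      | smul c y _ hy =>
        rw [map_smul, map_smul, LinearMap.smul_apply]
        exact ⟨Submodule.smul_mem _ _ hy.1, Submodule.smul_mem _ _ hy.2⟩
    · refine (Submodule.mem_iInf _).2 fun d => ?_
      obtain ⟨c, hc⟩ := hx.homogeneous
      rw [Submodule.mem_comap]
      by_cases hcd : c = d
      · subst hcd; rw [freeProj_of_mem hc]; exact hrel hx
      · rw [freeProj_of_mem_ne hcd hc]; exact zero_mem _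
  exact this.trans (iInf_le _ d)

variable (K)

/-- The projection of `S̃` onto a multidegree. -/
def tildeProj (d : SuperNode I →₀ ℤ) : TildeS K A →ₗ[K] TildeS K A :=
  (relIdeal K A).mapQ (relIdeal K A) (freeProj K d) (relIdeal_le_comap_freeProj A d)

/-- The image of a monomial in `S̃`. -/
def tildeMon (u : FreeMagma (Gen I)) : TildeS K A := (relIdeal K A).mkQ (mon K u)

open scoped Classical in
theorem tildeProj_mon (d : SuperNode I →₀ ℤ) (u : FreeMagma (Gen I)) :
    tildeProj K A d (tildeMon K A u) = if degree u = d then tildeMon K A u else 0 := by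
  rw [tildeProj, tildeMon, Submodule.mkQ_apply, Submodule.mapQ_apply, freeProj_mon]
  split_ifs <;> simp

theorem tildeProj_of_mem {c : SuperNode I →₀ ℤ} {x : TildeS K A}
    (hx : x ∈ homogeneousPart K A c) : tildeProj K A c x = x := by
  have : homogeneousPart K A c ≤ LinearMap.eqLocus (tildeProj K A c) LinearMap.id :=
    Submodule.span_le.2 (by
      rintro _ ⟨u, rfl, rfl⟩
      exact (tildeProj_mon K A _ u).trans (if_pos rfl))
  exact this hx

theorem tildeProj_of_mem_ne {c d : SuperNode I →₀ ℤ} (hcd : c ≠ d) {x : TildeS K A}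
    (hx : x ∈ homogeneousPart K A c) : tildeProj K A d x = 0 := by
  have : homogeneousPart K A c ≤ LinearMap.ker (tildeProj K A d) :=
    Submodule.span_le.2 (by
      rintro _ ⟨u, rfl, rfl⟩
      exact (tildeProj_mon K A _ u).trans (if_neg hcd))
  exact this hx

theorem maxIdeal_le_comap_tildeProj (d : SuperNode I →₀ ℤ) :
    maxIdeal K A ≤ (maxIdeal K A).comap (tildeProj K A d) := by
  refine sSup_le fun V hV => ?_
  rw [hV.2.1]
  refine iSup_le fun c x hx => ?_
  rw [Submodule.mem_comap]
  by_cases hcd : c = d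
  · subst hcd
    rw [tildeProj_of_mem K A hx.2]
    exact (le_sSup hV : V ≤ maxIdeal K A) hx.1
  · rw [tildeProj_of_mem_ne K A hcd hx.2]; exact zero_mem _

/-- Each summand is graded with trivial component of degree 0, so a sum of elements of such ideals
has none either. -/
theorem tildeProj_zero_maxIdeal : maxIdeal K A ≤ LinearMap.ker (tildeProj K A 0) := by
  refine sSup_le fun V hV => ?_
  rw [hV.2.1]
  refine iSup_le fun c x hx => ?_
  rw [LinearMap.mem_ker]
  by_cases hcd : c = 0
  · subst hcd
    have := hV.2.2.le hx
    rw [(Submodule.mem_bot K).1 this, map_zero]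
  · rw [tildeProj_of_mem_ne K A hcd hx.2]

/-- The projection of `S` onto a multidegree. -/
def proj (d : SuperNode I →₀ ℤ) : S K A →ₗ[K] S K A :=
  (maxIdeal K A).mapQ (maxIdeal K A) (tildeProj K A d) (maxIdeal_le_comap_tildeProj K A d)

/-- The quotient map from `S̃` to `S`. -/
def mkS : TildeS K A →ₗ[K] S K A := (maxIdeal K A).mkQ

/-- The image of a monomial in `S`. -/
def monS (u : FreeMagma (Gen I)) : S K A := mkS K A (tildeMon K A u)

theorem proj_mkS (d : SuperNode I →₀ ℤ) (x : TildeS K A) :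
    proj K A d (mkS K A x) = mkS K A (tildeProj K A d x) := rfl

theorem mkS_surjective : Function.Surjective (mkS K A) := (maxIdeal K A).mkQ_surjective

theorem mkS_eq_zero {x : TildeS K A} : mkS K A x = 0 ↔ x ∈ maxIdeal K A :=
  Submodule.Quotient.mk_eq_zero _

theorem monS_mul (u v : FreeMagma (Gen I)) : monS K A (u * v) = ⁅monS K A u, monS K A v⁆ := by
  change mkS K A ((relIdeal K A).mkQ _) =
    mkS K A ((relIdeal K A).mkQ (freeBracket I K (mon K u) (mon K v)))
  rw [freeBracket_mon]

open scoped Classical in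
theorem proj_monS (d : SuperNode I →₀ ℤ) (u : FreeMagma (Gen I)) :
    proj K A d (monS K A u) = if degree u = d then monS K A u else 0 := by
  rw [monS, proj_mkS, tildeProj_mon]
  split_ifs <;> simp

theorem span_tildeMon : Submodule.span K (Set.range (tildeMon K A)) = ⊤ := by
  have h := congrArg (Submodule.map (relIdeal K A).mkQ) (span_mon K (I := I))
  rw [Submodule.map_span, Submodule.map_top, Submodule.range_mkQ, ← Set.range_comp] at h
  exact h

theorem span_monS : Submodule.span K (Set.range (monS K A)) = ⊤ := by
  have h := congrArg (Submodule.map (mkS K A)) (span_tildeMon K A)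
  rw [Submodule.map_span, Submodule.map_top, LinearMap.range_eq_top.2 (mkS_surjective K A),
    ← Set.range_comp] at h
  exact h

variable {K A} in
/-- An induction principle: a subspace that contains all monomials is everything. -/
theorem mem_of_monS {V : Submodule K (S K A)} (h : ∀ u, monS K A u ∈ V) (x : S K A) : x ∈ V := by
  have : Submodule.span K (Set.range (monS K A)) ≤ V :=
    Submodule.span_le.2 (by rintro _ ⟨u, rfl⟩; exact h u)
  rw [span_monS] at this
  exact this trivial

instance : BiadditiveBracket (S K A) where
  add_br x y z := by
    change bracket K A (x + y) z = _
    rw [map_add]; rfl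
  br_add x y z := map_add (bracket K A x) y z

/-- The image of the free algebra in `S`. -/
def freeToS : FreeAlg I K →ₗ[K] S K A := mkS K A ∘ₗ (relIdeal K A).mkQ

theorem freeToS_iterate (x y : FreeAlg I K) (n : ℕ) :
    freeToS K A ((fun z => freeBracket I K x z)^[n] y) =
      (fun z => ⁅freeToS K A x, z⁆)^[n] (freeToS K A y) := by
  induction n with
  | zero => rfl
  | succ n ih => rw [Function.iterate_succ_apply', Function.iterate_succ_apply', ← ih]; rfl

theorem freeToS_rel {x : FreeAlg I K} (hx : Rel K A x) : freeToS K A x = 0 := by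
  have : x ∈ relIdeal K A := Submodule.mem_sInf.2 fun V hV => hV.2 x hx
  rw [freeToS, LinearMap.comp_apply, (Submodule.mkQ_apply _ x).trans
    ((Submodule.Quotient.mk_eq_zero _).2 this), map_zero]

end Grading

/-! ### The bracket of S is a Lie superalgebra -/

section Super

variable {I : Type*} (K : Type*) [Field K] (A : Matrix (AffineNode I) (AffineNode I) ℤ)

/-- The span of the monomials whose degree at a node satisfies a condition. -/
def nodeSpan (s : SuperNode I) (p : ℤ → Prop) : Submodule K (S K A) :=
  Submodule.span K {x | ∃ u, p (degree u s) ∧ x = monS K A u}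

variable {K A} {s : SuperNode I}

theorem monS_mem_nodeSpan {p : ℤ → Prop} {u : FreeMagma (Gen I)} (h : p (degree u s)) :
    monS K A u ∈ nodeSpan K A s p := Submodule.subset_span ⟨u, h, rfl⟩

theorem smul_br_S (c : K) (x y : S K A) : ⁅c • x, y⁆ = c • ⁅x, y⁆ := by
  change bracket K A (c • x) y = c • bracket K A x y
  rw [map_smul]; rfl

theorem br_smul_S (c : K) (x y : S K A) : ⁅x, c • y⁆ = c • ⁅x, y⁆ :=
  map_smul (bracket K A x) c y

theorem br_mem_nodeSpan {p q r : ℤ → Prop} (h : ∀ m n, p m → q n → r (m + n)) {x y : S K A}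
    (hx : x ∈ nodeSpan K A s p) (hy : y ∈ nodeSpan K A s q) :
    ⁅x, y⁆ ∈ nodeSpan K A s r := by
  have := Submodule.apply_mem_map₂ (bracket K A) hx hy
  rw [nodeSpan, nodeSpan, Submodule.map₂_span_span] at this
  refine Submodule.span_mono ?_ this
  rintro _ ⟨_, ⟨u, hu, rfl⟩, _, ⟨v, hv, rfl⟩, rfl⟩
  exact ⟨u * v, h _ _ hu hv, (monS_mul K A u v).symm⟩

/-- Two linear maps that agree on the monomials in question agree on their span. -/
theorem eq_of_nodeSpan {p : ℤ → Prop} {N : Type*} [AddCommGroup N] [Module K N]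
    (f g : S K A →ₗ[K] N) (h : ∀ u, p (degree u s) → f (monS K A u) = g (monS K A u)) {x : S K A}
    (hx : x ∈ nodeSpan K A s p) : f x = g x := by
  have : nodeSpan K A s p ≤ LinearMap.eqLocus f g :=
    Submodule.span_le.2 (by rintro _ ⟨u, hu, rfl⟩; exact h u hu)
  exact this hx

theorem eq_of_monS {N : Type*} [AddCommGroup N] [Module K N]
    (f g : S K A →ₗ[K] N) (h : ∀ u, f (monS K A u) = g (monS K A u)) (x : S K A) : f x = g x :=
  mem_of_monS (V := LinearMap.eqLocus f g) h x

theorem monS_antisymm (u v : FreeMagma (Gen I)) :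
    ⁅monS K A u, monS K A v⁆ = -(koszulSign K u v • ⁅monS K A v, monS K A u⁆) := by
  have := freeToS_rel K A (.antisymm u v)
  rw [map_add, map_smul] at this
  exact eq_neg_of_add_eq_zero_left this

theorem monS_jacobi (u v w : FreeMagma (Gen I)) :
    ⁅monS K A u, ⁅monS K A v, monS K A w⁆⁆ = ⁅⁅monS K A u, monS K A v⁆, monS K A w⁆ +
      koszulSign K u v • ⁅monS K A v, ⁅monS K A u, monS K A w⁆⁆ := by
  have := freeToS_rel K A (.jacobi u v w)
  rw [map_sub, map_sub, map_smul, sub_sub] at this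
  exact sub_eq_zero.1 this

theorem koszulSign_even {u : FreeMagma (Gen I)} (hu : Even (level u)) (v : FreeMagma (Gen I)) :
    koszulSign K u v = 1 := by
  rw [koszulSign, if_neg]; rw [← Int.not_odd_iff_even] at hu; tauto

theorem koszulSign_odd {u v : FreeMagma (Gen I)} (hu : Odd (level u)) (hv : Odd (level v)) :
    koszulSign K u v = -1 := by
  rw [koszulSign, if_pos ⟨hu, hv⟩]

instance : SuperBracket K (S K A) where
  ev := nodeSpan K A none Even
  od := nodeSpan K A none Odd
  smul_br := smul_br_S
  br_smul := br_smul_S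
  ev_ev := br_mem_nodeSpan fun _ _ => Even.add
  ev_od := br_mem_nodeSpan fun _ _ => Even.add_odd
  od_od := br_mem_nodeSpan fun _ _ => Odd.add_odd
  anti hx y := by
    refine eq_of_monS (bracket K A _) (-(bracket K A).flip _) (fun v => ?_) y
    refine eq_of_nodeSpan ((bracket K A).flip (monS K A v)) (-bracket K A (monS K A v))
      (fun u hu => ?_) hx
    exact (monS_antisymm u v).trans (by rw [koszulSign_even hu, one_smul]; rfl)
  symm {x y} hx hy := by
    refine eq_of_nodeSpan (bracket K A x) ((bracket K A).flip x) (fun v hv => ?_) hy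
    refine eq_of_nodeSpan ((bracket K A).flip (monS K A v)) (bracket K A (monS K A v))
      (fun u hu => ?_) hx
    exact (monS_antisymm u v).trans (by rw [koszulSign_odd hu hv, neg_smul, one_smul, neg_neg]; rfl)
  jac {x} hx y z := by
    refine eq_of_monS (bracket K A x ∘ₗ bracket K A y)
      (bracket K A (bracket K A x y) + bracket K A y ∘ₗ bracket K A x) (fun w => ?_) z
    refine eq_of_monS (bracket K A x ∘ₗ (bracket K A).flip (monS K A w))
      ((bracket K A).flip (monS K A w) ∘ₗ bracket K A x +
        (bracket K A).flip (bracket K A x (monS K A w))) (fun v => ?_) y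
    refine eq_of_nodeSpan ((bracket K A).flip (bracket K A (monS K A v) (monS K A w)))
      ((bracket K A).flip (monS K A w) ∘ₗ (bracket K A).flip (monS K A v) +
        bracket K A (monS K A v) ∘ₗ (bracket K A).flip (monS K A w)) (fun u hu => ?_) hx
    exact (monS_jacobi u v w).trans (by rw [koszulSign_even hu, one_smul]; rfl)
  jac_od {x y} hx hy z := by
    refine eq_of_monS (bracket K A x ∘ₗ bracket K A y)
      (bracket K A (bracket K A x y) - bracket K A y ∘ₗ bracket K A x) (fun w => ?_) z
    refine eq_of_nodeSpan (bracket K A x ∘ₗ (bracket K A).flip (monS K A w))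
      ((bracket K A).flip (monS K A w) ∘ₗ bracket K A x -
        (bracket K A).flip (bracket K A x (monS K A w))) (fun v hv => ?_) hy
    refine eq_of_nodeSpan ((bracket K A).flip (bracket K A (monS K A v) (monS K A w)))
      ((bracket K A).flip (monS K A w) ∘ₗ (bracket K A).flip (monS K A v) -
        bracket K A (monS K A v) ∘ₗ (bracket K A).flip (monS K A w)) (fun u hu => ?_) hx
    exact (monS_jacobi u v w).trans
      (by rw [koszulSign_odd hu hv, neg_smul, one_smul, ← sub_eq_add_neg]; rfl)

theorem monS_mem_ev {u : FreeMagma (Gen I)} (h : Even (level u)) :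
    monS K A u ∈ ev (K := K) (L := S K A) := monS_mem_nodeSpan h

theorem monS_mem_od {u : FreeMagma (Gen I)} (h : Odd (level u)) :
    monS K A u ∈ od (K := K) (L := S K A) := monS_mem_nodeSpan h

theorem monS_parity (u : FreeMagma (Gen I)) :
    monS K A u ∈ ev (K := K) (L := S K A) ∨ monS K A u ∈ od (K := K) (L := S K A) :=
  (Int.even_or_odd (level u)).imp monS_mem_ev monS_mem_od

/-- A subspace that is closed under the bracket and contains the generators is everything. -/
theorem mem_of_toS {V : Submodule K (S K A)} (h : ∀ x, toS K A x ∈ V)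
    (hV : ∀ x ∈ V, ∀ y ∈ V, ⁅x, y⁆ ∈ V) (x : S K A) : x ∈ V := by
  refine mem_of_monS (fun u => ?_) x
  induction u with
  | ih1 x => exact h x
  | ih2 u v hu hv => exact monS_mul K A u v ▸ hV _ hu _ hv

/-- A subspace that is stable under the generators is a left ideal. -/
theorem br_mem_of_toS {W : Submodule K (S K A)} (h : ∀ x, ∀ w ∈ W, ⁅toS K A x, w⁆ ∈ W)
    (x : S K A) {w : S K A} (hw : w ∈ W) : ⁅x, w⁆ ∈ W := by
  suffices H : ∀ u, ∀ w ∈ W, ⁅monS K A u, w⁆ ∈ W from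
    mem_of_monS (V := W.comap ((bracket K A).flip w)) (fun u => H u w hw) x
  intro u
  induction u with
  | ih1 x => exact h x
  | ih2 u v hu hv =>
    intro w hw
    rw [monS_mul]
    rcases Int.even_or_odd (level u) with h | h
    · rw [← sub_eq_iff_eq_add.2 (jac (monS_mem_ev h) _ _)]
      exact sub_mem (hu _ (hv _ hw)) (hv _ (hu _ hw))
    · rcases Int.even_or_odd (level v) with h' | h'
      · rw [← sub_eq_iff_eq_add.2 (jac_od_ev (monS_mem_ev h') _)]
        exact sub_mem (hu _ (hv _ hw)) (hv _ (hu _ hw))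
      · rw [← eq_sub_iff_add_eq.1 (jac_od (monS_mem_od h) (monS_mem_od h') w)]
        exact add_mem (hu _ (hv _ hw)) (hv _ (hu _ hw))

end Super

/-! ### No nonzero ideal avoids multidegree zero -/

section Ideal

variable {I : Type*} {K : Type*} [Field K] {A : Matrix (AffineNode I) (AffineNode I) ℤ}

theorem sum_proj (x : TildeS K A) : ∃ s : Finset (SuperNode I →₀ ℤ), ∀ t, s ⊆ t →
    ∑ d ∈ t, tildeProj K A d x = x := by
  classical
  have hx : x ∈ Submodule.span K (Set.range (tildeMon K A)) := by rw [span_tildeMon]; trivial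
  induction hx using Submodule.span_induction with
  | mem x hx =>
    obtain ⟨u, rfl⟩ := hx
    refine ⟨{degree u}, fun t ht => ?_⟩
    simp only [tildeProj_mon]
    rw [Finset.sum_ite_eq, if_pos (ht (Finset.mem_singleton_self _))]
  | zero => exact ⟨∅, by simp⟩
  | add x y _ _ hx hy =>
    obtain ⟨s, hs⟩ := hx
    obtain ⟨s', hs'⟩ := hy
    refine ⟨s ∪ s', fun t ht => ?_⟩
    simp only [map_add, Finset.sum_add_distrib]
    rw [hs t (Finset.union_subset_left ht), hs' t (Finset.union_subset_right ht)]
  | smul c x _ hx =>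
    obtain ⟨s, hs⟩ := hx
    exact ⟨s, fun t ht => by simp only [map_smul, ← Finset.smul_sum]; rw [hs t ht]⟩

theorem tildeProj_mem (d : SuperNode I →₀ ℤ) (x : TildeS K A) :
    tildeProj K A d x ∈ homogeneousPart K A d := by
  have hx : x ∈ Submodule.span K (Set.range (tildeMon K A)) := by rw [span_tildeMon]; trivial
  induction hx using Submodule.span_induction with
  | mem x hx =>
    obtain ⟨u, rfl⟩ := hx
    rw [tildeProj_mon]
    split_ifs with h
    · exact Submodule.subset_span ⟨u, h, rfl⟩
    · exact zero_mem _
  | zero => simp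
  | add x y _ _ hx hy => rw [map_add]; exact add_mem hx hy
  | smul c x _ hx => rw [map_smul]; exact Submodule.smul_mem _ _ hx

open scoped Classical in
theorem proj_proj (c d : SuperNode I →₀ ℤ) (x : S K A) :
    proj K A c (proj K A d x) = if d = c then proj K A d x else 0 := by
  refine eq_of_monS (proj K A c ∘ₗ proj K A d) (if d = c then proj K A d else 0) (fun u => ?_) x
    |>.trans (by split_ifs <;> rfl)
  rw [LinearMap.comp_apply, proj_monS]
  split_ifs with h1 h2 h2
  · rw [proj_monS, proj_monS, if_pos h1, if_pos (h1.trans h2)]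
  · rw [proj_monS, if_neg (fun h => h2 (h1.symm.trans h))]; rfl
  · rw [map_zero, proj_monS, if_neg h1]
  · rw [map_zero]; rfl

theorem proj_toS_br (d : SuperNode I →₀ ℤ) (x : Gen I) (w : S K A) :
    ⁅toS K A x, proj K A d w⁆ = proj K A (x.degree + d) ⁅toS K A x, w⁆ := by
  refine eq_of_monS (bracket K A (toS K A x) ∘ₗ proj K A d)
    (proj K A (x.degree + d) ∘ₗ bracket K A (toS K A x)) (fun u => ?_) w
  rw [LinearMap.comp_apply, LinearMap.comp_apply, proj_monS]
  change _ = proj K A _ ⁅monS K A (.of x), monS K A u⁆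
  rw [← monS_mul, proj_monS, monS_mul]
  have : degree (.of x * u) = x.degree + d ↔ degree u = d := add_right_inj _
  by_cases h : degree u = d
  · rw [if_pos h, if_pos (this.2 h)]; rfl
  · rw [if_neg h, if_neg (fun h' => h (this.1 h')), map_zero]

theorem proj_mem (d : SuperNode I →₀ ℤ) (x : S K A) :
    proj K A d x ∈ nodeSpan K A none (fun n => n = d none) := by
  refine mem_of_monS (V := (nodeSpan K A none (fun n => n = d none)).comap (proj K A d)) (fun u => ?_) x
  rw [Submodule.mem_comap, proj_monS]
  split_ifs with h
  · exact monS_mem_nodeSpan (by rw [← h])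
  · exact zero_mem _

theorem nodeSpan_mono {s : SuperNode I} {p q : ℤ → Prop} (h : ∀ n, p n → q n) : nodeSpan K A s p ≤
    nodeSpan K A s q :=
  Submodule.span_mono fun _ ⟨u, hu, hx⟩ => ⟨u, h _ hu, hx⟩

theorem proj_parity (d : SuperNode I →₀ ℤ) (x : S K A) :
    proj K A d x ∈ ev (K := K) (L := S K A) ∨ proj K A d x ∈ od (K := K) (L := S K A) := by
  rcases Int.even_or_odd (d none) with h | h
  · exact .inl (nodeSpan_mono (fun n hn => hn ▸ h) (proj_mem d x))
  · exact .inr (nodeSpan_mono (fun n hn => hn ▸ h) (proj_mem d x))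

/-- There are no nonzero left ideals without a component of multidegree zero. -/
theorem eq_bot_of_proj_zero {W : Submodule K (S K A)} (hW : ∀ x, ∀ w ∈ W, ⁅toS K A x, w⁆ ∈ W)
    (h0 : ∀ w ∈ W, proj K A 0 w = 0) : W = ⊥ := by
  -- W need not be graded; V is its graded hull. Its elements have homogeneous generators, which
  -- have a parity, so the left ideal is also a right ideal.
  set V : Submodule K (S K A) := ⨆ d, W.map (proj K A d) with hV
  have mem_V (d) {w} (hw : w ∈ W) : proj K A d w ∈ V :=
    (le_iSup (fun d => W.map (proj K A d)) d) (Submodule.mem_map_of_mem hw)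
  have V_le {U : Submodule K (S K A)} (h : ∀ d, ∀ w ∈ W, proj K A d w ∈ U) : V ≤ U :=
    iSup_le fun d => Submodule.map_le_iff_le_comap.2 fun w hw => h d w hw
  have left (x : S K A) {v : S K A} (hv : v ∈ V) : ⁅x, v⁆ ∈ V := by
    refine br_mem_of_toS (fun x w hw => ?_) x hv
    have : V ≤ V.comap (bracket K A (toS K A x)) := V_le fun d w hw => by
      change ⁅toS K A x, proj K A d w⁆ ∈ V
      rw [proj_toS_br]
      exact mem_V _ (hW _ _ hw)
    exact this hw
  have right (x : S K A) {v : S K A} (hv : v ∈ V) : ⁅v, x⁆ ∈ V := by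
    have : V ≤ V.comap ((bracket K A).flip x) := V_le fun d w hw => by
      change ⁅proj K A d w, x⁆ ∈ V
      rcases proj_parity d w with h | h
      · rw [anti h]; exact neg_mem (left _ (mem_V _ hw))
      · refine mem_of_monS (V := V.comap (bracket K A (proj K A d w))) (fun u => ?_) x
        change ⁅proj K A d w, monS K A u⁆ ∈ V
        rcases monS_parity (K := K) (A := A) u with h' | h'
        · rw [← neg_neg ⁅proj K A d w, monS K A u⁆, ← anti h']
          exact neg_mem (left _ (mem_V _ hw))
        · rw [symm h h']; exact left _ (mem_V _ hw)
    exact this hv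
  have hproj (c) : V ≤ V.comap (proj K A c) := V_le fun d w hw => by
    rw [Submodule.mem_comap, proj_proj]
    split_ifs
    · exact mem_V d hw
    · exact zero_mem _
  have hproj0 : V ≤ LinearMap.ker (proj K A 0) := V_le fun d w hw => by
    rw [LinearMap.mem_ker, proj_proj]
    split_ifs with h
    · rw [h, h0 w hw]
    · rfl
  -- In degree 0 an element of the preimage maps to zero in S, so it lies in `maxIdeal`, which has
  -- no component of degree 0.
  have avoid : IsAvoidingIdeal K A (V.comap (mkS K A)) := by
    refine ⟨fun x hx y => ⟨right (mkS K A y) hx, left (mkS K A y) hx⟩, le_antisymm (fun x hx => ?_)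
      (iSup_le fun d => inf_le_left), (Submodule.eq_bot_iff _).2 fun x hx => ?_⟩
    · obtain ⟨s, hs⟩ := sum_proj x
      rw [← hs s subset_rfl]
      refine sum_mem fun d _ => Submodule.mem_iSup_of_mem d ⟨?_, tildeProj_mem d x⟩
      exact hproj d hx
    · have h1 : tildeProj K A 0 x = x := tildeProj_of_mem K A hx.2
      have h2 : mkS K A x = 0 := by
        rw [← h1, ← proj_mkS]; exact hproj0 hx.1
      rw [← h1]
      exact tildeProj_zero_maxIdeal K A ((mkS_eq_zero K A).1 h2)
  refine (Submodule.eq_bot_iff _).2 fun w hw => ?_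
  obtain ⟨x, rfl⟩ := mkS_surjective K A w
  obtain ⟨s, hs⟩ := sum_proj x
  rw [← hs s subset_rfl, map_sum]
  refine Finset.sum_eq_zero fun d _ => ?_
  exact (mkS_eq_zero K A).2 ((le_sSup avoid : _ ≤ maxIdeal K A) (mem_V d hw))

end Ideal

/-! ### Relations in the tensor hierarchy algebra -/

section Relations

variable {I : Type*} {K : Type*} [Field K] {A : Matrix (AffineNode I) (AffineNode I) ℤ}

theorem toS_mem_ev {x : Gen I} (h : Even (x.degree none)) : toS K A x ∈ ev (K := K) :=
  monS_mem_ev (u := .of x) h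

theorem toS_mem_od {x : Gen I} (h : Odd (x.degree none)) : toS K A x ∈ od (K := K) :=
  monS_mem_od (u := .of x) h

theorem e_some_mem_ev (a : OverNode I) : toS K A (.e (some a)) ∈ ev (K := K) :=
  toS_mem_ev (by simp [Gen.degree])

theorem f_mem_ev (a : OverNode I) : toS K A (.f a) ∈ ev (K := K) :=
  toS_mem_ev (by simp [Gen.degree])

theorem h_mem_ev (a : OverNode I) : toS K A (.h a) ∈ ev (K := K) :=
  toS_mem_ev (by simp [Gen.degree])

theorem ε_mem_od : toS K A (.e none) ∈ od (K := K) :=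
  toS_mem_od (by simp [Gen.degree])

theorem φ_mem_od (a : AffineNode I) : toS K A (.φ a) ∈ od (K := K) :=
  toS_mem_od (by simp [Gen.degree])

theorem toS_h_e (i : OverNode I) (j : SuperNode I) {c : ℤ} (hc : superCartan A (some i) j = c) :
    ⁅toS K A (.h i), toS K A (.e j)⁆ = (c : K) • toS K A (.e j) := by
  have := freeToS_rel K A (.h_e i j)
  rw [map_sub, map_smul, hc] at this
  exact sub_eq_zero.1 this

theorem toS_h_f (i j : OverNode I) {c : ℤ} (hc : superCartan A (some i) (some j) = c) :
    ⁅toS K A (.h i), toS K A (.f j)⁆ = -(c : K) • toS K A (.f j) := by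
  have := freeToS_rel K A (.h_f i j)
  rw [map_add, map_smul, hc] at this
  rw [neg_smul]
  exact eq_neg_of_add_eq_zero_left this

theorem toS_h_φ (i : OverNode I) (j : AffineNode I) {c : ℤ} (hc : superCartan A (some i) none = c) :
    ⁅toS K A (.h i), toS K A (.φ j)⁆ = -(c : K) • toS K A (.φ j) := by
  have := freeToS_rel K A (.h_φ i j)
  rw [map_add, map_smul, hc] at this
  rw [neg_smul]
  exact eq_neg_of_add_eq_zero_left this

theorem toS_e_f_same (i : OverNode I) :
    ⁅toS K A (.e (some i)), toS K A (.f i)⁆ = toS K A (.h i) := by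
  have := freeToS_rel K A (.e_f_same i)
  rw [map_sub] at this
  exact sub_eq_zero.1 this

theorem toS_e_f_ne {i : SuperNode I} {j : OverNode I} (hij : i ≠ some j) :
    ⁅toS K A (.e i), toS K A (.f j)⁆ = 0 :=
  freeToS_rel K A (.e_f_ne i j hij)

theorem br_eq_zero_of_e_f {i : SuperNode I} {j : OverNode I} (hij : i ≠ some j) :
    ⁅toS K A (.f j), toS K A (.e i)⁆ = 0 := by
  rw [anti (f_mem_ev j), toS_e_f_ne hij, neg_zero]

theorem toS_serre_e {i j : SuperNode I} (n : ℕ) (hn : superCartan A i j = -n) :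
    (fun x => ⁅toS K A (.e i), x⁆)^[n + 1] (toS K A (.e j)) = 0 := by
  have := freeToS_rel K A (.serre_e i j (by omega))
  have hn' : (1 - superCartan A i j).toNat = n + 1 := by omega
  rw [hn'] at this
  exact (freeToS_iterate K A _ _ _).symm.trans this

theorem toS_serre_f {i j : OverNode I} (n : ℕ) (hn : superCartan A (some i) (some j) = -n) :
    (fun x => ⁅toS K A (.f i), x⁆)^[n + 1] (toS K A (.f j)) = 0 := by
  have := freeToS_rel K A (.serre_f i j (by omega))
  have hn' : (1 - superCartan A (some i) (some j)).toNat = n + 1 := by omega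
  rw [hn'] at this
  exact (freeToS_iterate K A _ _ _).symm.trans this

theorem toS_ε_φ (i : AffineNode I) :
    ⁅toS K A (.e none), toS K A (.φ i)⁆ = toS K A (.h (some i)) := by
  have := freeToS_rel K A (.ε_φ i)
  rw [map_sub] at this
  exact sub_eq_zero.1 this

theorem superCartan_some_some (a b : AffineNode I) :
    superCartan A (some (some a)) (some (some b)) = A a b := by
  cases a <;> cases b <;> rfl

theorem toS_e_f_φ_same (i k : AffineNode I) :
    ⁅toS K A (.e (some (some i))), ⁅toS K A (.f (some i)), toS K A (.φ k)⁆⁆ =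
      (A k i : K) • toS K A (.φ i) := by
  have := freeToS_rel K A (.e_f_φ_same i k)
  rw [map_sub, map_smul, superCartan_some_some] at this
  exact sub_eq_zero.1 this

theorem toS_e_f_φ_ne {i j : AffineNode I} (hij : i ≠ j) (k : AffineNode I) :
    ⁅toS K A (.e (some (some i))), ⁅toS K A (.f (some j)), toS K A (.φ k)⁆⁆ = 0 :=
  freeToS_rel K A (.e_f_φ_ne i j k hij)

theorem toS_f_e_φ_same (a b : AffineNode I) :
    ⁅toS K A (.f (some a)), ⁅toS K A (.e (some (some a))), toS K A (.φ b)⁆⁆ =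
      (A b a : K) • toS K A (.φ a) := by
  have h3 : ⁅toS K A (.h (some a)), toS K A (.φ b)⁆ = 0 := by
    rw [toS_h_φ (c := 0) _ _ (by cases a <;> rfl)]; simp
  rw [jac (f_mem_ev _), anti (f_mem_ev _) (toS K A (.e _)), toS_e_f_same, neg_br, h3, neg_zero,
    zero_add, toS_e_f_φ_same]

theorem toS_f_e_φ_ne {a b : AffineNode I} (hab : a ≠ b) (k : AffineNode I) :
    ⁅toS K A (.f (some a)), ⁅toS K A (.e (some (some b))), toS K A (.φ k)⁆⁆ = 0 := by
  rw [jac (f_mem_ev _), br_eq_zero_of_e_f (by simpa using hab.symm), zero_br, zero_add,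
    toS_e_f_φ_ne hab.symm]

theorem toS_e_φ (i : AffineNode I) : ⁅toS K A (.e (some none)), toS K A (.φ i)⁆ = 0 :=
  freeToS_rel K A (.e_φ i)

theorem toS_f_f_φ (i : AffineNode I) :
    ⁅toS K A (.f none), ⁅toS K A (.f none), toS K A (.φ i)⁆⁆ = 0 :=
  freeToS_rel K A (.f_f_φ i)

theorem toS_φ_φ (i j : AffineNode I) : ⁅toS K A (.φ i), toS K A (.φ j)⁆ = 0 :=
  freeToS_rel K A (.φ_φ i j)

theorem toS_φ_f_φ (i j : I) :
    ⁅toS K A (.φ (some i)), ⁅toS K A (.f none), toS K A (.φ (some j))⁆⁆ = 0 := by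
  have : ⁅toS K A (.φ (some i)), ⁅toS K A (.φ (some j)), toS K A (.f none)⁆⁆ = 0 :=
    freeToS_rel K A (.φ_φ_f i j)
  rw [anti (f_mem_ev _), br_neg, this, neg_zero]

theorem iterate_br (x y : S K A) (n : ℕ) : (fun z => ⁅x, z⁆)^[n] y = (ad K x ^ n) y := by
  rw [Module.End.pow_apply]; rfl

/-- The generators other than the `h i` suffice to check local nilpotency. -/
theorem mem_nil_of_toS {x : S K A} (hx : x ∈ ev (K := K))
    (he : ∀ i, toS K A (.e i) ∈ nil K x) (hf : ∀ i, toS K A (.f i) ∈ nil K x)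
    (hφ : ∀ i, toS K A (.φ i) ∈ nil K x) (v : S K A) : v ∈ nil K x := by
  refine mem_of_toS (fun y => ?_) (fun u hu v hv => br_mem_nil hx hu hv) v
  cases y with
  | e i => exact he i
  | f i => exact hf i
  | φ i => exact hφ i
  | h i => rw [← toS_e_f_same]; exact br_mem_nil hx (he _) (hf _)

theorem e_mem_nil_e {i j : SuperNode I} (h : superCartan A i j ≤ 0) :
    toS K A (.e j) ∈ nil K (toS K A (.e i)) := by
  obtain ⟨n, hn⟩ : ∃ n : ℕ, superCartan A i j = -n := ⟨(-superCartan A i j).toNat, by omega⟩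
  exact ⟨n + 1, by rw [← iterate_br, toS_serre_e n hn]⟩

theorem f_mem_nil_f {i j : OverNode I} (h : superCartan A (some i) (some j) ≤ 0) :
    toS K A (.f j) ∈ nil K (toS K A (.f i)) := by
  obtain ⟨n, hn⟩ : ∃ n : ℕ, superCartan A (some i) (some j) = -n :=
    ⟨(-superCartan A (some i) (some j)).toNat, by omega⟩
  exact ⟨n + 1, by rw [← iterate_br, toS_serre_f n hn]⟩

end Relations

variable (K : Type*) {I : Type*} [Field K] [Fintype I] in
/-- The properties of the Cartan matrix of an affine Kac–Moody algebra that are used. -/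
structure AffineData (A : Matrix (AffineNode I) (AffineNode I) ℤ) where
  diag (a : Option I) : A a a = 2
  nonpos {a b : Option I} : a ≠ b → A a b ≤ 0
  neighbour (a : Option I) : ∃ b, b ≠ a ∧ A b a ≠ 0
  comark : I → K
  comark_sum (b : Option I) : (A none b : K) + ∑ k, comark k * (A (some k) b : K) = 0
  pos (γ : I → ℕ) : γ ≠ 0 → ∃ i, 0 < ∑ j, A (some i) (some j) * γ j
  nondeg (x : I → ℤ) : (∀ l, ∑ j, A (some l) (some j) * x j = 0) → x = 0
  conn (Q : I → Prop) (i j : I) : (∀ i j, A (some i) (some j) ≠ 0 → Q i → Q j) → Q i → Q j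

/-! ### Local nilpotency and the instance of the abstract relations -/

namespace AffineData

variable {I : Type*} {K : Type*} [Field K] [Fintype I]
  {A : Matrix (AffineNode I) (AffineNode I) ℤ}

theorem over_nonpos (D : AffineData K A) {i j : SuperNode I} (h : i ≠ j) : superCartan A i j ≤ 0 := by
  rcases i with _ | _ | a <;> rcases j with _ | _ | b <;>
    first | exact absurd rfl h | skip
  · simp [superCartan, addNode]
  · simp [superCartan, addNode]
  · simp [superCartan, addNode]
  · cases b <;> simp [superCartan, overCartan, addNode]
  · simp [superCartan, addNode]
  · cases a <;> simp [superCartan, overCartan, addNode]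
  · rw [superCartan_some_some]; exact D.nonpos (by simpa using h)

variable [CharZero K]

theorem e_mem_nil_e (D : AffineData K A) (i : OverNode I) (j : SuperNode I) :
    toS K A (.e j) ∈ nil K (toS K A (.e (some i))) := by
  by_cases h : some i = j
  · exact mem_nil_of_br_eq_zero (h ▸ br_self (e_some_mem_ev i))
  · exact TensorHierarchy.e_mem_nil_e (D.over_nonpos h)

theorem f_mem_nil_f (D : AffineData K A) (i j : OverNode I) :
    toS K A (.f j) ∈ nil K (toS K A (.f i)) := by
  by_cases h : i = j
  · exact mem_nil_of_br_eq_zero (h ▸ br_self (f_mem_ev i))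
  · exact TensorHierarchy.f_mem_nil_f (D.over_nonpos (by simpa using h))

theorem f_mem_nil_e (D : AffineData K A) (i j : OverNode I) :
    toS K A (.f j) ∈ nil K (toS K A (.e (some i))) := by
  by_cases h : i = j
  · subst h
    refine mem_nil_of_br (mem_nil_of_br ?_)
    rw [toS_e_f_same, anti (e_some_mem_ev _), toS_h_e _ _ rfl]
    exact neg_mem (Submodule.smul_mem _ _ (D.e_mem_nil_e _ _))
  · exact mem_nil_of_br_eq_zero (toS_e_f_ne (by simpa using h))

theorem e_mem_nil_f (D : AffineData K A) (i : OverNode I) (j : SuperNode I) :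
    toS K A (.e j) ∈ nil K (toS K A (.f i)) := by
  by_cases h : j = some i
  · subst h
    refine mem_nil_of_br (mem_nil_of_br ?_)
    rw [anti (f_mem_ev _) (toS K A (.e _)), toS_e_f_same, br_neg, anti (f_mem_ev _),
      toS_h_f _ _ rfl]
    simpa using Submodule.smul_mem _ _ (D.f_mem_nil_f _ _)
  · exact mem_nil_of_br_eq_zero (br_eq_zero_of_e_f h)

/-- For b ≠ a, Φ_b is half of [e_b,[f_b,Φ_b]], and e_a kills [f_b,Φ_b]. For a itself, Φ_a is a
multiple of [f_a,[e_a,Φ_b]] with b a neighbour of a. -/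
theorem φ_mem_nil_e (D : AffineData K A) (a k : AffineNode I) :
    toS K A (.φ k) ∈ nil K (toS K A (.e (some (some a)))) := by
  have hx := e_some_mem_ev (K := K) (A := A) (some a)
  have H {b : AffineNode I} (hb : b ≠ a) :
      toS K A (.φ b) ∈ nil K (toS K A (.e (some (some a)))) := by
    have h1 := toS_e_f_φ_same (K := K) (A := A) b b
    rw [D.diag] at h1
    refine ((nil K _).smul_mem_iff (two_ne_zero (α := K))).1 ?_
    rw [← Int.cast_two, ← h1]
    exact br_mem_nil hx (D.e_mem_nil_e _ _) (mem_nil_of_br_eq_zero (toS_e_f_φ_ne hb.symm b))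
  by_cases hk : k = a
  · obtain ⟨b, hb, hA⟩ := D.neighbour a
    rw [hk]
    refine ((nil K _).smul_mem_iff (Int.cast_ne_zero.2 hA : (A b a : K) ≠ 0)).1 ?_
    rw [← toS_f_e_φ_same]
    exact br_mem_nil hx (D.f_mem_nil_e _ _) (br_mem_nil hx (D.e_mem_nil_e _ _) (H hb))
  · exact H hk

theorem φ_mem_nil_f (D : AffineData K A) (a k : AffineNode I) :
    toS K A (.φ k) ∈ nil K (toS K A (.f (some a))) := by
  have hx := f_mem_ev (K := K) (A := A) (some a)
  have H {b : AffineNode I} (hb : b ≠ a) :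
      toS K A (.φ b) ∈ nil K (toS K A (.f (some a))) := by
    have h1 := toS_f_e_φ_same (K := K) (A := A) b b
    rw [D.diag] at h1
    refine ((nil K _).smul_mem_iff (two_ne_zero (α := K))).1 ?_
    rw [← Int.cast_two, ← h1]
    exact br_mem_nil hx (D.f_mem_nil_f _ _) (mem_nil_of_br_eq_zero (toS_f_e_φ_ne hb.symm b))
  by_cases hk : k = a
  · obtain ⟨b, hb, hA⟩ := D.neighbour a
    rw [hk]
    refine ((nil K _).smul_mem_iff (Int.cast_ne_zero.2 hA : (A b a : K) ≠ 0)).1 ?_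
    rw [← toS_e_f_φ_same]
    exact br_mem_nil hx (D.e_mem_nil_f _ _) (br_mem_nil hx (D.f_mem_nil_f _ _) (H hb))
  · exact H hk

theorem nil_e (D : AffineData K A) (i : OverNode I) (v : S K A) :
    v ∈ nil K (toS K A (.e (some i))) := by
  refine mem_nil_of_toS (e_some_mem_ev i) (D.e_mem_nil_e i) (D.f_mem_nil_e i) (fun k => ?_) v
  cases i with
  | none => exact mem_nil_of_br_eq_zero (toS_e_φ k)
  | some a => exact D.φ_mem_nil_e a k

theorem nil_f (D : AffineData K A) (i : OverNode I) (v : S K A) :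
    v ∈ nil K (toS K A (.f i)) := by
  refine mem_nil_of_toS (f_mem_ev i) (D.e_mem_nil_f i) (D.f_mem_nil_f i) (fun k => ?_) v
  cases i with
  | none => exact mem_nil_of_br (mem_nil_of_br_eq_zero (toS_f_f_φ k))
  | some a => exact D.φ_mem_nil_f a k

variable [DecidableEq I]

/-- The tensor hierarchy algebra. -/
def hierarchy (D : AffineData K A) : Hierarchy K (S K A) I where
  A := A
  e a := toS K A (.e (some (some a)))
  f a := toS K A (.f (some a))
  h a := toS K A (.h (some a))
  Φ a := toS K A (.φ a)
  ε := toS K A (.e none)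
  e_ev a := e_some_mem_ev _
  f_ev a := f_mem_ev _
  Φ_od := φ_mem_od
  ε_od := ε_mem_od
  A_diag := D.diag
  h_e a b := toS_h_e _ _ (superCartan_some_some a b)
  h_f a b := toS_h_f _ _ (superCartan_some_some a b)
  e_f_same a := toS_e_f_same _
  e_f_ne h := toS_e_f_ne (by simpa using h)
  h_Φ a b := by
    rw [toS_h_φ (c := 0) _ _ (by cases a <;> rfl)]; simp
  e_f_Φ_same := toS_e_f_φ_same
  e_f_Φ_ne k h := toS_e_f_φ_ne h k
  ε_e a := toS_serre_e 0 (by cases a <;> rfl)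
  ε_f a := toS_e_f_ne (by simp)
  ε_Φ := toS_ε_φ
  ε_ε := toS_serre_e 0 rfl
  Φ_Φ := toS_φ_φ
  e_nil a := D.nil_e _
  f_nil a := D.nil_f _
  E := toS K A (.e (some none))
  F := toS K A (.f none)
  E_ev := e_some_mem_ev _
  F_ev := f_mem_ev _
  E_e i := toS_serre_e 0 rfl
  E_f a := toS_e_f_ne (by simp)
  F_e a := br_eq_zero_of_e_f (by simp)
  F_f i := toS_serre_f 0 rfl
  F_ε := br_eq_zero_of_e_f (by simp)
  h_E := by rw [toS_h_e (c := -1) _ _ rfl]; simp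
  h_F := by rw [toS_h_f (c := -1) _ _ rfl]; simp
  H_E := by rw [toS_e_f_same, toS_h_e (c := 2) _ _ rfl]; simp
  H_F := by rw [toS_e_f_same, toS_h_f (c := 2) _ _ rfl]; simp
  H_ε := by rw [toS_e_f_same, toS_h_e (c := -1) _ _ rfl]; simp
  H_Φ a := by rw [toS_e_f_same, toS_h_φ (c := -1) _ _ rfl]; simp
  H_e := by rw [toS_e_f_same, toS_h_e (c := -1) _ _ rfl]; simp
  E_E_ε := toS_serre_e (i := some none) (j := none) 1 rfl
  E_Φ := toS_e_φ
  F_F_Φ := toS_f_f_φ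
  Φ_F_Φ := toS_φ_f_φ
  E_nil := D.nil_e none
  F_nil := D.nil_f none
  comark := D.comark
  comark_sum := D.comark_sum
  pos := D.pos
  nondeg := D.nondeg
  conn := D.conn

/-- The grading by the degree at the affine node. -/
def grading (D : AffineData K A) : D.hierarchy.Grading where
  P0 := nodeSpan K A (some (some none)) (fun n => n = 0)
  Ppos := nodeSpan K A (some (some none)) (fun n => 0 < n)
  P0_P0 := br_mem_nodeSpan (by omega)
  P0_Ppos := br_mem_nodeSpan (by omega)
  Ppos_P0 := br_mem_nodeSpan (by omega)
  Ppos_Ppos := br_mem_nodeSpan (by omega)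
  e_P0 i := monS_mem_nodeSpan (u := .of _) (by simp [degree, Gen.degree])
  f_P0 i := monS_mem_nodeSpan (u := .of _) (by simp [degree, Gen.degree])
  E_P0 := monS_mem_nodeSpan (u := .of _) (by simp [degree, Gen.degree])
  F_P0 := monS_mem_nodeSpan (u := .of _) (by simp [degree, Gen.degree])
  ε_P0 := monS_mem_nodeSpan (u := .of _) (by simp [degree, Gen.degree])
  Φ_P0 a := monS_mem_nodeSpan (u := .of _) (by simp [degree, Gen.degree])
  e_Ppos := monS_mem_nodeSpan (u := .of _) (by simp [degree, Gen.degree])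
  eq_bot W hW he hf hE hF hε hΦ := by
    have he' (i) : ∀ w ∈ W, ⁅toS K A (.e i), w⁆ ∈ W := by
      rcases i with _ | _ | a
      exacts [hε, hE, he a]
    have hf' (i) : ∀ w ∈ W, ⁅toS K A (.f i), w⁆ ∈ W := by
      rcases i with _ | a
      exacts [hF, hf a]
    refine eq_bot_of_proj_zero (fun x w hw => ?_) fun w hw => ?_
    · cases x with
      | e i => exact he' i w hw
      | f i => exact hf' i w hw
      | φ i => exact hΦ i w hw
      | h i =>
        rw [← toS_e_f_same, ← sub_eq_iff_eq_add.2 (jac (e_some_mem_ev i) _ _)]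
        exact sub_mem (he' _ _ (hf' _ _ hw)) (hf' _ _ (he' _ _ hw))
    · refine eq_of_nodeSpan (proj K A 0) 0 (fun u hu => ?_) (hW hw)
      rw [proj_monS, if_neg]
      · rfl
      · intro h; rw [h] at hu; exact absurd hu (by simp)

end AffineData

/-! ### Highest root vectors -/

/-- A vector of weight `w n` in a sum of weight spaces lies in the one of index `n`. -/
theorem mem_of_weight {K L α β : Type*} [Field K] [AddCommGroup L] [Module K L]
    (C : α → Submodule K L) (T : β → Module.End K L) (w : β → α → K)
    (hC : ∀ γ, ∀ y ∈ C γ, ∀ j, T j y = w j γ • y) {n : α} (hn : ∀ γ, γ ≠ n → ∃ j, w j γ ≠ w j n)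
    {x : L} (hx : ∀ j, T j x = w j n • x) (hxC : x ∈ ⨆ γ, C γ) : x ∈ C n := by
  classical
  obtain ⟨s, hs⟩ := Submodule.mem_iSup_iff_exists_finset.1 hxC
  replace hs : x ∈ C n ⊔ ⨆ γ ∈ s, C γ := Submodule.mem_sup_right hs
  induction s using Finset.induction_on with
  | empty => simpa using hs
  | insert γ s _ ih =>
    rw [Finset.iSup_insert] at hs
    by_cases hγ : γ = n
    · rw [hγ, ← sup_assoc, sup_idem] at hs
      exact ih hs
    obtain ⟨j, hj⟩ := hn γ hγ
    -- The operator T_j − w_j(γ) kills the summand γ, preserves the others and scales x by a nonzero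
    -- number, so that summand can be dropped.
    refine ih (((C n ⊔ ⨆ γ ∈ s, C γ).smul_mem_iff (sub_ne_zero.2 hj.symm)).1 ?_)
    have h (δ) : C δ ≤ (C δ).comap (T j - w j γ • 1) := fun y hy => by
      have : (T j - w j γ • 1) y = (w j δ - w j γ) • y := by
        simp [hC δ y hy j, sub_smul]
      rw [Submodule.mem_comap, this]
      exact Submodule.smul_mem _ _ hy
    have h' : C n ⊔ (C γ ⊔ ⨆ δ ∈ s, C δ) ≤
        (C n ⊔ ⨆ δ ∈ s, C δ).comap (T j - w j γ • 1) := by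
      refine sup_le ((h n).trans (Submodule.comap_mono le_sup_left)) (sup_le (fun y hy => ?_)
        (iSup₂_le fun δ hδ => (h δ).trans (Submodule.comap_mono ?_)))
      · simp [hC γ y hy j]
      · exact (le_iSup₂ (f := fun δ (_ : δ ∈ s) => C δ) δ hδ).trans le_sup_right
    have := h' hs
    simpa [hx j, ← sub_smul] using this

namespace AffineData

variable {I : Type*} {K : Type*} [Field K] [Fintype I] [DecidableEq I]
  {A : Matrix (AffineNode I) (AffineNode I) ℤ}

/-- Even elements of `S` that behave like brackets of raising operators with content `n`. -/
def contentSpace (K : Type*) [Field K] (A : Matrix (AffineNode I) (AffineNode I) ℤ) (n : I → ℕ) :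
    Submodule K (S K A) where
  carrier := {x | x ∈ ev (K := K) ∧ (∀ M : (I → ℕ) → Submodule K (S K A),
    (∀ γ i v, v ∈ M γ → ⁅toS K A (.e (some (some (some i)))), v⁆ ∈ M (γ + Pi.single i 1)) →
      ∀ γ v, v ∈ M γ → ⁅x, v⁆ ∈ M (γ + n)) ∧
    ∀ i, ⁅toS K A (.h (some (some i))), x⁆ = ((∑ j, A (some i) (some j) * n j : ℤ) : K) • x}
  zero_mem' := ⟨zero_mem _, fun M _ γ v _ => by rw [zero_br]; exact zero_mem _, by simp⟩
  add_mem' := by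
    rintro x y ⟨hx1, hx2, hx3⟩ ⟨hy1, hy2, hy3⟩
    refine ⟨add_mem hx1 hy1, fun M hM γ v hv => ?_, fun i => ?_⟩
    · rw [add_br]; exact add_mem (hx2 M hM γ v hv) (hy2 M hM γ v hv)
    · rw [br_add, hx3, hy3, smul_add]
  smul_mem' := by
    rintro c x ⟨hx1, hx2, hx3⟩
    refine ⟨Submodule.smul_mem _ _ hx1, fun M hM γ v hv => ?_, fun i => ?_⟩
    · rw [smul_br]; exact Submodule.smul_mem _ _ (hx2 M hM γ v hv)
    · rw [br_smul, hx3, smul_comm]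

theorem br_mem_contentSpace {x y : S K A} {m n : I → ℕ} (hx : x ∈ contentSpace K A m)
    (hy : y ∈ contentSpace K A n) : ⁅x, y⁆ ∈ contentSpace K A (m + n) := by
  obtain ⟨hx1, hx2, hx3⟩ := hx
  obtain ⟨hy1, hy2, hy3⟩ := hy
  refine ⟨ev_ev hx1 hy1, fun M hM γ v hv => ?_, fun i => ?_⟩
  · rw [← sub_eq_iff_eq_add.2 (jac hx1 y v)]
    refine sub_mem ?_ ?_
    · rw [add_comm m, ← add_assoc]; exact hx2 M hM _ _ (hy2 M hM _ _ hv)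
    · rw [← add_assoc]; exact hy2 M hM _ _ (hx2 M hM _ _ hv)
  · rw [br_of_wt (h_mem_ev _) (hx3 i) (hy3 i), ← Int.cast_add, ← Finset.sum_add_distrib]
    simp only [Pi.add_apply, Nat.cast_add, mul_add]

theorem e_mem_contentSpace (i : I) :
    toS K A (.e (some (some (some i)))) ∈ contentSpace K A (Pi.single i 1) := by
  refine ⟨e_some_mem_ev _, fun M hM γ v hv => hM γ i v hv, fun j => ?_⟩
  rw [toS_h_e _ _ (superCartan_some_some _ _)]
  congr 2
  rw [Finset.sum_eq_single i (fun k _ hk => by simp [hk]) (by simp)]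
  simp

theorem generatedSubalgebra_le :
    generatedSubalgebra (bracket K A) (Set.range fun i : I =>
      toS K A (.e (some (some (some i))))) ≤ ⨆ n, contentSpace K A n := by
  refine sInf_le ⟨?_, fun x hx y hy => ?_⟩
  · rintro _ ⟨i, rfl⟩
    exact Submodule.mem_iSup_of_mem _ (e_mem_contentSpace i)
  · refine Submodule.iSup_induction (motive := fun x => bracket K A x y ∈ _) _ hx
      (fun m x hx => ?_) (by simp) (fun x x' h h' => by rw [map_add]; exact add_mem h h')
    refine Submodule.iSup_induction (motive := fun y => bracket K A x y ∈ _) _ hy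
      (fun n y hy => ?_) (by simp) (fun x x' h h' => by rw [map_add]; exact add_mem h h')
    exact Submodule.mem_iSup_of_mem _ (br_mem_contentSpace hx hy)

variable [CharZero K] {n : I → ℕ}

/-- Nondegeneracy makes the content a function of the weight, and x has the weight of content n. -/
theorem mem_contentSpace (D : AffineData K A) {x : S K A}
    (hx : x ∈ generatedSubalgebra (bracket K A) (Set.range fun i : I =>
      toS K A (.e (some (some (some i))))))
    (hn : ∀ i, ∑ j, A (some i) (some j) * n j = -A (some i) none)
    (h_x : ∀ i, ⁅toS K A (.h (some (some i))), x⁆ = -(A (some i) none : K) • x) :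
    x ∈ contentSpace K A n := by
  refine mem_of_weight (contentSpace K A) (fun i => ad K (toS K A (.h (some (some i)))))
    (fun i γ => ((∑ j, A (some i) (some j) * γ j : ℤ) : K)) (fun γ y hy i => hy.2.2 i)
    (fun γ hγ => ?_) (fun i => ?_) (generatedSubalgebra_le hx)
  · by_contra! h
    refine hγ (funext fun j => ?_)
    have := D.nondeg (fun j => (γ j : ℤ) - n j) fun l => by
      simp only [mul_sub, Finset.sum_sub_distrib]
      exact sub_eq_zero.2 (Int.cast_injective (h l))
    have := congrFun this j
    simp only [Pi.zero_apply] at this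
    omega
  · rw [hn, ad_apply, h_x, Int.cast_neg]

/-- The highest root vector. -/
def highestRoot (D : AffineData K A) {x : S K A}
    (hx : x ∈ generatedSubalgebra (bracket K A) (Set.range fun i : I =>
      toS K A (.e (some (some (some i))))))
    (hn : ∀ i, ∑ j, A (some i) (some j) * n j = -A (some i) none)
    (h_x : ∀ i, ⁅toS K A (.h (some (some i))), x⁆ = -(A (some i) none : K) • x)
    (e_x : ∀ i, ⁅toS K A (.e (some (some (some i)))), x⁆ = 0)
    (n_ne : ∀ i, n i ≠ 0) {i₁ : I} (i₁_ne : A none (some i₁) ≠ 0)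
    (A_eq_zero : ∀ i, A none (some i) ≠ 0 → A (some i) none ≠ 0)
    (A_eq : ∀ i, A (some i) none ≠ 0 → A none (some i) = -1 ∨ n = Pi.single i 1) :
    HighestRoot D.hierarchy where
  x := x
  n := n
  i₁ := i₁
  x_ev := (D.mem_contentSpace hx hn h_x).1
  content := (D.mem_contentSpace hx hn h_x).2.1
  n_ne := n_ne
  h_x := h_x
  e_x := e_x
  i₁_ne := i₁_ne
  A_nonpos i := D.nonpos (by simp)
  A_eq_zero := A_eq_zero
  A_eq := A_eq

theorem lowestState_br_lowestState (D : AffineData K A) {x : S K A}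
    (hx : x ∈ generatedSubalgebra (bracket K A) (Set.range fun i : I =>
      toS K A (.e (some (some (some i))))))
    (hn : ∀ i, ∑ j, A (some i) (some j) * n j = -A (some i) none)
    (h_x : ∀ i, ⁅toS K A (.h (some (some i))), x⁆ = -(A (some i) none : K) • x)
    (e_x : ∀ i, ⁅toS K A (.e (some (some (some i)))), x⁆ = 0)
    (n_ne : ∀ i, n i ≠ 0) {i₁ : I} (i₁_ne : A none (some i₁) ≠ 0)
    (A_eq_zero : ∀ i, A none (some i) ≠ 0 → A (some i) none ≠ 0)
    (A_eq : ∀ i, A (some i) none ≠ 0 → A none (some i) = -1 ∨ n = Pi.single i 1) :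
    ⁅lowestState i₁ x, ⁅toS K A (.e (some none)), lowestState i₁ x⁆⁆ = 0 := by
  let X := D.highestRoot hx hn h_x e_x n_ne i₁_ne A_eq_zero A_eq
  -- Since x commutes with F, the inner bracket is [F,φ]; since ε kills Y, [ε,[E,Y]] equals
  -- [[ε,E],Y].
  have hJ : lowestState i₁ x = X.J := by
    have h1 : ⁅x, ⁅toS K A (.f none), toS K A (.φ (some i₁))⁆⁆ = ⁅D.hierarchy.F, X.φ⁆ :=
      comm X.x_ev X.x_F _
    have h2 := jac_od_ev (x := D.hierarchy.ε) D.hierarchy.E_ev X.Y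
    rw [X.ε_Y, br_zero, add_zero] at h2
    rw [lowestState, h1]
    exact h2
  rw [hJ]
  exact HighestRoot.J_E_J D.grading X

end AffineData

/-! ### The affine Cartan matrix of an irreducible root system -/

section RootData

open RootPairing

variable {ι K M N : Type*} [Field K] [AddCommGroup M] [Module K M] [AddCommGroup N]
  [Module K N] {P : RootPairing ι K M N} [P.IsRootSystem] (b : P.Base) {θ : ι}

theorem pairing_eq_sum (i : ι) (x : M) :
    P.coroot' i x = ∑ j : b.support, b.toWeightBasis.repr x j * P.pairing j i := by
  conv_lhs => rw [← b.toWeightBasis.sum_repr x]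
  simp

theorem repr_of_mem_closure {x : M} (hx : x ∈ AddSubmonoid.closure (P.root '' b.support))
    (j : b.support) : ∃ m : ℕ, b.toWeightBasis.repr x j = m := by
  classical
  induction hx using AddSubmonoid.closure_induction with
  | mem x hx =>
    obtain ⟨i, hi, rfl⟩ := hx
    refine ⟨if (⟨i, hi⟩ : b.support) = j then 1 else 0, ?_⟩
    rw [b.toWeightBasis_repr_root ⟨i, hi⟩, Finsupp.single_apply]
    split_ifs <;> simp
  | zero => exact ⟨0, by simp⟩
  | add x y _ _ hx hy =>
    obtain ⟨m, hm⟩ := hx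
    obtain ⟨n, hn⟩ := hy
    exact ⟨m + n, by simp [hm, hn]⟩

/-- The coefficients of the highest root are positive. -/
theorem IsHighestRoot.exists_coeff (hθ : IsHighestRoot b θ) :
    ∃ n : b.support → ℕ, (∀ j, n j ≠ 0) ∧ ∀ j, b.toWeightBasis.repr (P.root θ) j = n j := by
  have h (j : b.support) : ∃ m : ℕ, m ≠ 0 ∧ b.toWeightBasis.repr (P.root θ) j = m := by
    obtain ⟨m, hm⟩ := repr_of_mem_closure b (hθ j) j
    refine ⟨m + 1, by omega, ?_⟩
    rw [map_sub, b.toWeightBasis_repr_root, Finsupp.sub_apply, Finsupp.single_eq_same] at hm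
    rw [Nat.cast_add_one, ← hm, sub_add_cancel]
  choose n hn using h
  exact ⟨n, fun j => (hn j).1, fun j => (hn j).2⟩

theorem sum_affineCartan [CharZero K] [P.IsCrystallographic] {n : b.support → ℕ}
    (hn : ∀ j, b.toWeightBasis.repr (P.root θ) j = n j) (i : b.support) :
    ∑ j, affineCartan b θ (some i) (some j) * n j = -affineCartan b θ (some i) none := by
  have h := pairing_eq_sum b i (P.root θ)
  simp only [hn, P.root_coroot'_eq_pairing, ← P.algebraMap_pairingIn ℤ] at h
  refine Int.cast_injective (α := K) ?_
  simp only [affineCartan, neg_neg]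
  simp only [algebraMap_int_eq, eq_intCast] at h
  rw [h]
  push_cast
  exact Finset.sum_congr rfl fun j _ => mul_comm _ _

variable [CharZero K] [Finite ι] [P.IsCrystallographic]

/-- A negative pairing would make θ + α_i a root, or θ = −α_i. Either way maximality of θ makes a
negative multiple of α_i a sum of simple roots. -/
theorem IsHighestRoot.pairingIn_nonneg (hθ : IsHighestRoot b θ) (i : b.support) :
    0 ≤ P.pairingIn ℤ θ i := by
  by_contra! h
  have key (k : ℕ) (hk : k ≠ 0) : -((k : K) • P.root i) ∉
      AddSubmonoid.closure (P.root '' b.support) := fun hmem => by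
    obtain ⟨m, hm⟩ := repr_of_mem_closure b hmem i
    rw [map_neg, map_smul, b.toWeightBasis_repr_root, Finsupp.neg_apply, Finsupp.smul_apply,
      Finsupp.single_eq_same, smul_eq_mul, mul_one, neg_eq_iff_add_eq_zero] at hm
    norm_cast at hm
    omega
  by_cases h' : P.root θ = -P.root i
  · refine key 2 two_ne_zero ?_
    have := hθ i
    rw [h'] at this
    convert this using 1
    push_cast
    rw [two_smul]; abel
  · obtain ⟨β, hβ⟩ := P.root_add_root_mem_of_pairingIn_neg h h'
    refine key 1 one_ne_zero ?_
    have := hθ β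
    rw [hβ] at this
    convert this using 1
    push_cast
    rw [one_smul]; abel

theorem IsHighestRoot.pairingIn_nonneg' (hθ : IsHighestRoot b θ) (i : b.support) :
    0 ≤ P.pairingIn ℤ i θ := by
  by_contra! h
  exact (hθ.pairingIn_nonneg b i).not_gt ((P.pairingIn_lt_zero_iff ℤ).1 h)

/-- A simple root that is not orthogonal to the highest root has pairing one with its coroot,
except in rank one. -/
theorem IsHighestRoot.pairingIn_eq_one (hθ : IsHighestRoot b θ) {n : b.support → ℕ}
    (hn0 : ∀ j, n j ≠ 0) (hn : ∀ j, b.toWeightBasis.repr (P.root θ) j = n j) {i : b.support}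
    [DecidableEq b.support] (hi : P.pairingIn ℤ i θ ≠ 0) :
    P.pairingIn ℤ i θ = 1 ∨ n = Pi.single i 1 := by
  have h0 := hθ.pairingIn_nonneg' b i
  obtain ⟨k, hk⟩ := Int.eq_ofNat_of_zero_le h0
  by_cases h1 : k ≤ 1
  · left; omega
  right
  -- This index is that of −s_θ(α_i) = ⟨α_i,θ^∨⟩θ − α_i. If the pairing is at least 2, comparing
  -- this root with θ forces θ = α_i, because every coefficient of θ is at least 1.
  have hmem := hθ (P.reflectionPerm (P.reflectionPerm θ i) (P.reflectionPerm θ i))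
  obtain ⟨k, rfl⟩ : ∃ l, k = l + 2 := ⟨k - 2, by omega⟩
  have hroot : P.root θ - P.root (P.reflectionPerm (P.reflectionPerm θ i) (P.reflectionPerm θ i)) =
      P.root i - ((k + 1 : ℕ) : K) • P.root θ := by
    have : P.pairing i θ = ((k + 2 : ℕ) : K) := by
      rw [← P.algebraMap_pairingIn ℤ, hk]; simp
    rw [P.root_reflectionPerm, P.reflection_apply_self, P.root_reflectionPerm,
      P.reflection_apply_root, this]
    push_cast
    module
  rw [hroot] at hmem
  funext j
  obtain ⟨m, hm⟩ := repr_of_mem_closure b hmem j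
  have h2 : m + (k + 1) * n j = if i = j then 1 else 0 := by
    rw [map_sub, map_smul, b.toWeightBasis_repr_root, Finsupp.sub_apply, Finsupp.smul_apply, hn,
      Finsupp.single_apply, smul_eq_mul, sub_eq_iff_eq_add] at hm
    have : (((if i = j then 1 else 0 : ℕ)) : K) = ((m + (k + 1) * n j : ℕ) : K) := by
      push_cast; push_cast at hm; exact hm
    exact (Nat.cast_injective this).symm
  have h3 := hn0 j
  rw [Pi.single_apply]
  by_cases hij : i = j
  · subst hij
    simp only [if_true] at h2 ⊢
    nlinarith [Nat.pos_of_ne_zero h3]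
  · rw [if_neg hij] at h2
    have : (k + 1) * n j = 0 := by omega
    simp [h3] at this

/-- The affine Cartan matrix of an irreducible root system. -/
def affineData [P.IsReduced] [P.IsIrreducible] (hθ : IsHighestRoot b θ) :
    AffineData K (affineCartan b θ) where
  diag a := by
    cases a with
    | none => rfl
    | some i => exact P.pairingIn_same ℤ i
  nonpos {a c} h := by
    match a, c, h with
    | none, some j, _ => exact neg_nonpos.2 (hθ.pairingIn_nonneg' b j)
    | some i, none, _ => exact neg_nonpos.2 (hθ.pairingIn_nonneg b i)
    | some i, some j, h => exact b.cartanMatrix_le_zero_of_ne j i (by simpa using Ne.symm h)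
  neighbour a := by
    obtain ⟨n, hn0, hn⟩ := hθ.exists_coeff b
    by_contra! h
    match a, h with
    | none, h =>
      obtain ⟨i, hi⟩ := b.exists_mem_support_pos_pairingIn_ne_zero θ
      have := h (some ⟨i, hi.1⟩) (by simp)
      exact hi.2 (P.pairingIn_eq_zero_iff.1 (neg_eq_zero.1 this))
    | some i, h =>
      -- An isolated node i would give 2nᵢ = 0 for the positive coefficient nᵢ of the highest root.
      have h1 := sum_affineCartan b hn i
      rw [Finset.sum_eq_single i (fun j _ hj => ?_) (by simp)] at h1
      · have h2 : affineCartan b θ (some i) (some i) = 2 := P.pairingIn_same ℤ i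
        have h3 := P.pairingIn_eq_zero_iff.1 (neg_eq_zero.1 (h none (by simp)))
        have h4 : affineCartan b θ (some i) none = 0 := neg_eq_zero.2 h3
        rw [h2, h4] at h1
        have := hn0 i
        omega
      · have := h (some j) (by simpa using hj)
        rw [show affineCartan b θ (some i) (some j) = 0 from P.pairingIn_eq_zero_iff.1 this,
          zero_mul]
  -- Row 0 of the affine matrix pairs with −θ^∨, so the dependence between the rows is the expansion
  -- of θ^∨ in simple coroots.
  comark := b.toCoweightBasis.repr (P.coroot θ)
  comark_sum a := by
    have h (i : ι) : P.pairing i θ =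
        ∑ k, b.toCoweightBasis.repr (P.coroot θ) k * P.pairing i k := by
      have := congrArg (P.root' i) (b.toCoweightBasis.sum_repr (P.coroot θ))
      simpa using this.symm
    have hc (i j : ι) : (P.pairingIn ℤ i j : K) = P.pairing i j := P.algebraMap_pairingIn ℤ i j
    match a with
    | none =>
      have := h θ
      simp only [affineCartan, Int.cast_neg, hc, mul_neg, Finset.sum_neg_distrib, ← this,
        P.pairing_same]
      norm_num
    | some j =>
      simp only [affineCartan, Int.cast_neg, hc, ← h]
      ring
  pos γ hγ := by
    classical
    obtain ⟨d, hd, h⟩ := b.exists_cartanMatrix_mul_diagaonal_posDef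
    -- For an antidominant γ the symmetrized Cartan form would be Σ dᵢ γᵢ·wtᵢ ≤ 0, contradicting
    -- positive definiteness.
    by_contra! hneg
    have h1 := h.dotProduct_mulVec_pos (x := fun j => (γ j : ℤ))
      (fun h0 => hγ (funext fun j => by simpa using congrFun h0 j))
    refine h1.not_ge ?_
    have h2 : (star fun j => (γ j : ℤ)) ⬝ᵥ ((b.cartanMatrix * Matrix.diagonal d).mulVec
        fun j => (γ j : ℤ)) = ∑ i, d i * γ i *
          ∑ j, affineCartan b θ (some i) (some j) * γ j := by
      simp only [dotProduct, Matrix.mulVec, Matrix.mul_diagonal, Finset.mul_sum]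
      rw [Finset.sum_comm]
      refine Finset.sum_congr rfl fun i _ => Finset.sum_congr rfl fun j _ => ?_
      simp only [affineCartan, RootPairing.Base.cartanMatrixIn_def, Pi.star_apply, star_trivial]
      ring
    rw [h2]
    exact Finset.sum_nonpos fun i _ => mul_nonpos_of_nonneg_of_nonpos
      (mul_nonneg (hd i).le (Int.natCast_nonneg _)) (hneg i)
  nondeg x hx := by
    classical
    refine Matrix.eq_zero_of_vecMul_eq_zero
      (Matrix.nondegenerate_iff_det_ne_zero.1 b.cartanMatrix_nondegenerate) ?_
    funext l
    refine Eq.trans ?_ (hx l)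
    exact Finset.sum_congr rfl fun j _ => mul_comm _ _
  conn Q i j hQ hi := by
    refine b.induction_on_cartanMatrix Q hi fun i j hi hij => hQ i j ?_ hi
    exact hij

theorem lowestState_br_lowestState_of_isHighestRootVector [P.IsReduced] [P.IsIrreducible]
    (hθ : IsHighestRoot b θ) {i₁ : b.support} (hi₁ : affineCartan b θ none (some i₁) ≠ 0)
    {x : S K (affineCartan b θ)} (hx : IsHighestRootVector b θ x) :
    ⁅lowestState i₁ x, ⁅toS K (affineCartan b θ) (.e (some none)), lowestState i₁ x⁆⁆ = 0 := by
  classical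
  obtain ⟨n, hn0, hn⟩ := hθ.exists_coeff b
  obtain ⟨hx1, hx2, hx3⟩ := hx
  have hzero (i : b.support) :
      affineCartan b θ none (some i) ≠ 0 ↔ affineCartan b θ (some i) none ≠ 0 :=
    (neg_ne_zero.trans P.pairingIn_eq_zero_iff.not).trans neg_ne_zero.symm
  refine (affineData b hθ).lowestState_br_lowestState hx1 (sum_affineCartan b hn) (fun i => ?_)
    hx3 hn0 hi₁ (fun i => (hzero i).1) fun i hi => ?_
  · rw [hx2 i]
    simp [affineCartan]
  · refine (hθ.pairingIn_eq_one b hn0 hn (neg_ne_zero.1 ((hzero i).2 hi))).imp_left fun h => ?_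
    simp [affineCartan, h]

end RootData

end TensorHierarchy

end

theorem mainTheorem3 {K 𝔤 : Type*} [Field K] [CharZero K] [LieRing 𝔤] [LieAlgebra K 𝔤]
    [FiniteDimensional K 𝔤] [LieAlgebra.IsSimple K 𝔤]
    (H : LieSubalgebra K 𝔤) [H.IsCartanSubalgebra] [LieModule.IsTriangularizable K H 𝔤]
    (b : (LieAlgebra.IsKilling.rootSystem H).Base)
    (θ : H.root) (hθ : TensorHierarchy.IsHighestRoot b θ)
    (i₁ : b.support) (hi₁ : TensorHierarchy.affineCartan b θ none (some i₁) ≠ 0)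
    (eθ : TensorHierarchy.S K (TensorHierarchy.affineCartan b θ))
    (heθ : TensorHierarchy.IsHighestRootVector b θ eθ) :
    ⁅TensorHierarchy.lowestState i₁ eθ,
      ⁅TensorHierarchy.toS K (TensorHierarchy.affineCartan b θ) (.e (some none)),
        TensorHierarchy.lowestState i₁ eθ⁆⁆ = 0 :=
  TensorHierarchy.lowestState_br_lowestState_of_isHighestRootVector b hθ hi₁ heθ
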